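/- **Setting.** Let $\Phi:\mathbb Z\to\mathbb R$ satisfy: $|\Phi(x)|\le C_\Phi e^{-\delta|x|}$ for some $C_\Phi,\delta>0$; $\Phi(-x)=\Phi(x)$; and $\hat\Phi(k):=\sum_x\Phi(x)e^{-i2\pi kx}\ge\omega_0^2$ for all $k$, for some $\omega_0>0$. Put $\omega(k)=\sqrt{\hat\Phi(k)}$. Let $\gamma>0$ satisfy $\gamma^2>4\max_k\hat\Phi(k)$, and put $u(k)=\sqrt{(\gamma/2)^2-\omega(k)^2}$, $\mu_\pm(k)=\gamma/2\pm u(k)$ and $\hat A^2_t(k)=\frac1{2u(k)}\bigl(\mu_+(k)e^{-t\mu_+(k)}-\mu_-(k)e^{-t\mu_-(k)}\bigr)$. Assume that for every $\varepsilon>0$ there is $C_\varepsilon>0$ with $$\int_0^\infty\!dt\int_{-1/2}^{1/2}\!dk\,\bigl(\hat A^2_t(k+\tfrac{k_0}2)-\hat A^2_t(k-\tfrac{k_0}2)\bigr)^2\ge C_\varepsilon\quad\text{whenever }\varepsilon\le|k_0|\le\tfrac12 .$$ For $L\ge1$ let $\Lambda_L=\mathbb Z\cap(-L/2,L/2]$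 with arithmetic modulo $L$, and $\Lambda_L^*=\Lambda_L/L$. Let $\Phi_L$ be the matrix $(\Phi_L)_{x'x}=\frac1L\sum_{k\in\Lambda_L^*}e^{i2\pi k(x'-x)}\omega(k)^2$ and $$M_\gamma=\begin{pmatrix}0&\Phi_L\\-1&\gamma 1\end{pmatrix},\qquad H_L(X)=\tfrac12\sum_x(X^2_x)^2+\tfrac12\sum_{x',x}X^1_{x'}X^1_x(\Phi_L)_{x'x}$$ on phase space points $X=(X^1,X^2)\in\mathbb R^{\Lambda_L}\times\mathbb R^{\Lambda_L}$ (positions and momenta; the upper index is a label). Let $p_{t,x}=2\gamma\bigl((e^{-tM_\gamma})^{22}_{-x,0}\bigr)^2$. For a random initial field $X(0)$ with finite second moments let $(\Gamma_x)^{i'i}_{y'y}=\langle X(0)^{i'}_{x+y'}X(0)^i_{x+y}\rangle$, $g_{t,x}=(e^{-tM_\gamma^T}\Gamma_xe^{-tM_\gamma})^{22}_{00}$ and $\mathcal E=L^{-1}\langle H_L(X(0))\rangle$. The renewal equation for the kinetic temperature profile is $$T_{t,x}=g_{t,x}+\int_0^t\!ds\sum_{y\in\Lambda_L}p_{s,y}\,T_{t-s,x-y},\qquad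 t\ge0,\ x\in\Lambda_L. \tag{1}$$ **Theorem.** There are $L_0\in\mathbb N$ and constants $C,d,\varepsilon_0,\beta>0$, depending only on $\Phi$ and $\gamma$, such that the following holds for every $L\ge L_0$. (a) The functions $s\mapsto p_{s,x}$ are integrable on $(0,\infty)$, and $\tilde p_x:=\frac\gamma2\int_0^\infty p_{s,x}\,ds\ge0$. (b) For each $k\in\Lambda_L^*$ with $|k|\le\varepsilon_0$ there is a unique $R(k)\in[0,\beta]$ with $1=\int_0^\infty e^{sR(k)}\sum_{y\in\Lambda_L}p_{s,y}\cos(2\pi ky)\,ds$, and $\frac1{a(k)}=\int_0^\infty s\,e^{sR(k)}\sum_{y\in\Lambda_L}p_{s,y}\cos(2\pi ky)\,ds$ defines $a(k)>0$. For $|k|>\varepsilon_0$ put $R(k)=\beta$, $a(k)=0$. (c) For every $X(0)$ with finite second moments, $\langle|H_L(X(0))|\rangle<\infty$, each $s\mapsto g_{s,x}$ is integrable on $(0,\infty)$, and (1) has a unique solution $T_{t,x}$ continuous in $t\in[0,\infty)$. It satisfies $$|T_{t,x}-\mathcal E|\le C\mathcal E\,\frac{e^{-dtL^{-2}}}{1-e^{-2dtL^{-2}}}\qquad\text{for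 all }t>0,\ x\in\Lambda_L .$$ Moreover the numbers $\tau_x:=\sum_{y\in\Lambda_L}\frac1L\sum_{k\in\Lambda_L^*}e^{i2\pi k(x-y)}a(k)\int_0^\infty g_{s,y}\,ds$ are real, and with $(D\tau)_x:=\sum_{y\in\Lambda_L}\tilde p_y(2\tau_x-\tau_{x+y}-\tau_{x-y})$, $$|T_{t,x}-(e^{-tD}\tau)_x|\le C\mathcal E\,L\,t^{-3/2}\qquad\text{for all }t>0,\ x\in\Lambda_L .$$ -/

import Mathlib

open MeasureTheory Set
open scoped Matrix

noncomputable section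

namespace VelocityFlip

/-! ### Interaction and dispersion relation in infinite volume -/

/-- The Fourier transform `Φ̂(k) = ∑ₓ Φ(x) e^{-i 2π k x}` of `Φ : ℤ → ℝ`.  The sum is real for the
symmetric `Φ` considered here, and we record it as a real number. -/
def hatPhi (Φ : ℤ → ℝ) (k : ℝ) : ℝ :=
  (∑' x : ℤ, (Φ x : ℂ) * Complex.exp (-(Complex.I * (2 * Real.pi * k * x : ℝ)))).re

/-- The dispersion relation `ω(k) = √Φ̂(k)`. -/
def omega (Φ : ℤ → ℝ) (k : ℝ) : ℝ := Real.sqrt (hatPhi Φ k)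

/-- `u(k) = √((γ/2)² - ω(k)²)`; it is only used when `ω(k) < γ/2` for all `k`. -/
def uFun (Φ : ℤ → ℝ) (γ k : ℝ) : ℝ := Real.sqrt ((γ / 2) ^ 2 - omega Φ k ^ 2)

/-- `μ₊(k) = γ/2 + u(k)`. -/
def muPlus (Φ : ℤ → ℝ) (γ k : ℝ) : ℝ := γ / 2 + uFun Φ γ k

/-- `μ₋(k) = γ/2 - u(k)`. -/
def muMinus (Φ : ℤ → ℝ) (γ k : ℝ) : ℝ := γ / 2 - uFun Φ γ k

/-- `Â²ₜ(k) = (2u(k))⁻¹ (μ₊(k) e^{-tμ₊(k)} - μ₋(k) e^{-tμ₋(k)})`. -/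
def hatA2 (Φ : ℤ → ℝ) (γ t k : ℝ) : ℝ :=
  1 / (2 * uFun Φ γ k) *
    (muPlus Φ γ k * Real.exp (-t * muPlus Φ γ k) - muMinus Φ γ k * Real.exp (-t * muMinus Φ γ k))

/-- Assumptions on the interaction `Φ`. -/
structure PhiAssumption (Φ : ℤ → ℝ) : Prop where
  exp_decay : ∃ C > 0, ∃ δ > 0, ∀ x : ℤ, |Φ x| ≤ C * Real.exp (-δ * |(x : ℝ)|)
  symm : ∀ x : ℤ, Φ (-x) = Φ x
  pinning : ∃ ω₀ > 0, ∀ k : ℝ, ω₀ ^ 2 ≤ hatPhi Φ k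

/-- Joint assumptions on the interaction `Φ` and the flip rate `γ`.  As `Φ̂` is continuous and
`1`-periodic, `noise_dominates` says that `γ² > 4 max Φ̂`. -/
structure GammaAssumption (Φ : ℤ → ℝ) (γ : ℝ) : Prop extends PhiAssumption Φ where
  gamma_pos : 0 < γ
  noise_dominates : ∀ k : ℝ, 4 * hatPhi Φ k < γ ^ 2
  nondegenerate : ∀ ε > 0, ∃ Cε > 0, ∀ k₀ : ℝ, ε ≤ |k₀| → |k₀| ≤ 1 / 2 →
    Cε ≤ ∫ t in Ioi (0 : ℝ), ∫ k in (-(1 / 2) : ℝ)..(1 / 2),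
      (hatA2 Φ γ t (k + k₀ / 2) - hatA2 Φ γ t (k - k₀ / 2)) ^ 2

/-! ### The periodic lattice

The lattice `Λ_L` with its periodic arithmetic is `ZMod L`; the representative of `x` in
`(-L/2, L/2]` is `x.valMinAbs`.  The dual lattice `Λ_L^* = Λ_L / L` is indexed by `n : ZMod L`. -/

variable (L : ℕ) [NeZero L]

/-- The point `k = n / L ∈ (-1/2, 1/2]` of the dual lattice. -/
def dualPt (n : ZMod L) : ℝ := (n.valMinAbs : ℝ) / L

/-- The plane wave `e^{i 2π k x}` with `k = n / L`. -/
def wave (n x : ZMod L) : ℂ :=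
  Complex.exp (Complex.I * (2 * Real.pi * dualPt L n * (x.valMinAbs : ℝ) : ℝ))

/-- The finite volume interaction matrix `Φ_L`, fixed by the finite volume dispersion relation
`ω(k; L) = √Φ̂(k)`, `k ∈ Λ_L^*`:
`(Φ_L)_{x',x} = L⁻¹ ∑_{k ∈ Λ_L^*} e^{i 2π k (x' - x)} ω(k)²`.
The sum is real by symmetry and equals `∑_{m ∈ ℤ} Φ(x' - x + mL)`; thus it is `Φ([x' - x]_L)` if `Φ`
is supported on `|x| < L/2`. -/
def phiMat (Φ : ℤ → ℝ) : Matrix (ZMod L) (ZMod L) ℝ :=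
  Matrix.of fun x' x =>
    ((1 / (L : ℂ)) * ∑ n : ZMod L, wave L n (x' - x) * ((omega Φ (dualPt L n) ^ 2 : ℝ) : ℂ)).re

/-- Indices of phase space coordinates: `Sum.inl x` is the position (superscript `1`) and
`Sum.inr x` the momentum (superscript `2`) at site `x`. -/
abbrev Coord := ZMod L ⊕ ZMod L

/-- The phase space `Ω = ℝ^{Λ_L} × ℝ^{Λ_L}`. -/
abbrev Phase := Coord L → ℝ

/-- The Hamiltonian `H_L(X)`. -/
def hamiltonian (Φ : ℤ → ℝ) (X : Phase L) : ℝ :=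
  ∑ x : ZMod L, 1 / 2 * X (Sum.inr x) ^ 2 +
    ∑ x' : ZMod L, ∑ x : ZMod L, 1 / 2 * X (Sum.inl x') * X (Sum.inl x) * phiMat L Φ x' x

/-- The matrix `M_γ = (0, Φ_L; -1, γ)`. -/
def mMat (Φ : ℤ → ℝ) (γ : ℝ) : Matrix (Coord L) (Coord L) ℝ :=
  Matrix.fromBlocks 0 (phiMat L Φ) (-1) (γ • 1)

/-- `A²_{t,x} = (e^{-tM_γ})^{22}_{x0}`. -/
def a2 (Φ : ℤ → ℝ) (γ t : ℝ) (x : ZMod L) : ℝ :=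
  NormedSpace.exp ((-t) • mMat L Φ γ) (Sum.inr x) (Sum.inr 0)

/-- The memory kernel `p_{t,x} = 2γ (A²_{t,-x})²`. -/
def memKernel (Φ : ℤ → ℝ) (γ t : ℝ) (x : ZMod L) : ℝ :=
  2 * γ * a2 L Φ γ t (-x) ^ 2

/-- All second moments of the initial distribution `μ₀` exist. -/
def HasSecondMoments (μ₀ : Measure (Phase L)) : Prop :=
  ∀ j j' : Coord L, Integrable (fun X : Phase L => X j * X j') μ₀

/-- The translated second moment matrix
`(Γ_x)^{i'i}_{y'y} = ⟨X(0)^{i'}_{x+y'} X(0)^i_{x+y}⟩`. -/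
def gammaMat (μ₀ : Measure (Phase L)) (x : ZMod L) : Matrix (Coord L) (Coord L) ℝ :=
  Matrix.of fun j' j =>
    ∫ X : Phase L, X (Sum.map (x + ·) (x + ·) j') * X (Sum.map (x + ·) (x + ·) j) ∂μ₀

/-- The source term `g_{t,x} = (e^{-tM_γᵀ} Γ_x e^{-tM_γ})^{22}_{00}`. -/
def source (Φ : ℤ → ℝ) (γ : ℝ) (μ₀ : Measure (Phase L)) (t : ℝ) (x : ZMod L) : ℝ :=
  (NormedSpace.exp ((-t) • (mMat L Φ γ)ᵀ) * gammaMat L μ₀ x *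
    NormedSpace.exp ((-t) • mMat L Φ γ)) (Sum.inr 0) (Sum.inr 0)

/-- The total energy density `𝓔 = L⁻¹ ⟨H_L(X(0))⟩`. -/
def energyDensity (Φ : ℤ → ℝ) (μ₀ : Measure (Phase L)) : ℝ :=
  (1 / (L : ℝ)) * ∫ X : Phase L, hamiltonian L Φ X ∂μ₀

/-- `T` is a continuous solution on `[0,∞) × Λ_L` of the renewal equation
`T_{t,x} = g_{t,x} + ∫₀ᵗ ds ∑_y p_{s,y} T_{t-s,x-y}`. -/
def IsTempProfile (Φ : ℤ → ℝ) (γ : ℝ) (μ₀ : Measure (Phase L)) (T : ℝ → ZMod L → ℝ) : Prop :=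
  (∀ x, ContinuousOn (fun t => T t x) (Ici 0)) ∧
  ∀ t, 0 ≤ t → ∀ x, T t x = source L Φ γ μ₀ t x +
    ∫ s in (0 : ℝ)..t, ∑ y : ZMod L, memKernel L Φ γ s y * T (t - s) (x - y)

/-! ### The lattice diffusion -/

/-- `p̃_x = (γ/2) ∫₀^∞ p_{s,x} ds`. -/
def pTilde (Φ : ℤ → ℝ) (γ : ℝ) (x : ZMod L) : ℝ :=
  γ / 2 * ∫ s in Ioi (0 : ℝ), memKernel L Φ γ s x

/-- The operator `(Dτ)_x = ∑_y p̃_y (2τ_x - τ_{x+y} - τ_{x-y})`. -/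
def diffOp (Φ : ℤ → ℝ) (γ : ℝ) : (ZMod L → ℝ) →ₗ[ℝ] (ZMod L → ℝ) where
  toFun τ := fun x => ∑ y : ZMod L, pTilde L Φ γ y * (2 * τ x - τ (x + y) - τ (x - y))
  map_add' τ σ := by
    funext x
    simp only [Pi.add_apply, ← Finset.sum_add_distrib]
    exact Finset.sum_congr rfl fun y _ => by ring
  map_smul' c τ := by
    funext x
    simp only [Pi.smul_apply, smul_eq_mul, RingHom.id_apply, Finset.mul_sum]
    exact Finset.sum_congr rfl fun y _ => by ring

/-- The profile `e^{-tD} τ`. -/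
def diffFlow (Φ : ℤ → ℝ) (γ t : ℝ) (τ : ZMod L → ℝ) : ZMod L → ℝ :=
  NormedSpace.exp ((-t) • LinearMap.toMatrix' (diffOp L Φ γ)) *ᵥ τ

/-- `∑_y p_{s,y} cos(2π k y)` for `k = n / L`. -/
def cosKernel (Φ : ℤ → ℝ) (γ s : ℝ) (n : ZMod L) : ℝ :=
  ∑ y : ZMod L, memKernel L Φ γ s y * Real.cos (2 * Real.pi * dualPt L n * (y.valMinAbs : ℝ))

/-- The decay rates `R(k)` and amplitudes `a(k)`, `k = n / L ∈ Λ_L^*`, for cut-offs `ε₀, β`.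
If `|k| > ε₀`, then `R(k) = β` and `a(k) = 0`.  If `|k| ≤ ε₀`, then `R(k)` is the unique point of
`[0, β]` with `1 = ∫₀^∞ e^{sR(k)} ∑_y p_{s,y} cos(2π k y) ds`, and `a(k) > 0` is determined by
`1 / a(k) = ∫₀^∞ s e^{sR(k)} ∑_y p_{s,y} cos(2π k y) ds`. -/
structure IsRateAmplitude (Φ : ℤ → ℝ) (γ ε₀ β : ℝ) (R a : ZMod L → ℝ) : Prop where
  rate_large : ∀ n, ε₀ < |dualPt L n| → R n = β
  amp_large : ∀ n, ε₀ < |dualPt L n| → a n = 0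
  rate_mem : ∀ n, |dualPt L n| ≤ ε₀ → R n ∈ Icc 0 β
  rate_eq : ∀ n, |dualPt L n| ≤ ε₀ →
    1 = ∫ s in Ioi (0 : ℝ), Real.exp (s * R n) * cosKernel L Φ γ s n
  rate_unique : ∀ n, |dualPt L n| ≤ ε₀ → ∀ r ∈ Icc 0 β,
    1 = ∫ s in Ioi (0 : ℝ), Real.exp (s * r) * cosKernel L Φ γ s n → r = R n
  amp_pos : ∀ n, |dualPt L n| ≤ ε₀ → 0 < a n
  amp_eq : ∀ n, |dualPt L n| ≤ ε₀ →
    1 / a n = ∫ s in Ioi (0 : ℝ), s * Real.exp (s * R n) * cosKernel L Φ γ s n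

/-- The initial profile
`τ_x = ∑_y L⁻¹ ∑_{k ∈ Λ_L^*} e^{i 2π k (x - y)} a(k) ∫₀^∞ g_{s,y} ds`, as a complex number. -/
def initProfile (Φ : ℤ → ℝ) (γ : ℝ) (μ₀ : Measure (Phase L)) (a : ZMod L → ℝ) (x : ZMod L) : ℂ :=
  ∑ y : ZMod L, ((1 / (L : ℂ)) * ∑ n : ZMod L, wave L n (x - y) * (a n : ℂ)) *
    ((∫ s in Ioi (0 : ℝ), source L Φ γ μ₀ s y : ℝ) : ℂ)

end VelocityFlip

end

open VelocityFlip

noncomputable section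

namespace VelocityFlip

/-! ### Exponentially bounded functions on the half line -/

/-! The discrete Fourier transform turns the lattice renewal equation into one scalar equation
$Y=f+p_n*Y$ per dual point. The memory kernel is $2\gamma$ times the square of an inverse transform,
so $p_n(s)=2\gamma\,\mathrm{avg}_m F_{v_m}(s)F_{v_{m+n}}(s)$, where $F_v$ is the momentum response
of a damped oscillator with squared frequency $v$ (`GammaAssumption.dFT_memKernel`, `modeKernel`).
All estimates reduce to these responses and are uniform for $v$ in a compact overdamped range
$[v_0,v_1]$, hence uniform in $L$.

Zero mode: the oscillator energy $Q=F^2+vX^2$ (with $X'=F$) loses $2\gamma F^2$ per unit time.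
Therefore $p_0$ is a probability density, its tail is the average of $Q$, and its mean is $1/\gamma$
whatever the frequencies are.

Other modes: polarization gives $p_0\pm p_n=\gamma\,\mathrm{avg}_m(F_{v_{m+n}}\pm F_{v_m})^2$. So
$|p_n|\le p_0$, and the missing mass is comparable to $V_n=\mathrm{avg}_m(v_{m+n}-v_m)^2$
(`modeVar`). Lipschitz continuity of $\hat\Phi$ gives $V_n\le\Lambda k^2$. The nondegeneracy
assumption bounds $V_n$ below for $k$ away from $0$; the inequality $V_{jn}\le j^2V_n$ carries this
down to $V_n\ge c\,k^2$ for small $k$ (`GammaAssumption.exists_modeVar_ge`).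

Renewal theorem (`renewal_asymptotics`): for a kernel $q$ of mass one, $\mathrm{tail}\,q*Y=\int_0^t
f$ along solutions. Subtracting $\theta$ times this identity replaces $q$ by
$q-\theta\,\mathrm{tail}\,q$. If the exponentially weighted $L^1$ norm of the new kernel is below
one, then $Y$ tends exponentially fast to $\int f/\int\mathrm{tail}\,q$. For $p_0$ such a $\theta$
exists because $F_v$ has a single zero, so that $F_v^2$ dominates a multiple of $Q$ outside a short
time interval (`Overdamped.exists_theta`).

Slow modes, $V_n$ small (`exists_slowMode`): the mass of $p_n$ is slightly below one, and there is a
small $R$ for which $e^{sR}p_n$ has mass one. The tilted kernel is an $O(V_n)$ perturbation of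
$p_0$, so the renewal theorem gives $Y\approx a\,e^{-Rt}\int e^{sR}f$. Expanding in $V_n$,
$R=\gamma(1-\int p_n)+O(V_n^2)$, and $\gamma(1-\int p_n)$ is exactly the eigenvalue of $D$. Fast
modes, $V_n$ bounded below (`exists_fastMode`): $\int|p_n|<1$ already forces exponential decay.

Summation over modes: the zero mode converges to $\gamma\int\sum_x g_{s,x}\,ds=L\mathcal E$, since
friction finally dissipates all the energy (`GammaAssumption.integral_sum_source`). The others decay
like $e^{-dtk^2}$, which sums to the first estimate. Against the diffusion flow the slow-mode error
contains $Ve^{-ctV}$ and $tV^2e^{-ctV}$, both $O(1/t)$ times a Gaussian in $k$; the Gaussian sum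
supplies $L\,t^{-1/2}$ and thus $t^{-3/2}$ in total. -/

lemma integrableOn_Ioi_of_exp_bound {E : Type*} [NormedAddCommGroup E] {f : ℝ → E} {C c : ℝ}
    (hc : 0 < c) (hf : Continuous f) (h : ∀ s, 0 ≤ s → ‖f s‖ ≤ C * Real.exp (-c * s)) :
    IntegrableOn f (Ioi 0) := by
  refine Integrable.mono' ((exp_neg_integrableOn_Ioi 0 hc).const_mul C)
    hf.aestronglyMeasurable ?_
  filter_upwards [ae_restrict_mem measurableSet_Ioi] with s hs
  exact h s (le_of_lt hs)

lemma integral_Ioi_exp_neg_mul {c : ℝ} (hc : 0 < c) (a : ℝ) :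
    ∫ s in Ioi a, Real.exp (-c * s) = Real.exp (-c * a) / c := by
  rw [integral_exp_mul_Ioi (neg_lt_zero.mpr hc)]
  rw [neg_div_neg_eq]

lemma norm_integral_Ioi_le_of_exp_bound {E : Type*} [NormedAddCommGroup E] [NormedSpace ℝ E]
    {f : ℝ → E} {C c a : ℝ} (hc : 0 < c) (ha : 0 ≤ a)
    (h : ∀ s, 0 ≤ s → ‖f s‖ ≤ C * Real.exp (-c * s)) :
    ‖∫ s in Ioi a, f s‖ ≤ C / c * Real.exp (-c * a) := by
  have h1 : ‖∫ s in Ioi a, f s‖ ≤ ∫ s in Ioi a, C * Real.exp (-c * s) := by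
    refine norm_integral_le_of_norm_le ((exp_neg_integrableOn_Ioi a hc).const_mul C) ?_
    filter_upwards [ae_restrict_mem measurableSet_Ioi] with s hs
    exact h s (ha.trans (le_of_lt hs))
  rw [integral_const_mul, integral_Ioi_exp_neg_mul hc] at h1
  calc _ ≤ _ := h1
    _ = _ := by ring

/-- A factor $s$ is paid for with half of the decay rate, using $x\le e^x$. This trade recurs
throughout and explains the rates $c/2$, $c/4$, $c/8$. -/
lemma mul_exp_neg_le {c : ℝ} (hc : 0 < c) (s : ℝ) :
    s * Real.exp (-c * s) ≤ 2 / c * Real.exp (-(c / 2) * s) := by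
  have h1 : c / 2 * s ≤ Real.exp (c / 2 * s) := by
    linarith [Real.add_one_le_exp (c / 2 * s)]
  have h2 : s ≤ 2 / c * Real.exp (c / 2 * s) := by
    have := mul_le_mul_of_nonneg_left h1 (by positivity : (0 : ℝ) ≤ 2 / c)
    calc s = 2 / c * (c / 2 * s) := by field_simp
      _ ≤ _ := this
  calc s * Real.exp (-c * s) ≤ (2 / c * Real.exp (c / 2 * s)) * Real.exp (-c * s) :=
        mul_le_mul_of_nonneg_right h2 (Real.exp_pos _).le
    _ = 2 / c * Real.exp (-(c / 2) * s) := by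
        rw [mul_assoc, ← Real.exp_add]; ring_nf

lemma tendsto_zero_of_exp_bound {f : ℝ → ℝ} {C c : ℝ}
    (hc : 0 < c) (h : ∀ s, 0 ≤ s → |f s| ≤ C * Real.exp (-c * s)) :
    Filter.Tendsto f Filter.atTop (nhds 0) := by
  have h1 : Filter.Tendsto (fun s : ℝ => C * Real.exp (-c * s)) Filter.atTop (nhds 0) := by
    have : Filter.Tendsto (fun s : ℝ => -c * s) Filter.atTop Filter.atBot :=
      Filter.tendsto_id.const_mul_atTop_of_neg (neg_lt_zero.mpr hc)
    simpa using (Real.tendsto_exp_atBot.comp this).const_mul C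
  refine squeeze_zero_norm' ?_ h1
  filter_upwards [Filter.eventually_ge_atTop 0] with s hs
  exact h s hs

lemma integral_Ioi_eq_of_hasDerivAt {f f' : ℝ → ℝ} {C c C' a : ℝ} (hc : 0 < c) (ha : 0 ≤ a)
    (hd : ∀ s, HasDerivAt f (f' s) s) (hf' : Continuous f')
    (hb : ∀ s, 0 ≤ s → |f s| ≤ C * Real.exp (-c * s))
    (hb' : ∀ s, 0 ≤ s → |f' s| ≤ C' * Real.exp (-c * s)) :
    ∫ s in Ioi a, f' s = - f a := by
  rw [integral_Ioi_of_hasDerivAt_of_tendsto (hd a).continuousAt.continuousWithinAt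
    (fun x _ => hd x) ((integrableOn_Ioi_of_exp_bound hc hf' hb').mono_set (Ioi_subset_Ioi ha))
    (tendsto_zero_of_exp_bound hc hb)]
  ring

/-! ### Response of a damped mode -/

/-- Half the splitting of the two decay rates of a mode with squared frequency `v`. -/
def modeU (γ v : ℝ) : ℝ := Real.sqrt ((γ / 2) ^ 2 - v)

/-- Position response of a damped mode to a unit kick. -/
def respX (γ v s : ℝ) : ℝ :=
  1 / (2 * modeU γ v) *
    (Real.exp (-s * (γ / 2 - modeU γ v)) - Real.exp (-s * (γ / 2 + modeU γ v)))

/-- Momentum response of a damped mode to a unit kick. -/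
def respF (γ v s : ℝ) : ℝ :=
  1 / (2 * modeU γ v) *
    ((γ / 2 + modeU γ v) * Real.exp (-s * (γ / 2 + modeU γ v)) -
      (γ / 2 - modeU γ v) * Real.exp (-s * (γ / 2 - modeU γ v)))

/-- The squared frequencies in `[v₀, v₁]` are positive and uniformly overdamped. -/
structure Overdamped (γ v₀ v₁ : ℝ) : Prop where
  gamma_pos : 0 < γ
  pos : 0 < v₀
  lt : v₁ < (γ / 2) ^ 2

lemma modeU_pos {γ v : ℝ} (h : v < (γ / 2) ^ 2) : 0 < modeU γ v :=
  Real.sqrt_pos.mpr (by linarith)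

lemma modeU_sq {γ v : ℝ} (h : v < (γ / 2) ^ 2) : modeU γ v ^ 2 = (γ / 2) ^ 2 - v :=
  Real.sq_sqrt (by linarith)

lemma respX_zero (γ v : ℝ) : respX γ v 0 = 0 := by simp [respX]

lemma respF_zero {γ v : ℝ} (h : v < (γ / 2) ^ 2) : respF γ v 0 = 1 := by
  have := modeU_pos h
  simp only [respF, neg_zero, zero_mul, Real.exp_zero]
  field_simp; ring

lemma hasDerivAt_exp_neg_mul (μ s : ℝ) :
    HasDerivAt (fun s => Real.exp (-s * μ)) (-μ * Real.exp (-s * μ)) s := by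
  have := (((hasDerivAt_id s).neg.mul_const μ).exp)
  simpa [mul_comm] using this

lemma hasDerivAt_respX (γ v s : ℝ) : HasDerivAt (respX γ v) (respF γ v s) s := by
  have h := ((hasDerivAt_exp_neg_mul (γ / 2 - modeU γ v) s).sub
    (hasDerivAt_exp_neg_mul (γ / 2 + modeU γ v) s)).const_mul (1 / (2 * modeU γ v))
  refine h.congr_deriv ?_
  simp only [respF]; ring

/-- With $X'=F$ this is the oscillator equation $X''+\gamma X'+vX=0$, started from $X(0)=0$,
$X'(0)=1$. -/
lemma hasDerivAt_respF {γ v : ℝ} (hv : v < (γ / 2) ^ 2) (s : ℝ) :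
    HasDerivAt (respF γ v) (-γ * respF γ v s - v * respX γ v s) s := by
  have h := (((hasDerivAt_exp_neg_mul (γ / 2 + modeU γ v) s).const_mul (γ / 2 + modeU γ v)).sub
    ((hasDerivAt_exp_neg_mul (γ / 2 - modeU γ v) s).const_mul (γ / 2 - modeU γ v))).const_mul
      (1 / (2 * modeU γ v))
  refine h.congr_deriv ?_
  have hu := modeU_sq hv
  have hv' : v = (γ / 2) ^ 2 - modeU γ v ^ 2 := by linarith
  simp only [respF, respX]
  generalize modeU γ v = u at *
  subst hv'
  ring

lemma continuous_respX (γ v : ℝ) : Continuous (respX γ v) :=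
  continuous_iff_continuousAt.mpr fun s => (hasDerivAt_respX γ v s).continuousAt

lemma continuous_respF (γ v : ℝ) : Continuous (respF γ v) := by
  unfold respF; fun_prop

/-- A constant bounding both responses. -/
def respBound (γ v₁ : ℝ) : ℝ := (1 + γ) / (2 * modeU γ v₁)

/-- A uniform decay rate of the responses. -/
def respRate (γ v₀ : ℝ) : ℝ := v₀ / γ

section
variable {γ v₀ v₁ : ℝ}

lemma Overdamped.rate_pos (h : Overdamped γ v₀ v₁) : 0 < respRate γ v₀ :=
  div_pos h.pos h.gamma_pos

lemma Overdamped.bound_pos (h : Overdamped γ v₀ v₁) : 0 < respBound γ v₁ := by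
  have := modeU_pos h.lt
  have := h.gamma_pos
  unfold respBound; positivity

lemma Overdamped.mem_lt (h : Overdamped γ v₀ v₁) {v : ℝ} (hv : v ∈ Icc v₀ v₁) :
    v < (γ / 2) ^ 2 := hv.2.trans_lt h.lt

lemma Overdamped.modeU_le (_ : Overdamped γ v₀ v₁) {v : ℝ} (hv : v ∈ Icc v₀ v₁) :
    modeU γ v₁ ≤ modeU γ v := Real.sqrt_le_sqrt (by linarith [hv.2])

lemma Overdamped.modeU_lt (h : Overdamped γ v₀ v₁) {v : ℝ} (hv : v ∈ Icc v₀ v₁) :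
    modeU γ v < γ / 2 := by
  have h1 := modeU_sq (h.mem_lt hv)
  have h2 := modeU_pos (h.mem_lt hv)
  nlinarith [h.pos, hv.1, h.gamma_pos]

/-- The two decay rates have product $v\ge v_0$, and the larger one is at most $\gamma$. -/
lemma Overdamped.rate_le (h : Overdamped γ v₀ v₁) {v : ℝ} (hv : v ∈ Icc v₀ v₁) :
    respRate γ v₀ ≤ γ / 2 - modeU γ v := by
  have h1 := modeU_sq (h.mem_lt hv)
  have h2 := modeU_pos (h.mem_lt hv)
  have h3 := h.modeU_lt hv
  have h4 := h.gamma_pos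
  rw [respRate, div_le_iff₀ h4]
  nlinarith [hv.1]

lemma Overdamped.respX_nonneg (h : Overdamped γ v₀ v₁) {v s : ℝ} (hv : v ∈ Icc v₀ v₁)
    (hs : 0 ≤ s) : 0 ≤ respX γ v s := by
  have h2 := modeU_pos (h.mem_lt hv)
  unfold respX
  refine mul_nonneg (by positivity) (sub_nonneg.mpr (Real.exp_le_exp.mpr ?_))
  nlinarith

lemma Overdamped.exp_minus_le (h : Overdamped γ v₀ v₁) {v s : ℝ} (hv : v ∈ Icc v₀ v₁)
    (hs : 0 ≤ s) : Real.exp (-s * (γ / 2 - modeU γ v)) ≤ Real.exp (-respRate γ v₀ * s) := by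
  have := h.rate_le hv
  refine Real.exp_le_exp.mpr ?_
  nlinarith

lemma Overdamped.exp_plus_le (h : Overdamped γ v₀ v₁) {v s : ℝ} (hv : v ∈ Icc v₀ v₁)
    (hs : 0 ≤ s) : Real.exp (-s * (γ / 2 + modeU γ v)) ≤ Real.exp (-respRate γ v₀ * s) := by
  refine le_trans (Real.exp_le_exp.mpr ?_) (h.exp_minus_le hv hs)
  have h2 := modeU_pos (h.mem_lt hv)
  nlinarith

lemma Overdamped.abs_respX_le (h : Overdamped γ v₀ v₁) {v s : ℝ} (hv : v ∈ Icc v₀ v₁)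
    (hs : 0 ≤ s) : |respX γ v s| ≤ respBound γ v₁ * Real.exp (-respRate γ v₀ * s) := by
  rw [abs_of_nonneg (h.respX_nonneg hv hs)]
  have h1 := h.exp_minus_le hv hs
  have h2 := modeU_pos (h.mem_lt hv)
  have h3 := modeU_pos h.lt
  have h4 := h.gamma_pos
  unfold respX respBound
  -- In `respBound` the summand $1$ serves the position response and the summand $\gamma$ the
  -- momentum response.
  have h5 : 1 / (2 * modeU γ v) ≤ (1 + γ) / (2 * modeU γ v₁) :=
    div_le_div₀ (by positivity) (by linarith) (by positivity) (by linarith [h.modeU_le hv])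
  refine mul_le_mul h5 ?_ (sub_nonneg.mpr (Real.exp_le_exp.mpr (by nlinarith))) (by positivity)
  linarith [Real.exp_pos (-s * (γ / 2 + modeU γ v))]

lemma Overdamped.abs_respF_le (h : Overdamped γ v₀ v₁) {v s : ℝ} (hv : v ∈ Icc v₀ v₁)
    (hs : 0 ≤ s) : |respF γ v s| ≤ respBound γ v₁ * Real.exp (-respRate γ v₀ * s) := by
  have h1 := h.exp_minus_le hv hs
  have h1' := h.exp_plus_le hv hs
  have h2 := modeU_pos (h.mem_lt hv)
  have h3 := modeU_pos h.lt
  have h4 := h.gamma_pos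
  have h6 := h.modeU_lt hv
  unfold respF respBound
  have h5 : γ * (1 / (2 * modeU γ v)) ≤ (1 + γ) / (2 * modeU γ v₁) := by
    rw [mul_one_div]
    exact div_le_div₀ (by positivity) (by linarith) (by positivity) (by linarith [h.modeU_le hv])
  set e := Real.exp (-respRate γ v₀ * s)
  have he : 0 < e := Real.exp_pos _
  have h7 : |(γ / 2 + modeU γ v) * Real.exp (-s * (γ / 2 + modeU γ v)) -
      (γ / 2 - modeU γ v) * Real.exp (-s * (γ / 2 - modeU γ v))| ≤ γ * e := by
    have a1 := Real.exp_pos (-s * (γ / 2 + modeU γ v))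
    have a2 := Real.exp_pos (-s * (γ / 2 - modeU γ v))
    have b1 := mul_le_mul_of_nonneg_left h1' (by linarith : (0 : ℝ) ≤ γ / 2 + modeU γ v)
    have b2 := mul_le_mul_of_nonneg_left h1 (by linarith : (0 : ℝ) ≤ γ / 2 - modeU γ v)
    have c1 := mul_pos (by linarith : (0 : ℝ) < γ / 2 + modeU γ v) a1
    have c2 := mul_pos (by linarith : (0 : ℝ) < γ / 2 - modeU γ v) a2
    rw [abs_le]; constructor <;> nlinarith
  rw [abs_mul, abs_of_pos (by positivity : (0 : ℝ) < 1 / (2 * modeU γ v))]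
  calc _ ≤ 1 / (2 * modeU γ v) * (γ * e) := mul_le_mul_of_nonneg_left h7 (by positivity)
    _ = γ * (1 / (2 * modeU γ v)) * e := by ring
    _ ≤ _ := mul_le_mul_of_nonneg_right h5 he.le

/-- Product of two exponentially bounded numbers. -/
lemma abs_mul_le_of_exp {a b A B c s : ℝ} (ha : |a| ≤ A * Real.exp (-c * s))
    (hb : |b| ≤ B * Real.exp (-c * s)) : |a * b| ≤ A * B * Real.exp (-(2 * c) * s) := by
  have h1 : Real.exp (-(2 * c) * s) = Real.exp (-c * s) * Real.exp (-c * s) := by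
    rw [← Real.exp_add]; ring_nf
  rw [abs_mul, h1]
  calc |a| * |b| ≤ (A * Real.exp (-c * s)) * (B * Real.exp (-c * s)) :=
        mul_le_mul ha hb (abs_nonneg _) ((abs_nonneg _).trans ha)
    _ = _ := by ring

lemma Overdamped.abs_FF_le (h : Overdamped γ v₀ v₁) {v v' s : ℝ} (hv : v ∈ Icc v₀ v₁)
    (hv' : v' ∈ Icc v₀ v₁) (hs : 0 ≤ s) : |respF γ v s * respF γ v' s| ≤
      respBound γ v₁ ^ 2 * Real.exp (-(2 * respRate γ v₀) * s) := by
  rw [pow_two]; exact abs_mul_le_of_exp (h.abs_respF_le hv hs) (h.abs_respF_le hv' hs)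

lemma Overdamped.abs_XX_le (h : Overdamped γ v₀ v₁) {v s : ℝ} (hv : v ∈ Icc v₀ v₁)
    (hs : 0 ≤ s) : |respX γ v s * respX γ v s| ≤
      respBound γ v₁ ^ 2 * Real.exp (-(2 * respRate γ v₀) * s) := by
  rw [pow_two]; exact abs_mul_le_of_exp (h.abs_respX_le hv hs) (h.abs_respX_le hv hs)

lemma Overdamped.abs_FX_le (h : Overdamped γ v₀ v₁) {v s : ℝ} (hv : v ∈ Icc v₀ v₁)
    (hs : 0 ≤ s) : |respF γ v s * respX γ v s| ≤
      respBound γ v₁ ^ 2 * Real.exp (-(2 * respRate γ v₀) * s) := by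
  rw [pow_two]; exact abs_mul_le_of_exp (h.abs_respF_le hv hs) (h.abs_respX_le hv hs)

/-- Twice the energy of a mode after a unit kick. -/
def modeQ (γ v s : ℝ) : ℝ := respF γ v s * respF γ v s + v * (respX γ v s * respX γ v s)

lemma continuous_modeQ (γ v : ℝ) : Continuous (modeQ γ v) := by
  have := continuous_respF γ v
  have := continuous_respX γ v
  unfold modeQ; fun_prop

/-- Only friction dissipates: the exchange terms between kinetic and potential energy cancel. -/
lemma hasDerivAt_modeQ {v : ℝ} (hv : v < (γ / 2) ^ 2) (s : ℝ) :
    HasDerivAt (modeQ γ v) (-(2 * γ * (respF γ v s * respF γ v s))) s := by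
  have hF := hasDerivAt_respF hv s
  have hX := hasDerivAt_respX γ v s
  refine ((hF.mul hF).add ((hX.mul hX).const_mul v)).congr_deriv ?_
  ring

lemma Overdamped.abs_modeQ_le (h : Overdamped γ v₀ v₁) {v s : ℝ} (hv : v ∈ Icc v₀ v₁)
    (hs : 0 ≤ s) : |modeQ γ v s| ≤
      (1 + v₁) * respBound γ v₁ ^ 2 * Real.exp (-(2 * respRate γ v₀) * s) := by
  have h1 := h.abs_FF_le hv hv hs
  have h2 := h.abs_XX_le hv hs
  have h0 := h.pos.trans_le hv.1
  unfold modeQ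
  set B := respBound γ v₁ ^ 2 * Real.exp (-(2 * respRate γ v₀) * s)
  calc _ ≤ |respF γ v s * respF γ v s| + |v * (respX γ v s * respX γ v s)| := abs_add_le _ _
    _ ≤ B + v₁ * B := by
        rw [abs_mul v, abs_of_pos h0]
        exact add_le_add h1 (mul_le_mul hv.2 h2 (abs_nonneg _) (h0.le.trans hv.2))
    _ = _ := by ring

lemma Overdamped.integral_Ioi_FF (h : Overdamped γ v₀ v₁) {v a : ℝ} (hv : v ∈ Icc v₀ v₁)
    (ha : 0 ≤ a) : ∫ s in Ioi a, 2 * γ * (respF γ v s * respF γ v s) = modeQ γ v a := by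
  have hF := continuous_respF γ v
  have key := integral_Ioi_eq_of_hasDerivAt (f := modeQ γ v) (c := 2 * respRate γ v₀)
    (f' := fun s => -(2 * γ * (respF γ v s * respF γ v s)))
    (C' := 2 * γ * respBound γ v₁ ^ 2)
    (by linarith [h.rate_pos]) ha (hasDerivAt_modeQ (h.mem_lt hv)) (by fun_prop)
    (fun s hs => h.abs_modeQ_le hv hs) (fun s hs => by
      rw [abs_neg, abs_mul, abs_of_pos (by linarith [h.gamma_pos] : 0 < 2 * γ), mul_assoc (2 * γ)]
      exact mul_le_mul_of_nonneg_left (h.abs_FF_le hv hv hs) (by linarith [h.gamma_pos]))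
  rw [integral_neg] at key
  linarith

/-- The whole initial energy $Q(0)=1$ is eventually dissipated, independently of $v$. This is why
the zero mode of the memory kernel has mass one. -/
lemma Overdamped.integral_FF (h : Overdamped γ v₀ v₁) {v : ℝ} (hv : v ∈ Icc v₀ v₁) :
    ∫ s in Ioi (0 : ℝ), respF γ v s * respF γ v s = 1 / (2 * γ) := by
  have h1 := h.integral_Ioi_FF hv le_rfl
  rw [integral_const_mul] at h1
  have : modeQ γ v 0 = 1 := by simp [modeQ, respX_zero, respF_zero (h.mem_lt hv)]
  have := h.gamma_pos
  rw [eq_div_iff (by positivity)]; linarith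

lemma Overdamped.integral_FX (h : Overdamped γ v₀ v₁) {v : ℝ} (hv : v ∈ Icc v₀ v₁) :
    ∫ s in Ioi (0 : ℝ), respF γ v s * respX γ v s = 0 := by
  have hF := continuous_respF γ v
  have hX := continuous_respX γ v
  have key := integral_Ioi_eq_of_hasDerivAt (f := fun s => 1 / 2 * (respX γ v s * respX γ v s))
    (c := 2 * respRate γ v₀) (a := 0)
    (f' := fun s => respF γ v s * respX γ v s)
    (C := 1 / 2 * respBound γ v₁ ^ 2)
    (by linarith [h.rate_pos]) le_rfl (fun s => by
      have hX := hasDerivAt_respX γ v s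
      exact ((hX.mul hX).const_mul (1 / 2)).congr_deriv (by ring)) (by fun_prop)
    (fun s hs => by
      rw [abs_mul, abs_of_pos (by norm_num : (0 : ℝ) < 1 / 2), mul_assoc]
      exact mul_le_mul_of_nonneg_left (h.abs_XX_le hv hs) (by norm_num))
    (fun s hs => h.abs_FX_le hv hs)
  simpa [respX_zero] using key

/-- An antiderivative of `modeQ`. -/
def modeQInt (γ v s : ℝ) : ℝ :=
  -(1 / γ) * (respF γ v s * respF γ v s) - respF γ v s * respX γ v s
    - (v / γ + γ / 2) * (respX γ v s * respX γ v s)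

/-- The coefficients of `modeQInt` come from seeking an antiderivative of the energy among quadratic
forms in $F$ and $X$; the oscillator equation determines them. The value $-1/\gamma$ at time $0$
then gives $\int Q=1/\gamma$. -/
lemma Overdamped.hasDerivAt_modeQInt (h : Overdamped γ v₀ v₁) {v : ℝ} (hv : v ∈ Icc v₀ v₁)
    (s : ℝ) : HasDerivAt (modeQInt γ v) (modeQ γ v s) s := by
  have hF := hasDerivAt_respF (h.mem_lt hv) s
  have hX := hasDerivAt_respX γ v s
  have := h.gamma_pos
  refine ((((hF.mul hF).const_mul (-(1 / γ))).sub (hF.mul hX)).sub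
    ((hX.mul hX).const_mul (v / γ + γ / 2))).congr_deriv ?_
  unfold modeQ
  field_simp; ring

lemma Overdamped.abs_modeQInt_le (h : Overdamped γ v₀ v₁) {v s : ℝ} (hv : v ∈ Icc v₀ v₁)
    (hs : 0 ≤ s) : |modeQInt γ v s| ≤ (1 / γ + 1 + (v / γ + γ / 2)) *
      respBound γ v₁ ^ 2 * Real.exp (-(2 * respRate γ v₀) * s) := by
  have h1 := h.abs_FF_le hv hv hs
  have h2 := h.abs_XX_le hv hs
  have h3 := h.abs_FX_le hv hs
  have h0 := h.pos.trans_le hv.1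
  have hγ := h.gamma_pos
  unfold modeQInt
  set B := respBound γ v₁ ^ 2 * Real.exp (-(2 * respRate γ v₀) * s)
  have e1 : |-(1 / γ) * (respF γ v s * respF γ v s)| ≤ 1 / γ * B := by
    rw [abs_mul, abs_neg, abs_of_pos (by positivity : 0 < 1 / γ)]; gcongr
  have e2 : |(v / γ + γ / 2) * (respX γ v s * respX γ v s)| ≤ (v / γ + γ / 2) * B := by
    rw [abs_mul, abs_of_pos (by positivity : 0 < v / γ + γ / 2)]; gcongr
  calc _ ≤ |-(1 / γ) * (respF γ v s * respF γ v s)| + |respF γ v s * respX γ v s| +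
        |(v / γ + γ / 2) * (respX γ v s * respX γ v s)| :=
        (abs_sub _ _).trans (add_le_add (abs_sub _ _) le_rfl)
    _ ≤ 1 / γ * B + B + (v / γ + γ / 2) * B := add_le_add (add_le_add e1 h3) e2
    _ = _ := by ring

lemma Overdamped.integral_modeQ (h : Overdamped γ v₀ v₁) {v : ℝ} (hv : v ∈ Icc v₀ v₁) :
    ∫ s in Ioi (0 : ℝ), modeQ γ v s = 1 / γ := by
  rw [integral_Ioi_eq_of_hasDerivAt (by linarith [h.rate_pos]) le_rfl (h.hasDerivAt_modeQInt hv)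
    (continuous_modeQ γ v) (fun s hs => h.abs_modeQInt_le hv hs)
    (fun s hs => h.abs_modeQ_le hv hs)]
  simp [modeQInt, respX_zero, respF_zero (h.mem_lt hv)]

lemma Overdamped.integrableOn_FF (h : Overdamped γ v₀ v₁) {v v' : ℝ} (hv : v ∈ Icc v₀ v₁)
    (hv' : v' ∈ Icc v₀ v₁) :
    IntegrableOn (fun s => respF γ v s * respF γ v' s) (Ioi 0) :=
  integrableOn_Ioi_of_exp_bound (by linarith [h.rate_pos])
    ((continuous_respF γ v).mul (continuous_respF γ v')) (fun s hs => h.abs_FF_le hv hv' hs)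

lemma Overdamped.integrableOn_modeQ (h : Overdamped γ v₀ v₁) {v : ℝ} (hv : v ∈ Icc v₀ v₁) :
    IntegrableOn (modeQ γ v) (Ioi 0) :=
  integrableOn_Ioi_of_exp_bound (by linarith [h.rate_pos]) (continuous_modeQ γ v)
    (fun s hs => h.abs_modeQ_le hv hs)

lemma Overdamped.integrableOn_XX (h : Overdamped γ v₀ v₁) {v : ℝ} (hv : v ∈ Icc v₀ v₁) :
    IntegrableOn (fun s => respX γ v s * respX γ v s) (Ioi 0) :=
  integrableOn_Ioi_of_exp_bound (by linarith [h.rate_pos])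
    ((continuous_respX γ v).mul (continuous_respX γ v)) (fun s hs => h.abs_XX_le hv hs)

lemma Overdamped.integral_XX (h : Overdamped γ v₀ v₁) {v : ℝ} (hv : v ∈ Icc v₀ v₁) :
    ∫ s in Ioi (0 : ℝ), v * (respX γ v s * respX γ v s) = 1 / (2 * γ) := by
  have h1 := h.integral_modeQ hv
  unfold modeQ at h1
  rw [integral_add (h.integrableOn_FF hv hv) ((h.integrableOn_XX hv).const_mul v),
    h.integral_FF hv] at h1
  have := h.gamma_pos
  have : 1 / γ = 1 / (2 * γ) + 1 / (2 * γ) := by field_simp; norm_num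
  linarith

/-- Integration by parts turns the first moment into $\int Q$. Since the value $1/\gamma$ does not
depend on $v$, averaging over modes preserves it. -/
lemma Overdamped.integral_mul_FF (h : Overdamped γ v₀ v₁) {v : ℝ} (hv : v ∈ Icc v₀ v₁) :
    ∫ s in Ioi (0 : ℝ), s * (2 * γ * (respF γ v s * respF γ v s)) = 1 / γ := by
  have hF := continuous_respF γ v
  have hr := h.rate_pos
  have h0 := h.pos.trans_le hv.1
  have hγ := h.gamma_pos
  have hB := h.bound_pos
  have hv1 := hv.2
  have hB0 : 0 < v₁ := h0.trans_le hv1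
  have bd : ∀ (A a s : ℝ), 0 ≤ A → 0 ≤ s →
      |a| ≤ A * Real.exp (-(2 * respRate γ v₀) * s) →
      |s * a| ≤ A * (2 / (2 * respRate γ v₀)) * Real.exp (-(respRate γ v₀) * s) := by
    intro A a s hA hs ha
    rw [abs_mul, abs_of_nonneg hs]
    have e := mul_exp_neg_le (by linarith : 0 < 2 * respRate γ v₀) s
    rw [show 2 * respRate γ v₀ / 2 = respRate γ v₀ by ring] at e
    calc s * |a| ≤ s * (A * Real.exp (-(2 * respRate γ v₀) * s)) := by gcongr
      _ = A * (s * Real.exp (-(2 * respRate γ v₀) * s)) := by ring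
      _ ≤ A * (2 / (2 * respRate γ v₀) * Real.exp (-(respRate γ v₀) * s)) := by gcongr
      _ = _ := by ring
  have weak : ∀ A s : ℝ, 0 ≤ A → 0 ≤ s → A * Real.exp (-(2 * respRate γ v₀) * s) ≤
      A * Real.exp (-(respRate γ v₀) * s) := by
    intro A s hA hs
    gcongr; nlinarith
  have bFF : ∀ s, 0 ≤ s → |2 * γ * (respF γ v s * respF γ v s)| ≤
      2 * γ * respBound γ v₁ ^ 2 * Real.exp (-(2 * respRate γ v₀) * s) := by
    intro s hs
    rw [abs_mul, abs_of_pos (by positivity), mul_assoc (2 * γ)]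
    have := h.abs_FF_le hv hv hs
    gcongr
  have key := integral_Ioi_eq_of_hasDerivAt (f := fun s => -(s * modeQ γ v s) + modeQInt γ v s)
    (c := respRate γ v₀) (a := 0)
    (f' := fun s => s * (2 * γ * (respF γ v s * respF γ v s)))
    (C := (1 + v₁) * respBound γ v₁ ^ 2 * (2 / (2 * respRate γ v₀)) +
      (1 / γ + 1 + (v / γ + γ / 2)) * respBound γ v₁ ^ 2)
    (C' := 2 * γ * respBound γ v₁ ^ 2 * (2 / (2 * respRate γ v₀)))
    hr le_rfl (fun s => by
      refine ((((hasDerivAt_id s).mul (hasDerivAt_modeQ (h.mem_lt hv) s)).neg).add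
        (h.hasDerivAt_modeQInt hv s)).congr_deriv ?_
      simp only [id]; ring) (by fun_prop)
    (fun s hs => by
      rw [add_mul]
      refine (abs_add_le _ _).trans (add_le_add ?_ ?_)
      · rw [abs_neg]
        exact bd _ _ s (by positivity) hs (h.abs_modeQ_le hv hs)
      · exact (h.abs_modeQInt_le hv hs).trans (weak _ s (by positivity) hs))
    (fun s hs => bd _ _ s (by positivity) hs (bFF s hs))
  rw [key]
  simp [modeQInt, respX_zero, respF_zero (h.mem_lt hv)]

end

/-! ### Comparison of the responses of two modes -/

section
variable {γ v₀ v₁ : ℝ}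

lemma le_of_hasDerivAt_nonneg {f f' : ℝ → ℝ} {b : ℝ} (hb : 0 ≤ b)
    (hd : ∀ s, HasDerivAt f (f' s) s) (h : ∀ s, 0 ≤ s → s ≤ b → 0 ≤ f' s) : f 0 ≤ f b := by
  have hm : MonotoneOn f (Icc 0 b) := by
    refine monotoneOn_of_deriv_nonneg (convex_Icc 0 b)
      (fun s _ => (hd s).continuousAt.continuousWithinAt)
      (fun s _ => (hd s).differentiableAt.differentiableWithinAt) ?_
    intro s hs
    rw [(hd s).deriv]
    have := interior_subset hs
    exact h s this.1 this.2
  exact hm ⟨le_rfl, hb⟩ ⟨hb, le_rfl⟩ hb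

/-- Interpolates between the responses of two modes. -/
def respInterp (γ v v' s r : ℝ) : ℝ :=
  respF γ v (s - r) * respF γ v' r - v' * (respX γ v (s - r) * respX γ v' r)

/-- Duhamel's formula: the interpolant is the momentum entry of the evolution that runs mode $v'$ up
to time $r$ and mode $v$ for the remaining time $s-r$. Only the difference of the two generators
survives in the $r$-derivative. -/
lemma hasDerivAt_respInterp {v v' : ℝ} (hv : v < (γ / 2) ^ 2) (hv' : v' < (γ / 2) ^ 2) (s r : ℝ) :
    HasDerivAt (respInterp γ v v' s) ((v - v') * (respX γ v (s - r) * respF γ v' r)) r := by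
  have hs : HasDerivAt (fun r : ℝ => s - r) (-1) r := (hasDerivAt_id r).const_sub s
  have h1 := (hasDerivAt_respF hv (s - r)).comp r hs
  have h2 := (hasDerivAt_respX γ v (s - r)).comp r hs
  have h3 := hasDerivAt_respF hv' r
  have h4 := hasDerivAt_respX γ v' r
  refine ((h1.mul h3).sub ((h2.mul h4).const_mul v')).congr_deriv ?_
  simp only [Function.comp]
  ring

lemma respInterp_zero {v v' : ℝ} (hv' : v' < (γ / 2) ^ 2) (s : ℝ) :
    respInterp γ v v' s 0 = respF γ v s := by
  simp [respInterp, respX_zero, respF_zero hv']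

lemma respInterp_self {v v' : ℝ} (hv : v < (γ / 2) ^ 2) (s : ℝ) :
    respInterp γ v v' s s = respF γ v' s := by
  simp [respInterp, respX_zero, respF_zero hv]

/-- In the Duhamel integrand the exponentials of $s-r$ and $r$ multiply to $e^{-cs}$, independent of
$r$; integrating over $[0,s]$ costs the factor $s$. -/
lemma Overdamped.abs_respF_sub_le (h : Overdamped γ v₀ v₁) {v v' s : ℝ} (hv : v ∈ Icc v₀ v₁)
    (hv' : v' ∈ Icc v₀ v₁) (hs : 0 ≤ s) : |respF γ v s - respF γ v' s| ≤
      |v - v'| * respBound γ v₁ ^ 2 * (s * Real.exp (-respRate γ v₀ * s)) := by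
  have key := norm_image_sub_le_of_norm_deriv_le_segment' (f := respInterp γ v v' s)
    (a := 0) (b := s) (C := |v - v'| * respBound γ v₁ ^ 2 * Real.exp (-respRate γ v₀ * s))
    (fun r _ => (hasDerivAt_respInterp (h.mem_lt hv) (h.mem_lt hv') s r).hasDerivWithinAt)
    (fun r hr => by
      rw [Real.norm_eq_abs, abs_mul, abs_mul (respX _ _ _)]
      have h1 := h.abs_respX_le hv (by linarith [hr.2] : 0 ≤ s - r)
      have h2 := h.abs_respF_le hv' hr.1
      have e : Real.exp (-respRate γ v₀ * s) =
          Real.exp (-respRate γ v₀ * (s - r)) * Real.exp (-respRate γ v₀ * r) := by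
        rw [← Real.exp_add]; ring_nf
      rw [mul_assoc |v - v'|]
      refine mul_le_mul_of_nonneg_left ?_ (abs_nonneg _)
      calc _ ≤ _ := mul_le_mul h1 h2 (abs_nonneg _) ((abs_nonneg _).trans h1)
        _ = _ := by rw [e]; ring) s ⟨hs, le_rfl⟩
  rw [respInterp_self (h.mem_lt hv), respInterp_zero (h.mem_lt hv'), Real.norm_eq_abs,
    abs_sub_comm] at key
  calc _ ≤ _ := key
    _ = _ := by ring

/-- On `[0, smallTime]` the momentum responses stay above `1 / 2`. -/
def smallTime (γ v₁ : ℝ) : ℝ := 1 / (2 * ((γ + v₁) * respBound γ v₁))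

lemma Overdamped.smallTime_pos (h : Overdamped γ v₀ v₁) (hv : v₀ ≤ v₁) : 0 < smallTime γ v₁ := by
  have := h.bound_pos
  have := h.gamma_pos
  have := h.pos.trans_le hv
  unfold smallTime; positivity

lemma Overdamped.half_le_respF (h : Overdamped γ v₀ v₁) {v s : ℝ} (hv : v ∈ Icc v₀ v₁)
    (hs : 0 ≤ s) (hs' : s ≤ smallTime γ v₁) : 1 / 2 ≤ respF γ v s := by
  have hB := h.bound_pos
  have hγ := h.gamma_pos
  have h0 := h.pos.trans_le hv.1
  have hv1 := h0.trans_le hv.2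
  have hvle := hv.2
  have key := norm_image_sub_le_of_norm_deriv_le_segment' (f := respF γ v)
    (a := 0) (b := s) (C := (γ + v₁) * respBound γ v₁)
    (fun r _ => (hasDerivAt_respF (h.mem_lt hv) r).hasDerivWithinAt)
    (fun r hr => by
      have h1 := h.abs_respX_le hv hr.1
      have h2 := h.abs_respF_le hv hr.1
      have e : Real.exp (-respRate γ v₀ * r) ≤ 1 := by
        rw [Real.exp_le_one_iff]; nlinarith [h.rate_pos, hr.1]
      have h1' : |respX γ v r| ≤ respBound γ v₁ := h1.trans (by nlinarith)
      have h2' : |respF γ v r| ≤ respBound γ v₁ := h2.trans (by nlinarith)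
      calc ‖-γ * respF γ v r - v * respX γ v r‖ ≤ |-γ * respF γ v r| + |v * respX γ v r| :=
            abs_sub _ _
        _ = γ * |respF γ v r| + v * |respX γ v r| := by
            rw [abs_mul, abs_mul, abs_neg, abs_of_pos hγ, abs_of_pos h0]
        _ ≤ γ * respBound γ v₁ + v₁ * respBound γ v₁ := by gcongr
        _ = _ := by ring) s ⟨hs, le_rfl⟩
  rw [respF_zero (h.mem_lt hv), Real.norm_eq_abs, sub_zero] at key
  have hK : 0 < (γ + v₁) * respBound γ v₁ := by positivity
  have h3 : (γ + v₁) * respBound γ v₁ * s ≤ 1 / 2 := by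
    calc _ ≤ (γ + v₁) * respBound γ v₁ * smallTime γ v₁ := by gcongr
      _ = 1 / 2 := by unfold smallTime; field_simp
  linarith [neg_abs_le (respF γ v s - 1)]

lemma Overdamped.half_mul_le_respX (h : Overdamped γ v₀ v₁) {v s : ℝ} (hv : v ∈ Icc v₀ v₁)
    (hs : 0 ≤ s) (hs' : s ≤ smallTime γ v₁) : s / 2 ≤ respX γ v s := by
  have := le_of_hasDerivAt_nonneg (f := fun s => respX γ v s - s * (1 / 2)) hs
    (fun r => (hasDerivAt_respX γ v r).sub ((hasDerivAt_id r).mul_const (1 / 2)))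
    (fun r hr hr' => by
      have := h.half_le_respF hv hr (hr'.trans hs')
      linarith)
  simp only [respX_zero] at this
  linarith

/-- At short times the Duhamel integrand has a sign: $X_v(s-r)\ge(s-r)/2$ and $F_{v'}(r)\ge1/2$.
Integrating $(s-r)/4$ over $[0,s]$ gives $s^2/8$. -/
lemma Overdamped.mul_sq_le_respF_sub (h : Overdamped γ v₀ v₁) {v v' s : ℝ} (hv : v ∈ Icc v₀ v₁)
    (hv' : v' ∈ Icc v₀ v₁) (hs : 0 ≤ s) (hs' : s ≤ smallTime γ v₁) (hvv : v' ≤ v) :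
    (v - v') * (s ^ 2 / 8) ≤ respF γ v' s - respF γ v s := by
  have := le_of_hasDerivAt_nonneg
    (f := fun r => respInterp γ v v' s r + (v - v') * ((s - r) ^ 2 / 8)) hs
    (fun r => (hasDerivAt_respInterp (h.mem_lt hv) (h.mem_lt hv') s r).add
      (((((hasDerivAt_id r).const_sub s).pow 2).div_const 8).const_mul (v - v')))
    (fun r hr hr' => by
      have h1 := h.half_le_respF hv' hr (hr'.trans hs')
      have h2 := h.half_mul_le_respX hv (by linarith : 0 ≤ s - r) (by linarith)
      have h3 : (s - r) / 4 ≤ respX γ v (s - r) * respF γ v' r := by nlinarith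
      have h4 := mul_nonneg (sub_nonneg.mpr hvv) (sub_nonneg.mpr h3)
      refine h4.trans (le_of_eq ?_)
      simp only [id]
      push_cast
      ring)
  simp only [respInterp_zero (h.mem_lt hv'), respInterp_self (h.mem_lt hv)] at this
  ring_nf at this ⊢
  linarith

lemma Overdamped.sq_sub_respF_ge (h : Overdamped γ v₀ v₁) {v v' s : ℝ} (hv : v ∈ Icc v₀ v₁)
    (hv' : v' ∈ Icc v₀ v₁) (hs : 0 ≤ s) (hs' : s ≤ smallTime γ v₁) :
    (v - v') ^ 2 * (s ^ 4 / 64) ≤ (respF γ v s - respF γ v' s) ^ 2 := by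
  rcases le_total v' v with hvv | hvv
  · have := h.mul_sq_le_respF_sub hv hv' hs hs' hvv
    have h0 : 0 ≤ (v - v') * (s ^ 2 / 8) := mul_nonneg (sub_nonneg.mpr hvv) (by positivity)
    nlinarith
  · have := h.mul_sq_le_respF_sub hv' hv hs hs' hvv
    have h0 : 0 ≤ (v' - v) * (s ^ 2 / 8) := mul_nonneg (sub_nonneg.mpr hvv) (by positivity)
    nlinarith

lemma Overdamped.sq_sub_respF_le (h : Overdamped γ v₀ v₁) {v v' s : ℝ} (hv : v ∈ Icc v₀ v₁)
    (hv' : v' ∈ Icc v₀ v₁) (hs : 0 ≤ s) :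
    (respF γ v s - respF γ v' s) ^ 2 ≤ (v - v') ^ 2 *
      (respBound γ v₁ ^ 4 * (2 / respRate γ v₀) ^ 2) * Real.exp (-respRate γ v₀ * s) := by
  have h1 := h.abs_respF_sub_le hv hv' hs
  have h2 := mul_exp_neg_le h.rate_pos s
  have h3 : |respF γ v s - respF γ v' s| ≤ |v - v'| * respBound γ v₁ ^ 2 *
      (2 / respRate γ v₀ * Real.exp (-(respRate γ v₀ / 2) * s)) :=
    h1.trans (by gcongr)
  have e : Real.exp (-respRate γ v₀ * s) = Real.exp (-(respRate γ v₀ / 2) * s) ^ 2 := by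
    rw [← Real.exp_nat_mul]; ring_nf
  rw [← sq_abs, ← sq_abs (v - v'), e]
  calc _ ≤ (|v - v'| * respBound γ v₁ ^ 2 *
      (2 / respRate γ v₀ * Real.exp (-(respRate γ v₀ / 2) * s))) ^ 2 := by gcongr
    _ = _ := by ring

/-! ### The set of times at which the momentum response is small -/

/-- Up to a common positive factor, $F$ is affine in $z=e^{-2us}$ and $X$ is $1-z\le1$. Hence $F$
small relative to $X$ confines $z$ to a $\kappa$-window around the only zero of the affine function,
and taking logarithms confines $s$. -/
lemma Overdamped.mem_Icc_of_respF_small (h : Overdamped γ v₀ v₁) {v κ s : ℝ} (hv : v ∈ Icc v₀ v₁)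
    (hκ : 0 < κ) (hκ' : κ ≤ respRate γ v₀ / 2) (hs : 0 ≤ s)
    (hlt : v₁ / κ ^ 2 * (respF γ v s * respF γ v s) < v * (respX γ v s * respX γ v s)) :
    s ∈ Icc (Real.log ((γ / 2 + modeU γ v) / (γ / 2 - modeU γ v + κ)) / (2 * modeU γ v))
      (Real.log ((γ / 2 + modeU γ v) / (γ / 2 - modeU γ v - κ)) / (2 * modeU γ v)) := by
  have hu := modeU_pos (h.mem_lt hv)
  have hlow := h.rate_le hv
  have hr := h.rate_pos
  have h0 := h.pos.trans_le hv.1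
  have hv1 := h0.trans_le hv.2
  have hγ := h.gamma_pos
  unfold respF respX at hlt
  set u := modeU γ v
  set z := Real.exp (-(2 * u) * s) with hz
  have hz0 : 0 < z := Real.exp_pos _
  have hz1 : z ≤ 1 := by rw [hz, Real.exp_le_one_iff]; nlinarith
  set e := Real.exp (-s * (γ / 2 - u)) with he
  have he0 : 0 < e := Real.exp_pos _
  have hplus : Real.exp (-s * (γ / 2 + u)) = e * z := by
    rw [he, hz, ← Real.exp_add]; ring_nf
  rw [hplus] at hlt
  have hq : 0 < (1 / (2 * u)) ^ 2 * e ^ 2 := by positivity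
  have h5 : v₁ / κ ^ 2 * ((γ / 2 + u) * z - (γ / 2 - u)) ^ 2 < v * (1 - z) ^ 2 := by
    refine lt_of_mul_lt_mul_left ?_ hq.le
    calc _ = _ := ?_
      _ < _ := hlt
      _ = _ := ?_
    -- Both sides are divided by the common factor $(e/2u)^2$ of the squared responses.
    · ring
    · ring
  have h6 : v₁ * ((γ / 2 + u) * z - (γ / 2 - u)) ^ 2 < v₁ * κ ^ 2 := by
    have : v * (1 - z) ^ 2 ≤ v₁ * 1 := by
      refine mul_le_mul hv.2 ?_ (sq_nonneg _) hv1.le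
      nlinarith
    rw [div_mul_eq_mul_div] at h5
    have h7 := h5.trans_le this
    rw [div_lt_iff₀ (by positivity)] at h7
    linarith
  have h7 := abs_lt_of_sq_lt_sq (lt_of_mul_lt_mul_left h6 hv1.le) hκ.le
  rw [abs_lt] at h7
  have hlz : Real.log z = -(2 * u) * s := by rw [hz, Real.log_exp]
  constructor
  · rw [div_le_iff₀ (by positivity)]
    have : Real.log ((γ / 2 + u) / (γ / 2 - u + κ)) ≤ Real.log z⁻¹ := by
      refine Real.log_le_log (by apply div_pos <;> linarith) ?_
      rw [inv_eq_one_div, div_le_div_iff₀ (by linarith) hz0]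
      linarith [h7.2]
    rw [Real.log_inv, hlz] at this
    linarith
  · rw [le_div_iff₀ (by positivity)]
    have : Real.log z⁻¹ ≤ Real.log ((γ / 2 + u) / (γ / 2 - u - κ)) := by
      refine Real.log_le_log (by positivity) ?_
      rw [inv_eq_one_div, div_le_div_iff₀ hz0 (by linarith)]
      linarith [h7.1]
    rw [Real.log_inv, hlz] at this
    linarith

/-- The difference of logarithms is $\log\frac{\gamma/2-u+\kappa}{\gamma/2-u-\kappa}$, which is
$O(\kappa)$ because $\kappa$ is at most half of the lower bound on $\gamma/2-u$. -/
lemma Overdamped.length_le (h : Overdamped γ v₀ v₁) {v κ : ℝ} (hv : v ∈ Icc v₀ v₁)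
    (hκ : 0 < κ) (hκ' : κ ≤ respRate γ v₀ / 2) :
    Real.log ((γ / 2 + modeU γ v) / (γ / 2 - modeU γ v - κ)) / (2 * modeU γ v) -
      Real.log ((γ / 2 + modeU γ v) / (γ / 2 - modeU γ v + κ)) / (2 * modeU γ v) ≤
      2 * κ / (modeU γ v₁ * respRate γ v₀) := by
  have hu := modeU_pos (h.mem_lt hv)
  have hu1 := modeU_pos h.lt
  have hlow := h.rate_le hv
  have hr := h.rate_pos
  have hγ := h.gamma_pos
  have hle := h.modeU_le hv
  set u := modeU γ v
  have a1 : 0 < γ / 2 - u - κ := by linarith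
  have a2 : 0 < γ / 2 - u + κ := by linarith
  have a3 : 0 < γ / 2 + u := by linarith
  rw [← sub_div, ← Real.log_div (by positivity) (by positivity)]
  have e : (γ / 2 + u) / (γ / 2 - u - κ) / ((γ / 2 + u) / (γ / 2 - u + κ)) =
      (γ / 2 - u + κ) / (γ / 2 - u - κ) := by field_simp
  rw [e]
  have h1 : Real.log ((γ / 2 - u + κ) / (γ / 2 - u - κ)) ≤ 4 * κ / respRate γ v₀ := by
    refine (Real.log_le_sub_one_of_pos (by positivity)).trans ?_
    have : (γ / 2 - u + κ) / (γ / 2 - u - κ) - 1 = 2 * κ / (γ / 2 - u - κ) := by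
      rw [div_sub_one a1.ne']; congr 1; ring
    rw [this, div_le_div_iff₀ a1 hr]
    nlinarith
  calc _ ≤ 4 * κ / respRate γ v₀ / (2 * modeU γ v₁) := by
        refine div_le_div₀ (by positivity) h1 (by positivity) (by linarith)
    _ = _ := by field_simp; ring

lemma Overdamped.integral_posPart_le (h : Overdamped γ v₀ v₁) {v κ : ℝ} (hv : v ∈ Icc v₀ v₁)
    (hκ : 0 < κ) (hκ' : κ ≤ respRate γ v₀ / 2) :
    ∫ s in Ioi (0 : ℝ), max (v * (respX γ v s * respX γ v s) -
      v₁ / κ ^ 2 * (respF γ v s * respF γ v s)) 0 ≤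
      v₁ * respBound γ v₁ ^ 2 * (2 * κ / (modeU γ v₁ * respRate γ v₀)) := by
  have h0 := h.pos.trans_le hv.1
  have hv1 := h0.trans_le hv.2
  have hlen := h.length_le hv hκ hκ'
  set s₁ := Real.log ((γ / 2 + modeU γ v) / (γ / 2 - modeU γ v + κ)) / (2 * modeU γ v)
  set s₂ := Real.log ((γ / 2 + modeU γ v) / (γ / 2 - modeU γ v - κ)) / (2 * modeU γ v)
  set M := v₁ * respBound γ v₁ ^ 2
  have hM : 0 ≤ M := by positivity
  have hint : Integrable ((Icc s₁ s₂).indicator fun _ => M) (volume.restrict (Ioi (0 : ℝ))) :=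
    ((integrable_indicator_iff measurableSet_Icc).mpr
      (integrableOn_const (by simp))).integrableOn
  calc _ ≤ ∫ s in Ioi (0 : ℝ), (Icc s₁ s₂).indicator (fun _ => M) s := by
        refine integral_mono_of_nonneg (ae_of_all _ fun s => le_max_right _ _) hint ?_
        filter_upwards [ae_restrict_mem measurableSet_Ioi] with s hs
        have hs0 : 0 ≤ s := le_of_lt hs
        by_cases hlt : v₁ / κ ^ 2 * (respF γ v s * respF γ v s) <
            v * (respX γ v s * respX γ v s)
        · rw [indicator_of_mem (h.mem_Icc_of_respF_small hv hκ hκ' hs0 hlt)]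
          refine max_le ?_ hM
          have h1 := h.abs_XX_le hv hs0
          have e : Real.exp (-(2 * respRate γ v₀) * s) ≤ 1 := by
            rw [Real.exp_le_one_iff]; nlinarith [h.rate_pos]
          have h2 : respX γ v s * respX γ v s ≤ respBound γ v₁ ^ 2 := by
            refine (le_abs_self _).trans (h1.trans ?_)
            nlinarith [sq_nonneg (respBound γ v₁)]
          have h3 : 0 ≤ v₁ / κ ^ 2 * (respF γ v s * respF γ v s) :=
            mul_nonneg (by positivity) (mul_self_nonneg _)
          have h4 : v * (respX γ v s * respX γ v s) ≤ M :=
            mul_le_mul hv.2 h2 (mul_self_nonneg _) hv1.le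
          linarith
        · rw [max_eq_right (by linarith)]
          exact indicator_nonneg (fun _ _ => hM) s
    _ ≤ ∫ s, (Icc s₁ s₂).indicator (fun _ => M) s :=
        setIntegral_le_integral ((integrable_indicator_iff measurableSet_Icc).mpr
          (integrableOn_const (by simp))) (ae_of_all _ fun s => indicator_nonneg (fun _ _ => hM) s)
    _ = max (s₂ - s₁) 0 * M := by
        rw [integral_indicator measurableSet_Icc, setIntegral_const, smul_eq_mul]
        congr 1
        rw [Measure.real, Real.volume_Icc, ENNReal.toReal_ofReal']
    _ ≤ _ := by
        rw [mul_comm]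
        refine mul_le_mul_of_nonneg_left (max_le hlen ?_) hM
        have := modeU_pos h.lt
        have := h.rate_pos
        positivity

/-- With $\theta=2\gamma/(K+1)$ the integrand is $-\theta(vX^2-KF^2)$, which is negative only on the
short interval where $F$ is small. The signed integral is $1-\theta/\gamma$; the negative part,
counted twice, returns at most half of the gain $\theta/\gamma$. -/
lemma Overdamped.exists_theta (h : Overdamped γ v₀ v₁) (hv01 : v₀ ≤ v₁) :
    ∃ θ > 0, ∀ v ∈ Icc v₀ v₁,
      ∫ s in Ioi (0 : ℝ), |2 * γ * (respF γ v s * respF γ v s) - θ * modeQ γ v s| ≤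
        1 - θ / (2 * γ) := by
  have hγ := h.gamma_pos
  have hB := h.bound_pos
  have hr := h.rate_pos
  have hu := modeU_pos h.lt
  have hv1 := h.pos.trans_le hv01
  set N := v₁ * respBound γ v₁ ^ 2 * (2 / (modeU γ v₁ * respRate γ v₀)) with hN
  have hN0 : 0 < N := by positivity
  -- The first bound keeps the bad time interval finite; the second makes the integral of the
  -- negative part, divided by $\theta$, at most $1/(4\gamma)$.
  set κ := min (respRate γ v₀ / 2) (1 / (4 * γ * N)) with hκd
  have hκ : 0 < κ := lt_min (by positivity) (by positivity)
  have hκN : κ * N ≤ 1 / (4 * γ) := by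
    calc κ * N ≤ 1 / (4 * γ * N) * N := by gcongr; exact min_le_right _ _
      _ = _ := by field_simp
  set K := v₁ / κ ^ 2
  have hK : 0 < K := by positivity
  refine ⟨2 * γ / (K + 1), by positivity, fun v hv => ?_⟩
  set θ := 2 * γ / (K + 1) with hθ
  have hθ0 : 0 < θ := by positivity
  have hθK : θ * (K + 1) = 2 * γ := by rw [hθ]; field_simp
  have hp := h.integral_posPart_le hv hκ (min_le_left _ _)
  have hp' : ∫ s in Ioi (0 : ℝ), max (v * (respX γ v s * respX γ v s) -
      K * (respF γ v s * respF γ v s)) 0 ≤ 1 / (4 * γ) := by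
    refine hp.trans (le_trans (le_of_eq ?_) hκN)
    rw [hN]; ring
  have e : ∀ s, |2 * γ * (respF γ v s * respF γ v s) - θ * modeQ γ v s| =
      2 * γ * (respF γ v s * respF γ v s) - θ * modeQ γ v s + 2 * θ *
        max (v * (respX γ v s * respX γ v s) - K * (respF γ v s * respF γ v s)) 0 := by
    intro s
    have e1 : 2 * γ * (respF γ v s * respF γ v s) - θ * modeQ γ v s =
        - (θ * (v * (respX γ v s * respX γ v s) - K * (respF γ v s * respF γ v s))) := by
      rw [← hθK]; unfold modeQ; ring
    rw [e1, abs_neg, abs_mul, abs_of_pos hθ0]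
    rcases le_total 0 (v * (respX γ v s * respX γ v s) - K * (respF γ v s * respF γ v s))
      with h1 | h1
    · rw [abs_of_nonneg h1, max_eq_left h1]; ring
    · rw [abs_of_nonpos h1, max_eq_right h1]; ring
  have i1 : IntegrableOn (fun s => 2 * γ * (respF γ v s * respF γ v s)) (Ioi 0) :=
    (h.integrableOn_FF hv hv).const_mul _
  have i2 : IntegrableOn (fun s => θ * modeQ γ v s) (Ioi 0) :=
    (h.integrableOn_modeQ hv).const_mul _
  have i3 : IntegrableOn (fun s => 2 * θ * max (v * (respX γ v s * respX γ v s) -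
      K * (respF γ v s * respF γ v s)) 0) (Ioi 0) :=
    ((((h.integrableOn_XX hv).const_mul v).sub
      ((h.integrableOn_FF hv hv).const_mul K)).pos_part).const_mul _
  simp_rw [e]
  have i12 : IntegrableOn (fun s => 2 * γ * (respF γ v s * respF γ v s) - θ * modeQ γ v s)
      (Ioi 0) := i1.sub i2
  rw [integral_add i12 i3, integral_sub i1 i2, integral_const_mul, integral_const_mul,
    integral_const_mul, h.integral_FF hv, h.integral_modeQ hv]
  have h2 : 2 * θ * ∫ s in Ioi (0 : ℝ), max (v * (respX γ v s * respX γ v s) -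
      K * (respF γ v s * respF γ v s)) 0 ≤ 2 * θ * (1 / (4 * γ)) := by gcongr
  have e2 : 2 * γ * (1 / (2 * γ)) = 1 := by field_simp
  have e3 : 2 * θ * (1 / (4 * γ)) = θ / (2 * γ) := by field_simp; norm_num
  have e4 : θ * (1 / γ) = 2 * (θ / (2 * γ)) := by field_simp
  linarith

end

/-! ### Volterra equations -/

section Volterra
variable {E : Type*} [NormedAddCommGroup E] [NormedSpace ℝ E]

/-- A renewal equation with a kernel of weighted mass less than one propagates exponential
decay. -/
lemma volterra_norm_le {z h : ℝ → E} {w : ℝ → ℝ} {β ρ H : ℝ} (hz : Continuous z)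
    (hw : IntegrableOn (fun s => Real.exp (β * s) * |w s|) (Ioi 0))
    (hρ : ∫ s in Ioi (0 : ℝ), Real.exp (β * s) * |w s| ≤ ρ) (hρ1 : ρ < 1)
    (hh : ∀ t, 0 ≤ t → ‖h t‖ ≤ H * Real.exp (-β * t))
    (heq : ∀ t, 0 ≤ t → z t = h t + ∫ s in (0 : ℝ)..t, w s • z (t - s)) {t : ℝ} (ht : 0 ≤ t) :
    ‖z t‖ ≤ H / (1 - ρ) * Real.exp (-β * t) := by
  have hcont : ContinuousOn (fun r => Real.exp (β * r) * ‖z r‖) (Icc 0 t) := by fun_prop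
  -- The weighted norm $e^{\beta r}\|z(r)\|$ attains its maximum $M$ on $[0,t]$. The equation at a
  -- maximizer gives $M\le H+\rho M$, so no a priori bound on $z$ is needed.
  obtain ⟨r₀, hr₀, hmax⟩ := isCompact_Icc.exists_isMaxOn (nonempty_Icc.mpr ht) hcont
  set M := Real.exp (β * r₀) * ‖z r₀‖ with hM
  have hM0 : 0 ≤ M := by positivity
  have hle : ∀ r, 0 ≤ r → r ≤ t → ‖z r‖ ≤ M * Real.exp (-β * r) := by
    intro r h0 h1
    have : Real.exp (β * r) * ‖z r‖ ≤ M := hmax ⟨h0, h1⟩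
    calc ‖z r‖ = (Real.exp (β * r) * ‖z r‖) * Real.exp (-β * r) := by
          rw [mul_right_comm, ← Real.exp_add]; simp
      _ ≤ _ := by gcongr
  have hint : ‖∫ s in (0 : ℝ)..r₀, w s • z (r₀ - s)‖ ≤ ρ * M * Real.exp (-β * r₀) := by
    have hi : IntervalIntegrable (fun s => M * Real.exp (-β * r₀) *
        (Real.exp (β * s) * |w s|)) volume 0 r₀ :=
      (intervalIntegrable_iff_integrableOn_Ioc_of_le hr₀.1).mpr
        ((hw.mono_set Ioc_subset_Ioi_self).const_mul _)
    refine (intervalIntegral.norm_integral_le_of_norm_le hr₀.1 (ae_of_all _ fun s hs => ?_)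
      hi).trans ?_
    · rw [norm_smul, Real.norm_eq_abs]
      have := hle (r₀ - s) (by linarith [hs.2]) (by linarith [hs.1, hr₀.2])
      calc |w s| * ‖z (r₀ - s)‖ ≤ |w s| * (M * Real.exp (-β * (r₀ - s))) := by gcongr
        _ = _ := by
          rw [show -β * (r₀ - s) = -β * r₀ + β * s by ring, Real.exp_add]; ring
    · rw [intervalIntegral.integral_const_mul, intervalIntegral.integral_of_le hr₀.1]
      have h1 : ∫ s in Ioc 0 r₀, Real.exp (β * s) * |w s| ≤ ρ :=
        (setIntegral_mono_set hw (ae_of_all _ fun s => by simp only [Pi.zero_apply]; positivity)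
          (Filter.Eventually.of_forall (Ioc_subset_Ioi_self : Ioc 0 r₀ ⊆ Ioi 0))).trans hρ
      calc _ ≤ M * Real.exp (-β * r₀) * ρ := by gcongr
        _ = _ := by ring
  have hMle : M ≤ H + ρ * M := by
    have h1 : ‖z r₀‖ ≤ H * Real.exp (-β * r₀) + ρ * M * Real.exp (-β * r₀) := by
      rw [heq r₀ hr₀.1]
      exact (norm_add_le _ _).trans (add_le_add (hh r₀ hr₀.1) hint)
    calc M ≤ Real.exp (β * r₀) *
          (H * Real.exp (-β * r₀) + ρ * M * Real.exp (-β * r₀)) := by rw [hM]; gcongr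
      _ = (H + ρ * M) * (Real.exp (β * r₀) * Real.exp (-β * r₀)) := by ring
      _ = _ := by rw [← Real.exp_add]; simp
  refine (hle t ht le_rfl).trans ?_
  gcongr
  rw [le_div_iff₀ (by linarith)]
  linarith

lemma continuous_volterra_integral {F : ℝ → ℝ → E} (hF : Continuous (Function.uncurry F)) :
    Continuous fun t => ∫ s in (0 : ℝ)..t, F t s :=
  intervalIntegral.continuous_parametric_intervalIntegral_of_continuous hF continuous_id

variable [CompleteSpace E]

/-- Bounded continuous kernels and sources admit a continuous solution. -/
lemma exists_volterra_solution {k : ℝ → E →L[ℝ] E} {g : ℝ → E} {Ck G : ℝ}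
    (hk : Continuous k) (hg : Continuous g) (hCk : ∀ s, 0 ≤ s → ‖k s‖ ≤ Ck)
    (hG : ∀ s, 0 ≤ s → ‖g s‖ ≤ G) :
    ∃ T : ℝ → E, Continuous T ∧
      ∀ t, 0 ≤ t → T t = g t + ∫ s in (0 : ℝ)..t, k s (T (t - s)) := by
  have hCk0 : 0 ≤ Ck := (norm_nonneg _).trans (hCk 0 le_rfl)
  -- In the unknown $\varphi(t)=e^{-\lambda t}T(t)$ the convolution has norm at most
  -- $C_k/\lambda<1/2$, so Banach's fixed point theorem applies on the whole half line at once.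
  set lam := 2 * Ck + 1 with hlam
  have hlam0 : 0 < lam := by linarith
  -- Replacing $t$ by $\max(t,0)$ lets the map act on bounded continuous functions on all of
  -- $\mathbb R$, while only nonnegative times enter.
  have hcont : ∀ φ : ℝ → E, Continuous φ → Continuous fun t : ℝ =>
      Real.exp (-lam * max t 0) • g (max t 0) +
        ∫ s in (0 : ℝ)..max t 0, Real.exp (-lam * s) • k s (φ (max t 0 - s)) := by
    intro φ hφ
    refine Continuous.add (by fun_prop) ?_
    have := continuous_volterra_integral (E := E)
      (F := fun t s => Real.exp (-lam * s) • k s (φ (t - s))) (by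
        unfold Function.uncurry
        have h1 : Continuous fun p : ℝ × ℝ => k p.2 := hk.comp continuous_snd
        have h2 : Continuous fun p : ℝ × ℝ => φ (p.1 - p.2) := by fun_prop
        have h3 := h1.clm_apply h2
        fun_prop)
    exact this.comp (continuous_id.max continuous_const)
  have hexp : ∀ r : ℝ, 0 ≤ r → Real.exp (-lam * r) ≤ 1 := fun r hr => by
    rw [Real.exp_le_one_iff]; nlinarith
  have hconv : ∀ (ψ : ℝ → E) (D : ℝ) (t : ℝ), 0 ≤ D → 0 ≤ t → (∀ r, ‖ψ r‖ ≤ D) →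
      ‖∫ s in (0 : ℝ)..t, Real.exp (-lam * s) • k s (ψ (t - s))‖ ≤ D / 2 := by
    intro ψ D t hD ht hψ
    refine (intervalIntegral.norm_integral_le_of_norm_le (g := fun s => Ck * D *
      Real.exp (-lam * s)) ht (ae_of_all _ fun s hs => ?_)
      (Continuous.intervalIntegrable (by fun_prop) _ _)).trans ?_
    · rw [norm_smul, Real.norm_eq_abs, abs_of_pos (Real.exp_pos _), mul_comm]
      gcongr
      calc _ ≤ ‖k s‖ * ‖ψ (t - s)‖ := (k s).le_opNorm _
        _ ≤ _ := by
          gcongr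
          · exact hCk s hs.1.le
          · exact hψ _
    · rw [intervalIntegral.integral_const_mul, intervalIntegral.integral_of_le ht]
      have h1 : ∫ s in Ioc 0 t, Real.exp (-lam * s) ≤ 1 / lam := by
        refine (setIntegral_mono_set (exp_neg_integrableOn_Ioi 0 hlam0)
          (ae_of_all _ fun s => by simp only [Pi.zero_apply]; positivity)
          (Filter.Eventually.of_forall (Ioc_subset_Ioi_self : Ioc 0 t ⊆ Ioi 0))).trans ?_
        rw [integral_Ioi_exp_neg_mul hlam0]; simp
      calc _ ≤ Ck * D * (1 / lam) := by gcongr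
        _ ≤ D / 2 := by
          rw [mul_one_div, div_le_div_iff₀ hlam0 two_pos]
          nlinarith
  have hbound : ∀ φ : BoundedContinuousFunction ℝ E, ∀ t : ℝ,
      ‖Real.exp (-lam * max t 0) • g (max t 0) +
        ∫ s in (0 : ℝ)..max t 0, Real.exp (-lam * s) • k s (φ (max t 0 - s))‖ ≤
          G + ‖φ‖ / 2 := by
    intro φ t
    have ht : 0 ≤ max t 0 := le_max_right _ _
    refine (norm_add_le _ _).trans (add_le_add ?_ ?_)
    · rw [norm_smul, Real.norm_eq_abs, abs_of_pos (Real.exp_pos _)]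
      calc _ ≤ 1 * G := mul_le_mul (hexp _ ht) (hG _ ht) (norm_nonneg _) zero_le_one
        _ = G := one_mul G
    · exact hconv φ ‖φ‖ _ (norm_nonneg _) ht fun r => φ.norm_coe_le_norm r
  let K : BoundedContinuousFunction ℝ E → BoundedContinuousFunction ℝ E := fun φ =>
    BoundedContinuousFunction.ofNormedAddCommGroup _ (hcont φ φ.continuous) _ (hbound φ)
  have hK : ContractingWith (1 / 2) K := by
    refine ⟨by norm_num, LipschitzWith.of_dist_le_mul fun φ ψ => ?_⟩
    refine (BoundedContinuousFunction.dist_le (by positivity)).mpr fun t => ?_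
    have ht : 0 ≤ max t 0 := le_max_right _ _
    have hint : ∀ χ : BoundedContinuousFunction ℝ E, IntervalIntegrable
        (fun s => Real.exp (-lam * s) • k s (χ (max t 0 - s))) volume 0 (max t 0) := by
      intro χ
      refine Continuous.intervalIntegrable ?_ _ _
      have h2 : Continuous fun s : ℝ => χ (max t 0 - s) := by fun_prop
      have h3 := hk.clm_apply h2
      fun_prop
    have h1 := hconv (fun r => φ r - ψ r) (dist φ ψ) (max t 0) dist_nonneg ht (fun r => by
      rw [← dist_eq_norm]; exact BoundedContinuousFunction.dist_coe_le_dist r)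
    have h2 : dist (K φ t) (K ψ t) = ‖∫ s in (0 : ℝ)..max t 0,
        Real.exp (-lam * s) • k s (φ (max t 0 - s) - ψ (max t 0 - s))‖ := by
      simp only [K, BoundedContinuousFunction.coe_ofNormedAddCommGroup, dist_eq_norm,
        add_sub_add_left_eq_sub]
      rw [← intervalIntegral.integral_sub (hint φ) (hint ψ)]
      simp only [map_sub, smul_sub]
    rw [h2]
    refine h1.trans (le_of_eq ?_)
    push_cast; ring
  set φ := hK.fixedPoint K
  have hφ : K φ = φ := hK.fixedPoint_isFixedPt
  refine ⟨fun t => Real.exp (lam * t) • φ t, by fun_prop, fun t ht => ?_⟩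
  have h1 : φ t = Real.exp (-lam * t) • g t +
      ∫ s in (0 : ℝ)..t, Real.exp (-lam * s) • k s (φ (t - s)) := by
    have := DFunLike.congr_fun hφ t
    simp only [K, BoundedContinuousFunction.coe_ofNormedAddCommGroup, max_eq_left ht] at this
    exact this.symm
  calc Real.exp (lam * t) • φ t = (Real.exp (lam * t) * Real.exp (-lam * t)) • g t +
        ∫ s in (0 : ℝ)..t, Real.exp (lam * t) • Real.exp (-lam * s) • k s (φ (t - s)) := by
        rw [intervalIntegral.integral_smul, mul_smul, ← smul_add, ← h1]
    _ = _ := by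
        congr 1
        · rw [← Real.exp_add]; simp
        · refine intervalIntegral.integral_congr fun s _ => ?_
          simp only [map_smul, smul_smul]
          rw [← Real.exp_add]
          congr 2; ring

end Volterra

/-! ### Tails of integrable functions -/

section Tail
variable {E : Type*} [NormedAddCommGroup E] [NormedSpace ℝ E]

/-- The tail integral `∫_t^∞ q`. -/
def tail (q : ℝ → E) (t : ℝ) : E := (∫ s in Ioi (0 : ℝ), q s) - ∫ s in (0 : ℝ)..t, q s

lemma tail_zero (q : ℝ → E) : tail q 0 = ∫ s in Ioi (0 : ℝ), q s := by simp [tail]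

/-- Defining the tail by subtraction makes it differentiable on the whole line for continuous $q$;
it is known to be an integral over $(t,\infty)$ only for $t\ge0$. -/
lemma tail_eq {q : ℝ → E} (hq : IntegrableOn q (Ioi 0)) {t : ℝ} (ht : 0 ≤ t) :
    tail q t = ∫ s in Ioi t, q s := by
  have h := intervalIntegral.integral_interval_add_Ioi hq (hq.mono_set (Ioi_subset_Ioi ht))
  rw [tail, ← h]; abel

lemma tail_norm_le {q : ℝ → E} {C c : ℝ} (hc : 0 < c) (hq : Continuous q)
    (h : ∀ s, 0 ≤ s → ‖q s‖ ≤ C * Real.exp (-c * s)) {t : ℝ} (ht : 0 ≤ t) :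
    ‖tail q t‖ ≤ C / c * Real.exp (-c * t) := by
  rw [tail_eq (integrableOn_Ioi_of_exp_bound hc hq h) ht]
  exact norm_integral_Ioi_le_of_exp_bound hc ht h

lemma hasDerivAt_tail [CompleteSpace E] {q : ℝ → E} (hq : Continuous q) (t : ℝ) :
    HasDerivAt (tail q) (-q t) t :=
  (hq.integral_hasStrictDerivAt 0 t).hasDerivAt.const_sub _

lemma continuous_tail [CompleteSpace E] {q : ℝ → E} (hq : Continuous q) : Continuous (tail q) :=
  continuous_iff_continuousAt.mpr fun t => (hasDerivAt_tail hq t).continuousAt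

/-- Integration by parts, with antiderivative $-s\,Q(s)-\int_s^\infty Q$ of $s\,q(s)$, where $Q$ is
the tail of $q$. -/
lemma integral_tail {q : ℝ → ℝ} {C c : ℝ} (hc : 0 < c) (hq : Continuous q)
    (h : ∀ s, 0 ≤ s → |q s| ≤ C * Real.exp (-c * s)) :
    ∫ s in Ioi (0 : ℝ), tail q s = ∫ s in Ioi (0 : ℝ), s * q s := by
  have hQ := continuous_tail hq
  have hQb : ∀ s, 0 ≤ s → |tail q s| ≤ C / c * Real.exp (-c * s) := fun s hs =>
    tail_norm_le hc hq h hs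
  have hC : 0 ≤ C := by simpa using (abs_nonneg _).trans (h 0 le_rfl)
  have weak : ∀ A s : ℝ, 0 ≤ A → 0 ≤ s → A * Real.exp (-c * s) ≤
      A * Real.exp (-(c / 2) * s) := by
    intro A s hA hs
    gcongr; linarith
  have bd : ∀ (A a s : ℝ), 0 ≤ A → 0 ≤ s → |a| ≤ A * Real.exp (-c * s) →
      |s * a| ≤ A * (2 / c) * Real.exp (-(c / 2) * s) := by
    intro A a s hA hs ha
    rw [abs_mul, abs_of_nonneg hs]
    calc s * |a| ≤ s * (A * Real.exp (-c * s)) := by gcongr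
      _ = A * (s * Real.exp (-c * s)) := by ring
      _ ≤ A * (2 / c * Real.exp (-(c / 2) * s)) := by
        exact mul_le_mul_of_nonneg_left (mul_exp_neg_le hc s) hA
      _ = _ := by ring
  have key := integral_Ioi_eq_of_hasDerivAt (f := fun s => -(s * tail q s) - tail (tail q) s)
    (f' := fun s => s * q s) (c := c / 2) (a := 0) (C := C / c * (2 / c) + C / c / c)
    (C' := C * (2 / c)) (by positivity) le_rfl
    (fun s => ((((hasDerivAt_id s).mul (hasDerivAt_tail hq s)).neg).sub
      (hasDerivAt_tail hQ s)).congr_deriv (by simp only [id]; ring)) (by fun_prop)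
    (fun s hs => by
      rw [add_mul]
      refine (abs_sub _ _).trans (add_le_add ?_ ?_)
      · rw [abs_neg]; exact bd _ _ s (by positivity) hs (hQb s hs)
      · exact (tail_norm_le hc hQ hQb hs).trans (weak _ s (by positivity) hs))
    (fun s hs => bd C _ s hC hs (h s hs))
  rw [key, ← tail_zero (tail q)]; simp

/-- Exchange of the order of integration over a triangle. -/
lemma integral_convolution_swap {q : ℝ → ℝ} {Y : ℝ → E} (hq : Continuous q) (hY : Continuous Y)
    {t : ℝ} (ht : 0 ≤ t) :
    ∫ s in (0 : ℝ)..t, ∫ r in (0 : ℝ)..s, q r • Y (s - r) =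
      ∫ r in (0 : ℝ)..t, q r • ∫ s in (0 : ℝ)..t - r, Y s := by
  -- An indicator extends the integrand from the triangle $r\le s$ to the square, where Fubini
  -- applies.
  set G : ℝ → ℝ → E := fun s r => (Iic s).indicator (fun r => q r • Y (s - r)) r with hG
  have hint : Integrable (Function.uncurry G)
      ((volume.restrict (Ioc 0 t)).prod (volume.restrict (Ioc 0 t))) := by
    have h1 : Continuous fun p : ℝ × ℝ => q p.2 • Y (p.1 - p.2) := by fun_prop
    have h2 : IntegrableOn (fun p : ℝ × ℝ => q p.2 • Y (p.1 - p.2)) (Ioc 0 t ×ˢ Ioc 0 t)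
        (volume.prod volume) :=
      (h1.continuousOn.integrableOn_compact (isCompact_Icc.prod isCompact_Icc)).mono_set
        (prod_mono Ioc_subset_Icc_self Ioc_subset_Icc_self)
    rw [Measure.prod_restrict]
    have h3 : MeasurableSet {p : ℝ × ℝ | p.2 ≤ p.1} :=
      measurableSet_le measurable_snd measurable_fst
    have h4 := h2.indicator h3
    refine h4.congr (ae_of_all _ fun p => ?_)
    simp only [Function.uncurry, hG, indicator, mem_ofPred_eq, mem_Iic]
  have hl : ∫ s in (0 : ℝ)..t, ∫ r in (0 : ℝ)..s, q r • Y (s - r) =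
      ∫ s in Ioc 0 t, ∫ r in Ioc 0 t, G s r := by
    rw [intervalIntegral.integral_of_le ht]
    refine setIntegral_congr_fun measurableSet_Ioc fun s hs => ?_
    simp only [hG]
    rw [setIntegral_indicator measurableSet_Iic, intervalIntegral.integral_of_le hs.1.le]
    congr 2
    ext r; simp only [mem_Ioc, mem_inter_iff, mem_Iic]
    exact ⟨fun h => ⟨⟨h.1, h.2.trans hs.2⟩, h.2⟩, fun h => ⟨h.1.1, h.2⟩⟩
  have hr : ∫ r in (0 : ℝ)..t, q r • ∫ s in (0 : ℝ)..t - r, Y s =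
      ∫ r in Ioc 0 t, ∫ s in Ioc 0 t, G s r := by
    rw [intervalIntegral.integral_of_le ht]
    refine setIntegral_congr_fun measurableSet_Ioc fun r hr => ?_
    have e : ∀ s, G s r = (Ici r).indicator (fun s => q r • Y (s - r)) s := by
      intro s; simp only [hG, indicator, mem_Iic, mem_Ici]
    simp only [e]
    rw [setIntegral_indicator measurableSet_Ici]
    have e2 : Ioc 0 t ∩ Ici r = Icc r t := by
      ext s; simp only [mem_Ioc, mem_inter_iff, mem_Ici, mem_Icc]
      exact ⟨fun h => ⟨h.2, h.1.2⟩, fun h => ⟨⟨hr.1.trans_le h.1, h.2⟩, h.1⟩⟩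
    rw [e2, integral_Icc_eq_integral_Ioc, ← intervalIntegral.integral_of_le hr.2,
      intervalIntegral.integral_smul]
    congr 1
    rw [intervalIntegral.integral_comp_sub_right (fun s => Y s) r, sub_self]
  rw [hl, hr, integral_integral_swap hint]

/-- The conserved quantity of a renewal equation. -/
lemma integral_tail_convolution [CompleteSpace E] {q : ℝ → ℝ} {Y f : ℝ → E} (hq : Continuous q)
    (hY : Continuous Y) (hf : Continuous f) (h1 : ∫ s in Ioi (0 : ℝ), q s = 1)
    (heq : ∀ t, 0 ≤ t → Y t = f t + ∫ s in (0 : ℝ)..t, q s • Y (t - s)) {t : ℝ} (ht : 0 ≤ t) :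
    ∫ s in (0 : ℝ)..t, tail q s • Y (t - s) = ∫ s in (0 : ℝ)..t, f s := by
  set W : ℝ → E := fun r => ∫ s in (0 : ℝ)..r, Y s with hW
  have hWd : ∀ r, HasDerivAt W (Y r) r := fun r => (hY.integral_hasStrictDerivAt 0 r).hasDerivAt
  have hWc : Continuous W := continuous_iff_continuousAt.mpr fun r => (hWd r).continuousAt
  have hQc := continuous_tail hq
  have hIc : Continuous fun t => ∫ s in (0 : ℝ)..t, q s • Y (t - s) :=
    continuous_volterra_integral (F := fun t s => q s • Y (t - s))
      (by unfold Function.uncurry; fun_prop)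
  -- The renewal equation integrated in time: the primitive $W$ of $Y$ satisfies $W=\int f+q*W$.
  have e1 : W t = (∫ s in (0 : ℝ)..t, f s) + ∫ r in (0 : ℝ)..t, q r • W (t - r) := by
    rw [← integral_convolution_swap hq hY ht, ← intervalIntegral.integral_add
      (hf.intervalIntegrable _ _) (hIc.intervalIntegrable _ _)]
    refine intervalIntegral.integral_congr fun s hs => ?_
    rw [uIcc_of_le ht] at hs
    exact heq s hs.1
  -- Integration by parts with $(\mathrm{tail}\,q)'=-q$; the boundary term is $W(t)$ because the
  -- mass of $q$ is one. Comparison with `e1` cancels $q*W$.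
  have e2 : ∫ s in (0 : ℝ)..t, (tail q s • Y (t - s) + q s • W (t - s)) = W t := by
    have hd : ∀ s, HasDerivAt (fun s => -(tail q s • W (t - s)))
        (tail q s • Y (t - s) + q s • W (t - s)) s := by
      intro s
      have a := (hWd (t - s)).scomp s ((hasDerivAt_id s).const_sub t)
      refine ((hasDerivAt_tail hq s).smul a).neg.congr_deriv ?_
      simp only [Function.comp]
      module
    rw [intervalIntegral.integral_eq_sub_of_hasDerivAt (fun s _ => hd s)
      (Continuous.intervalIntegrable (by fun_prop) _ _)]
    simp [hW, tail_zero, h1]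
  rw [intervalIntegral.integral_add (Continuous.intervalIntegrable (by fun_prop) _ _)
    (Continuous.intervalIntegrable (by fun_prop) _ _)] at e2
  rw [e1] at e2
  exact add_right_cancel e2

/-- A renewal theorem with exponential remainder. -/
theorem renewal_asymptotics [CompleteSpace E] {q : ℝ → ℝ} {Y f : ℝ → E} {A β θ ρ G m : ℝ} (hβ : 0 < β)
    (hq : Continuous q) (hqb : ∀ s, 0 ≤ s → |q s| ≤ A * Real.exp (-(2 * β) * s))
    (h1 : ∫ s in Ioi (0 : ℝ), q s = 1) (hθ : 0 < θ)
    (hρ : ∫ s in Ioi (0 : ℝ), Real.exp (β * s) * |q s - θ * tail q s| ≤ ρ) (hρ1 : ρ < 1)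
    (hm : ∫ s in Ioi (0 : ℝ), tail q s = m) (hm0 : 0 < m)
    (hf : Continuous f) (hfb : ∀ s, 0 ≤ s → ‖f s‖ ≤ G * Real.exp (-(2 * β) * s))
    (hY : Continuous Y)
    (heq : ∀ t, 0 ≤ t → Y t = f t + ∫ s in (0 : ℝ)..t, q s • Y (t - s)) {t : ℝ} (ht : 0 ≤ t) :
    ‖Y t - m⁻¹ • ∫ s in Ioi (0 : ℝ), f s‖ ≤
      (G * (1 + θ / (2 * β)) * (1 + A / ((2 * β) ^ 2 * m))) / (1 - ρ) * Real.exp (-β * t) := by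
  have h2β : 0 < 2 * β := by linarith
  have hA0 : 0 ≤ A := by simpa using (abs_nonneg _).trans (hqb 0 le_rfl)
  have hG0 : 0 ≤ G := by simpa using (norm_nonneg _).trans (hfb 0 le_rfl)
  have hQc := continuous_tail hq
  have hQb : ∀ s, 0 ≤ s → |tail q s| ≤ A / (2 * β) * Real.exp (-(2 * β) * s) := fun s hs =>
    tail_norm_le h2β hq hqb hs
  have hQQb : ∀ s, 0 ≤ s → |tail (tail q) s| ≤
      A / (2 * β) / (2 * β) * Real.exp (-(2 * β) * s) := fun s hs =>
    tail_norm_le h2β hQc hQb hs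
  have hFb : ∀ s, 0 ≤ s → ‖tail f s‖ ≤ G / (2 * β) * Real.exp (-(2 * β) * s) := fun s hs =>
    tail_norm_le h2β hf hfb hs
  set B : E := m⁻¹ • ∫ s in Ioi (0 : ℝ), f s with hB
  have hBm : m • B = ∫ s in Ioi (0 : ℝ), f s := by
    rw [hB, smul_smul, mul_inv_cancel₀ hm0.ne', one_smul]
  have hBn : ‖B‖ ≤ G / (2 * β * m) := by
    have := norm_integral_Ioi_le_of_exp_bound h2β le_rfl hfb
    rw [hB, norm_smul, norm_inv, Real.norm_eq_abs, abs_of_pos hm0]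
    simp only [mul_zero, Real.exp_zero, mul_one] at this
    calc _ ≤ m⁻¹ * (G / (2 * β)) := by gcongr
      _ = _ := by field_simp
  clear_value B
  -- Subtracting $\theta$ times the conserved quantity gives an equation with the contracting kernel
  -- $q-\theta\,\mathrm{tail}\,q$. The limit $B$ is chosen with $mB=\int f$, so the constants cancel
  -- and the new source contains only tails.
  refine volterra_norm_le (z := fun t => Y t - B) (w := fun s => q s - θ * tail q s)
    (h := fun t => f t - θ • tail f t - tail q t • B + (θ * tail (tail q) t) • B)
    (hY.sub continuous_const) ?_ hρ hρ1 ?_ ?_ ht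
  · refine integrableOn_Ioi_of_exp_bound hβ (C := A + θ * (A / (2 * β))) (by fun_prop)
      fun s hs => ?_
    rw [Real.norm_eq_abs, abs_mul, abs_abs, abs_of_pos (Real.exp_pos _)]
    have : |q s - θ * tail q s| ≤ (A + θ * (A / (2 * β))) * Real.exp (-(2 * β) * s) := by
      rw [add_mul]
      refine (abs_sub _ _).trans (add_le_add (hqb s hs) ?_)
      rw [abs_mul, abs_of_pos hθ, mul_assoc]
      gcongr; exact hQb s hs
    calc _ ≤ Real.exp (β * s) * ((A + θ * (A / (2 * β))) * Real.exp (-(2 * β) * s)) := by gcongr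
      _ = (A + θ * (A / (2 * β))) * (Real.exp (β * s) * Real.exp (-(2 * β) * s)) := by ring
      _ = _ := by rw [← Real.exp_add]; ring_nf
  · intro s hs
    have he : Real.exp (-(2 * β) * s) ≤ Real.exp (-β * s) :=
      Real.exp_le_exp.mpr (by nlinarith)
    set e := Real.exp (-(2 * β) * s)
    have he0 : 0 < e := Real.exp_pos _
    calc ‖f s - θ • tail f s - tail q s • B + (θ * tail (tail q) s) • B‖
        ≤ ‖f s‖ + ‖θ • tail f s‖ + ‖tail q s • B‖ + ‖(θ * tail (tail q) s) • B‖ :=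
          (norm_add_le _ _).trans (add_le_add ((norm_sub_le _ _).trans
            (add_le_add (norm_sub_le _ _) le_rfl)) le_rfl)
      _ ≤ G * e + θ * (G / (2 * β) * e) + (A / (2 * β) * e) * (G / (2 * β * m)) +
          θ * (A / (2 * β) / (2 * β) * e) * (G / (2 * β * m)) := by
          rw [norm_smul, norm_smul, norm_smul, norm_mul, Real.norm_eq_abs, Real.norm_eq_abs,
            Real.norm_eq_abs, abs_of_pos hθ]
          have a1 := hfb s hs
          have a2 := hFb s hs
          have a3 := hQb s hs
          have a4 := hQQb s hs
          gcongr
      _ = (G * (1 + θ / (2 * β)) * (1 + A / ((2 * β) ^ 2 * m))) * e := by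
          field_simp; ring
      _ ≤ _ := by gcongr
  · intro t ht
    have c1 : IntervalIntegrable (fun s => q s • Y (t - s)) volume 0 t :=
      Continuous.intervalIntegrable (by fun_prop) _ _
    have c2 : IntervalIntegrable (fun s => tail q s • Y (t - s)) volume 0 t :=
      Continuous.intervalIntegrable (by fun_prop) _ _
    have i1 : ∫ s in (0 : ℝ)..t, (q s - θ * tail q s) • (Y (t - s) - B) =
        (∫ s in (0 : ℝ)..t, q s • Y (t - s)) - θ • (∫ s in (0 : ℝ)..t, tail q s • Y (t - s)) -
          ((∫ s in (0 : ℝ)..t, q s) - θ * ∫ s in (0 : ℝ)..t, tail q s) • B := by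
      have c3 : IntervalIntegrable q volume 0 t := hq.intervalIntegrable _ _
      have c5 : IntervalIntegrable (fun s => θ • tail q s • Y (t - s)) volume 0 t := c2.smul θ
      have c4 : IntervalIntegrable (tail q) volume 0 t := hQc.intervalIntegrable _ _
      rw [← intervalIntegral.integral_smul, ← intervalIntegral.integral_sub c1 c5,
        ← intervalIntegral.integral_const_mul, ← intervalIntegral.integral_sub c3
          (c4.const_mul θ), ← intervalIntegral.integral_smul_const,
        ← intervalIntegral.integral_sub]
      · refine intervalIntegral.integral_congr fun s _ => ?_
        module
      · exact Continuous.intervalIntegrable (by fun_prop) _ _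
      · exact Continuous.intervalIntegrable (by fun_prop) _ _
    rw [i1, integral_tail_convolution hq hY hf h1 heq ht]
    have b1 : ∫ s in (0 : ℝ)..t, q s = 1 - tail q t := by rw [tail, h1]; ring
    have b2 : ∫ s in (0 : ℝ)..t, tail q s = m - tail (tail q) t := by
      rw [tail, hm]; ring
    have b3 : ∫ s in (0 : ℝ)..t, f s = m • B - tail f t := by
      rw [tail, hBm]; abel
    rw [b1, b2, b3]
    have := heq t ht
    generalize (∫ s in (0 : ℝ)..t, q s • Y (t - s)) = J at *
    rw [this]
    module

end Tail

/-! ### Memory kernels of single Fourier modes -/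

/-- A memory kernel `p` that is close to the probability density `p₀` when `V` is small, and that
has total mass less than one when `V` is not small. -/
structure KernelPair (γ C c κ θ ρ : ℝ) (p₀ p : ℝ → ℝ) (V : ℝ) : Prop where
  cont₀ : Continuous p₀
  cont : Continuous p
  bound₀ : ∀ s, 0 ≤ s → p₀ s ≤ C * Real.exp (-c * s)
  abs_le : ∀ s, |p s| ≤ p₀ s
  diff : ∀ s, 0 ≤ s → p₀ s - p s ≤ C * V * Real.exp (-c * s)
  mass₀ : ∫ s in Ioi (0 : ℝ), p₀ s = 1
  mean₀ : ∫ s in Ioi (0 : ℝ), s * p₀ s = 1 / γ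
  gap : ∫ s in Ioi (0 : ℝ), |p s| ≤ 1 - κ * V
  contraction : ∫ s in Ioi (0 : ℝ), |p₀ s - θ * tail p₀ s| ≤ ρ

lemma exp_sub_exp_le {a b : ℝ} : Real.exp b - Real.exp a ≤ (b - a) * Real.exp b := by
  have h := Real.add_one_le_exp (a - b)
  have e : Real.exp a = Real.exp b * Real.exp (a - b) := by rw [← Real.exp_add]; ring_nf
  rw [e]; nlinarith [Real.exp_pos b]

lemma le_exp_sub_exp {a b : ℝ} (ha : 0 ≤ a) (hab : a ≤ b) :
    b - a ≤ Real.exp b - Real.exp a := by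
  have h := Real.add_one_le_exp (b - a)
  have e : Real.exp b = Real.exp a * Real.exp (b - a) := by rw [← Real.exp_add]; ring_nf
  have h1 : 1 ≤ Real.exp a := Real.one_le_exp ha
  rw [e]; nlinarith [Real.exp_pos a]

lemma exp_sub_one_sub_le {x : ℝ} (hx : 0 ≤ x) : Real.exp x - 1 - x ≤ x ^ 2 * Real.exp x := by
  have h := exp_sub_exp_le (a := 0) (b := x)
  simp only [Real.exp_zero, sub_zero] at h
  nlinarith

lemma exp_mul_exp_le {r c s : ℝ} (hs : 0 ≤ s) (hr : r ≤ c / 2) :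
    Real.exp (s * r) * Real.exp (-c * s) ≤ Real.exp (-(c / 2) * s) := by
  rw [← Real.exp_add]
  exact Real.exp_le_exp.mpr (by nlinarith)

lemma mul_exp_mul_exp_le {r c s : ℝ} (hc : 0 < c) (hs : 0 ≤ s) (hr : r ≤ c / 2) :
    s * (Real.exp (s * r) * Real.exp (-c * s)) ≤ 4 / c * Real.exp (-(c / 4) * s) := by
  have h1 := mul_exp_neg_le (by linarith : 0 < c / 2) s
  have h2 := exp_mul_exp_le hs hr
  calc _ ≤ s * Real.exp (-(c / 2) * s) := by gcongr
    _ ≤ _ := h1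
    _ = _ := by
      rw [show 2 / (c / 2) = 4 / c by field_simp; norm_num, show c / 2 / 2 = c / 4 by ring]

lemma sq_mul_exp_mul_exp_le {r c s : ℝ} (hc : 0 < c) (hs : 0 ≤ s) (hr : r ≤ c / 2) :
    s ^ 2 * (Real.exp (s * r) * Real.exp (-c * s)) ≤ 64 / c ^ 2 * Real.exp (-(c / 4) * s) := by
  have h1 := mul_exp_neg_le (by linarith : 0 < c / 4) s
  have h2 := exp_mul_exp_le hs hr
  have e1 : Real.exp (-(c / 2) * s) = Real.exp (-(c / 4) * s) ^ 2 := by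
    rw [← Real.exp_nat_mul]; ring_nf
  have e2 : Real.exp (-(c / 4) * s) = Real.exp (-(c / 4 / 2) * s) ^ 2 := by
    rw [← Real.exp_nat_mul]; ring_nf
  calc _ ≤ s ^ 2 * Real.exp (-(c / 2) * s) := by gcongr
    _ = (s * Real.exp (-(c / 4) * s)) ^ 2 := by rw [e1]; ring
    _ ≤ (2 / (c / 4) * Real.exp (-(c / 4 / 2) * s)) ^ 2 := by gcongr
    _ = 64 / c ^ 2 * Real.exp (-(c / 4 / 2) * s) ^ 2 := by field_simp; norm_num
    _ = _ := by rw [← e2]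

section
variable {γ C c κ θ ρ : ℝ} {p₀ p : ℝ → ℝ} {V : ℝ}

namespace KernelPair

lemma nonneg₀ (k : KernelPair γ C c κ θ ρ p₀ p V) (s : ℝ) : 0 ≤ p₀ s :=
  (abs_nonneg _).trans (k.abs_le s)

lemma C_nonneg (k : KernelPair γ C c κ θ ρ p₀ p V) : 0 ≤ C := by
  simpa using (k.nonneg₀ 0).trans (k.bound₀ 0 le_rfl)

lemma abs_le_exp (k : KernelPair γ C c κ θ ρ p₀ p V) {s : ℝ} (hs : 0 ≤ s) :
    |p s| ≤ C * Real.exp (-c * s) := (k.abs_le s).trans (k.bound₀ s hs)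

lemma diff_nonneg (k : KernelPair γ C c κ θ ρ p₀ p V) (s : ℝ) : 0 ≤ p₀ s - p s :=
  sub_nonneg.mpr ((le_abs_self _).trans (k.abs_le s))

lemma integrableOn₀ (k : KernelPair γ C c κ θ ρ p₀ p V) (hc : 0 < c) :
    IntegrableOn p₀ (Ioi 0) :=
  integrableOn_Ioi_of_exp_bound hc k.cont₀ fun s hs => by
    rw [Real.norm_eq_abs, abs_of_nonneg (k.nonneg₀ s)]; exact k.bound₀ s hs

lemma integrableOn (k : KernelPair γ C c κ θ ρ p₀ p V) (hc : 0 < c) :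
    IntegrableOn p (Ioi 0) :=
  integrableOn_Ioi_of_exp_bound hc k.cont fun _ hs => k.abs_le_exp hs

lemma tilt_bound (k : KernelPair γ C c κ θ ρ p₀ p V) {r s : ℝ} (hs : 0 ≤ s)
    (hr : r ≤ c / 2) : |Real.exp (s * r) * p s| ≤ C * Real.exp (-(c / 2) * s) := by
  rw [abs_mul, abs_of_pos (Real.exp_pos _)]
  calc _ ≤ Real.exp (s * r) * (C * Real.exp (-c * s)) := by
        gcongr; exact k.abs_le_exp hs
    _ = C * (Real.exp (s * r) * Real.exp (-c * s)) := by ring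
    _ ≤ _ := mul_le_mul_of_nonneg_left (exp_mul_exp_le hs hr) k.C_nonneg

lemma integrableOn_tilt (k : KernelPair γ C c κ θ ρ p₀ p V) (hc : 0 < c) {r : ℝ}
    (hr : r ≤ c / 2) : IntegrableOn (fun s => Real.exp (s * r) * p s) (Ioi 0) := by
  have := k.cont
  exact integrableOn_Ioi_of_exp_bound (by linarith : 0 < c / 2) (by fun_prop)
    fun s hs => k.tilt_bound hs hr

lemma mul_tilt_bound (k : KernelPair γ C c κ θ ρ p₀ p V) (hc : 0 < c) {r s : ℝ} (hs : 0 ≤ s)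
    (hr : r ≤ c / 2) : |s * Real.exp (s * r) * p s| ≤ C * (4 / c) * Real.exp (-(c / 4) * s) := by
  rw [abs_mul, abs_mul, abs_of_pos (Real.exp_pos _), abs_of_nonneg hs]
  calc _ ≤ s * Real.exp (s * r) * (C * Real.exp (-c * s)) := by
        gcongr; exact k.abs_le_exp hs
    _ = C * (s * (Real.exp (s * r) * Real.exp (-c * s))) := by ring
    _ ≤ C * (4 / c * Real.exp (-(c / 4) * s)) :=
        mul_le_mul_of_nonneg_left (mul_exp_mul_exp_le hc hs hr) k.C_nonneg
    _ = _ := by ring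

lemma integrableOn_mul_tilt (k : KernelPair γ C c κ θ ρ p₀ p V) (hc : 0 < c) {r : ℝ}
    (hr : r ≤ c / 2) : IntegrableOn (fun s => s * Real.exp (s * r) * p s) (Ioi 0) := by
  have := k.cont
  exact integrableOn_Ioi_of_exp_bound (by linarith : 0 < c / 4) (by fun_prop)
    fun s hs => k.mul_tilt_bound hc hs hr

lemma integrableOn_mul₀ (k : KernelPair γ C c κ θ ρ p₀ p V) (hc : 0 < c) :
    IntegrableOn (fun s => s * p₀ s) (Ioi 0) := by
  have := k.cont₀
  refine integrableOn_Ioi_of_exp_bound (C := C * (2 / c)) (by linarith : 0 < c / 2)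
    (by fun_prop) fun s hs => ?_
  rw [Real.norm_eq_abs, abs_mul, abs_of_nonneg hs, abs_of_nonneg (k.nonneg₀ s)]
  calc _ ≤ s * (C * Real.exp (-c * s)) := by gcongr; exact k.bound₀ s hs
    _ = C * (s * Real.exp (-c * s)) := by ring
    _ ≤ C * (2 / c * Real.exp (-(c / 2) * s)) :=
        mul_le_mul_of_nonneg_left (mul_exp_neg_le hc s) k.C_nonneg
    _ = _ := by ring

lemma integrableOn_envelope (hc : 0 < c) (K : ℝ) :
    IntegrableOn (fun s => K * Real.exp (-(c / 4) * s)) (Ioi 0) :=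
  (exp_neg_integrableOn_Ioi 0 (by linarith : 0 < c / 4)).const_mul K

lemma integral_envelope (hc : 0 < c) (K : ℝ) :
    ∫ s in Ioi (0 : ℝ), K * Real.exp (-(c / 4) * s) = K * (4 / c) := by
  rw [integral_const_mul, integral_Ioi_exp_neg_mul (by linarith)]
  simp

/-- The mass of the tilted kernel grows in $r$ at a rate close to the mean $1/\gamma$ of $p_0$.
Since $p$ may change sign, it is split as $p_0-(p_0-p)$, and the second part costs $O(V)$. -/
lemma integral_tilt_sub_ge (k : KernelPair γ C c κ θ ρ p₀ p V) (hc : 0 < c) (hV : 0 ≤ V)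
    {r r' : ℝ} (hr0 : 0 ≤ r) (hrr : r ≤ r') (hr' : r' ≤ c / 2) :
    (r' - r) * (1 / γ - C * V * (16 / c ^ 2)) ≤
      (∫ s in Ioi (0 : ℝ), Real.exp (s * r') * p s) -
        ∫ s in Ioi (0 : ℝ), Real.exp (s * r) * p s := by
  rw [← integral_sub (k.integrableOn_tilt hc hr') (k.integrableOn_tilt hc (hrr.trans hr'))]
  have h1 : (r' - r) * (1 / γ - C * V * (16 / c ^ 2)) = ∫ s in Ioi (0 : ℝ),
      ((r' - r) * (s * p₀ s) - (r' - r) * C * V * (4 / c) * Real.exp (-(c / 4) * s)) := by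
    rw [integral_sub ((k.integrableOn_mul₀ hc).const_mul _) (integrableOn_envelope hc _),
      integral_const_mul, k.mean₀, integral_envelope hc]
    field_simp; norm_num
  rw [h1]
  refine setIntegral_mono_on (((k.integrableOn_mul₀ hc).const_mul _).sub
    (integrableOn_envelope hc _)) ((k.integrableOn_tilt hc hr').sub
      (k.integrableOn_tilt hc (hrr.trans hr'))) measurableSet_Ioi fun s hs => ?_
  have hs0 : 0 ≤ s := le_of_lt hs
  have hsr : s * r ≤ s * r' := by gcongr
  have a1 := le_exp_sub_exp (by positivity : 0 ≤ s * r) hsr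
  have a2 := exp_sub_exp_le (a := s * r) (b := s * r')
  have a3 := mul_exp_mul_exp_le hc hs0 hr'
  have b1 := mul_le_mul_of_nonneg_right a1 (k.nonneg₀ s)
  have hd : 0 ≤ r' - r := by linarith
  have b2 : (Real.exp (s * r') - Real.exp (s * r)) * (p₀ s - p s) ≤
      (r' - r) * C * V * (4 / c) * Real.exp (-(c / 4) * s) := by
    -- The correction is estimated by the increment of the exponential, $O((r'-r)s\,e^{sr'})$, times
    -- the decaying difference $p_0-p=O(V)$.
    have hCV : 0 ≤ C * V := mul_nonneg k.C_nonneg hV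
    calc _ ≤ ((s * r' - s * r) * Real.exp (s * r')) * (C * V * Real.exp (-c * s)) := by
          refine mul_le_mul a2 (k.diff s hs0) (k.diff_nonneg s) ?_
          exact mul_nonneg (by linarith) (Real.exp_pos _).le
      _ = (r' - r) * (C * V) * (s * (Real.exp (s * r') * Real.exp (-c * s))) := by ring
      _ ≤ (r' - r) * (C * V) * (4 / c * Real.exp (-(c / 4) * s)) := by gcongr
      _ = _ := by ring
  nlinarith

/-- This Lipschitz bound serves twice: it gives the continuity needed for the intermediate value
theorem, and it shows that a missing mass of order $V$ requires a rate of order at least $V$. -/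
lemma integral_tilt_sub_le (k : KernelPair γ C c κ θ ρ p₀ p V) (hc : 0 < c)
    {r r' : ℝ} (hrr : r ≤ r') (hr' : r' ≤ c / 2) :
    (∫ s in Ioi (0 : ℝ), Real.exp (s * r') * p s) -
        ∫ s in Ioi (0 : ℝ), Real.exp (s * r) * p s ≤ (r' - r) * (C * (16 / c ^ 2)) := by
  rw [← integral_sub (k.integrableOn_tilt hc hr') (k.integrableOn_tilt hc (hrr.trans hr'))]
  have h1 : (r' - r) * (C * (16 / c ^ 2)) = ∫ s in Ioi (0 : ℝ),
      ((r' - r) * C * (4 / c) * Real.exp (-(c / 4) * s)) := by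
    rw [integral_envelope hc]
    field_simp; norm_num
  rw [h1]
  refine setIntegral_mono_on ((k.integrableOn_tilt hc hr').sub
      (k.integrableOn_tilt hc (hrr.trans hr'))) (integrableOn_envelope hc _)
      measurableSet_Ioi fun s hs => ?_
  have hs0 : 0 ≤ s := le_of_lt hs
  have hsr : s * r ≤ s * r' := by gcongr
  have a2 := exp_sub_exp_le (a := s * r) (b := s * r')
  have a3 := mul_exp_mul_exp_le hc hs0 hr'
  have a4 : 0 ≤ Real.exp (s * r') - Real.exp (s * r) :=
    sub_nonneg.mpr (Real.exp_le_exp.mpr hsr)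
  have hd : 0 ≤ r' - r := by linarith
  have hC := k.C_nonneg
  calc Real.exp (s * r') * p s - Real.exp (s * r) * p s
      = (Real.exp (s * r') - Real.exp (s * r)) * p s := by ring
    _ ≤ (Real.exp (s * r') - Real.exp (s * r)) * (C * Real.exp (-c * s)) := by
        gcongr; exact (le_abs_self _).trans (k.abs_le_exp hs0)
    _ ≤ ((s * r' - s * r) * Real.exp (s * r')) * (C * Real.exp (-c * s)) := by gcongr
    _ = (r' - r) * C * (s * (Real.exp (s * r') * Real.exp (-c * s))) := by ring
    _ ≤ (r' - r) * C * (4 / c * Real.exp (-(c / 4) * s)) := by gcongr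
    _ = _ := by ring

lemma one_sub_mass (k : KernelPair γ C c κ θ ρ p₀ p V) (hc : 0 < c) :
    1 - ∫ s in Ioi (0 : ℝ), p s = ∫ s in Ioi (0 : ℝ), (p₀ s - p s) := by
  rw [integral_sub (k.integrableOn₀ hc) (k.integrableOn hc), k.mass₀]

lemma one_sub_mass_le (k : KernelPair γ C c κ θ ρ p₀ p V) (hc : 0 < c) :
    1 - ∫ s in Ioi (0 : ℝ), p s ≤ C * V / c := by
  rw [k.one_sub_mass hc]
  have h := norm_integral_Ioi_le_of_exp_bound (f := fun s => p₀ s - p s) (a := 0) (C := C * V)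
    hc le_rfl fun s hs => by
      rw [Real.norm_eq_abs, abs_of_nonneg (k.diff_nonneg s)]; exact k.diff s hs
  simp only [mul_zero, Real.exp_zero, mul_one] at h
  exact (le_abs_self _).trans h

lemma le_one_sub_mass (k : KernelPair γ C c κ θ ρ p₀ p V) (hc : 0 < c) :
    κ * V ≤ 1 - ∫ s in Ioi (0 : ℝ), p s := by
  have h1 := k.gap
  have h2 : ∫ s in Ioi (0 : ℝ), p s ≤ ∫ s in Ioi (0 : ℝ), |p s| :=
    setIntegral_mono_on (k.integrableOn hc) (k.integrableOn hc).abs measurableSet_Ioi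
      fun s _ => le_abs_self _
  linarith

lemma mean_tilt_ge (k : KernelPair γ C c κ θ ρ p₀ p V) (hc : 0 < c) (hV : 0 ≤ V) {r : ℝ}
    (hr0 : 0 ≤ r) (hr : r ≤ c / 2) :
    1 / γ - C * V * (16 / c ^ 2) ≤ ∫ s in Ioi (0 : ℝ), s * Real.exp (s * r) * p s := by
  have h1 : 1 / γ - C * V * (16 / c ^ 2) = ∫ s in Ioi (0 : ℝ),
      (s * p₀ s - C * V * (4 / c) * Real.exp (-(c / 4) * s)) := by
    rw [integral_sub (k.integrableOn_mul₀ hc) (integrableOn_envelope hc _),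
      k.mean₀, integral_envelope hc]
    field_simp; norm_num
  rw [h1]
  refine setIntegral_mono_on ((k.integrableOn_mul₀ hc).sub (integrableOn_envelope hc _))
    (k.integrableOn_mul_tilt hc hr) measurableSet_Ioi fun s hs => ?_
  have hs0 : 0 ≤ s := le_of_lt hs
  have a3 := mul_exp_mul_exp_le hc hs0 hr
  have hCV : 0 ≤ C * V := mul_nonneg k.C_nonneg hV
  have b1 : s * p₀ s ≤ s * (Real.exp (s * r) * p₀ s) := by
    have := Real.one_le_exp (by positivity : 0 ≤ s * r)
    have := k.nonneg₀ s
    gcongr; nlinarith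
  have b2 : s * (Real.exp (s * r) * (p₀ s - p s)) ≤
      C * V * (4 / c) * Real.exp (-(c / 4) * s) := by
    calc _ ≤ s * (Real.exp (s * r) * (C * V * Real.exp (-c * s))) := by
          gcongr; exact k.diff s hs0
      _ = C * V * (s * (Real.exp (s * r) * Real.exp (-c * s))) := by ring
      _ ≤ C * V * (4 / c * Real.exp (-(c / 4) * s)) := by gcongr
      _ = _ := by ring
  linarith

/-- When $r=O(V)$, both the tilt and the difference $p_0-p$ are $O(V)$, so the tilted kernel is a
small perturbation of $p_0$ in an exponentially weighted sense. -/
lemma tilt_sub_bound (k : KernelPair γ C c κ θ ρ p₀ p V) (hc : 0 < c) (hV : 0 ≤ V) {r s K : ℝ}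
    (hr0 : 0 ≤ r) (hr : r ≤ c / 2) (hrV : r ≤ K * V) (hs : 0 ≤ s) :
    |Real.exp (s * r) * p s - p₀ s| ≤ (K * C * (4 / c) + C) * V * Real.exp (-(c / 4) * s) := by
  have hC := k.C_nonneg
  have a3 := mul_exp_mul_exp_le hc hs hr
  have e := exp_sub_exp_le (a := 0) (b := s * r)
  simp only [Real.exp_zero, sub_zero] at e
  have e0 : 0 ≤ Real.exp (s * r) - 1 := sub_nonneg.mpr (Real.one_le_exp (by positivity))
  have b1 : |(Real.exp (s * r) - 1) * p s| ≤ K * C * (4 / c) * V * Real.exp (-(c / 4) * s) := by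
    rw [abs_mul, abs_of_nonneg e0]
    calc _ ≤ (s * r * Real.exp (s * r)) * (C * Real.exp (-c * s)) :=
          mul_le_mul e (k.abs_le_exp hs) (abs_nonneg _) (by positivity)
      _ = r * C * (s * (Real.exp (s * r) * Real.exp (-c * s))) := by ring
      _ ≤ K * V * C * (4 / c * Real.exp (-(c / 4) * s)) := by
          refine mul_le_mul (by gcongr) a3 (by positivity) ?_
          exact mul_nonneg (hr0.trans hrV) hC
      _ = _ := by ring
  have b2 : |p₀ s - p s| ≤ C * V * Real.exp (-(c / 4) * s) := by
    rw [abs_of_nonneg (k.diff_nonneg s)]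
    refine (k.diff s hs).trans ?_
    have : 0 ≤ C * V := mul_nonneg hC hV
    gcongr; linarith
  calc _ = |(Real.exp (s * r) - 1) * p s - (p₀ s - p s)| := by ring_nf
    _ ≤ _ := (abs_sub _ _).trans (add_le_add b1 b2)
    _ = _ := by ring

lemma abs_rate_sub_aux (k : KernelPair γ C c κ θ ρ p₀ p V) (hc : 0 < c)
    {r K s : ℝ} (hr0 : 0 ≤ r) (hr : r ≤ c / 2) (hrV : r ≤ K * V) (hK : 0 ≤ K)
    (hV : 0 ≤ V) (hs : 0 ≤ s) : |Real.exp (s * r) * p s - p s - r * (s * p₀ s)| ≤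
      (K ^ 2 * C * (64 / c ^ 2) + K * C * (4 / c)) * V ^ 2 * Real.exp (-(c / 4) * s) := by
  have hC := k.C_nonneg
  have e := exp_sub_one_sub_le (by positivity : 0 ≤ s * r)
  have e0 : 0 ≤ Real.exp (s * r) - 1 - s * r := by
    linarith [Real.add_one_le_exp (s * r)]
  have a2 := sq_mul_exp_mul_exp_le hc hs hr
  have a1 : s * Real.exp (-c * s) ≤ 4 / c * Real.exp (-(c / 4) * s) := by
    simpa using mul_exp_mul_exp_le hc hs (by linarith : 0 ≤ c / 2)
  have hr2 : r ^ 2 ≤ (K * V) ^ 2 := by gcongr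
  have b1 : |(Real.exp (s * r) - 1 - s * r) * p s| ≤
      K ^ 2 * C * (64 / c ^ 2) * V ^ 2 * Real.exp (-(c / 4) * s) := by
    rw [abs_mul, abs_of_nonneg e0]
    calc _ ≤ ((s * r) ^ 2 * Real.exp (s * r)) * (C * Real.exp (-c * s)) :=
          mul_le_mul e (k.abs_le_exp hs) (abs_nonneg _) (by positivity)
      _ = r ^ 2 * C * (s ^ 2 * (Real.exp (s * r) * Real.exp (-c * s))) := by ring
      _ ≤ (K * V) ^ 2 * C * (64 / c ^ 2 * Real.exp (-(c / 4) * s)) := by gcongr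
      _ = _ := by ring
  have b2 : |s * r * (p₀ s - p s)| ≤ K * C * (4 / c) * V ^ 2 * Real.exp (-(c / 4) * s) := by
    rw [abs_mul, abs_of_nonneg (by positivity : 0 ≤ s * r), abs_of_nonneg (k.diff_nonneg s)]
    calc _ ≤ s * r * (C * V * Real.exp (-c * s)) := by gcongr; exact k.diff s hs
      _ = r * (C * V) * (s * Real.exp (-c * s)) := by ring
      _ ≤ K * V * (C * V) * (4 / c * Real.exp (-(c / 4) * s)) := by gcongr
      _ = _ := by ring
  calc _ = |(Real.exp (s * r) - 1 - s * r) * p s - s * r * (p₀ s - p s)| := by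
        ring_nf
    _ ≤ _ := (abs_sub _ _).trans (add_le_add b1 b2)
    _ = _ := by ring

/-- The normalization reads $1-\int p=\int(e^{sr}-1)p$. To first order the right side is $r\int
s\,p_0=r/\gamma$; the quadratic term of the exponential and the replacement of $p$ by $p_0$ are both
$O(V^2)$. -/
lemma abs_rate_sub_le (k : KernelPair γ C c κ θ ρ p₀ p V) (hγ : 0 < γ) (hc : 0 < c)
    (hV : 0 ≤ V) {r K : ℝ} (hr0 : 0 ≤ r) (hr : r ≤ c / 2) (hrV : r ≤ K * V) (hK : 0 ≤ K)
    (h1 : 1 = ∫ s in Ioi (0 : ℝ), Real.exp (s * r) * p s) :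
    |γ * (1 - ∫ s in Ioi (0 : ℝ), p s) - r| ≤
      γ * ((K ^ 2 * C * (64 / c ^ 2) + K * C * (4 / c)) * (4 / c)) * V ^ 2 := by
  have hC := k.C_nonneg
  have hi0 : IntegrableOn (fun s => r * (s * p₀ s)) (Ioi 0) := (k.integrableOn_mul₀ hc).const_mul r
  have i12 : IntegrableOn (fun s => Real.exp (s * r) * p s - p s) (Ioi 0) :=
    (k.integrableOn_tilt hc hr).sub (k.integrableOn hc)
  have e1 : γ * (1 - ∫ s in Ioi (0 : ℝ), p s) - r =
      γ * ∫ s in Ioi (0 : ℝ), (Real.exp (s * r) * p s - p s - r * (s * p₀ s)) := by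
    rw [integral_sub i12 hi0, integral_sub (k.integrableOn_tilt hc hr) (k.integrableOn hc), ← h1,
      integral_const_mul, k.mean₀]
    field_simp
  have key : |∫ s in Ioi (0 : ℝ), (Real.exp (s * r) * p s - p s - r * (s * p₀ s))| ≤
      (K ^ 2 * C * (64 / c ^ 2) + K * C * (4 / c)) * V ^ 2 / (c / 4) *
        Real.exp (-(c / 4) * 0) := by
    have hc4 : 0 < c / 4 := by linarith
    have := norm_integral_Ioi_le_of_exp_bound (E := ℝ) hc4 le_rfl
      fun s hs => k.abs_rate_sub_aux hc hr0 hr hrV hK hV hs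
    exact this
  rw [e1, abs_mul, abs_of_pos hγ]
  calc _ ≤ γ * _ := mul_le_mul_of_nonneg_left key hγ.le
    _ = _ := by
      simp only [mul_zero, Real.exp_zero, mul_one]
      field_simp

/-- Contraction is inherited from $p_0$. The three terms of the bound are the contraction constant
of $p_0$, the price of the weight $e^{\beta s}$, and the price of passing from $p_0$ to the tilted
kernel. -/
lemma weighted_contraction (k : KernelPair γ C c κ θ ρ p₀ p V) (hc : 0 < c) (hV : 0 ≤ V)
    (hθ : 0 < θ) {r β K : ℝ} (hr0 : 0 ≤ r) (hr : r ≤ c / 2) (hrV : r ≤ K * V) (hK : 0 ≤ K)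
    (hβ : 0 < β) (hβc : β ≤ c / 8) :
    ∫ s in Ioi (0 : ℝ), Real.exp (β * s) * |Real.exp (s * r) * p s -
      θ * tail (fun s => Real.exp (s * r) * p s) s| ≤
      ρ + β * (C * (1 + θ / c) * (16 / c ^ 2)) +
        V * ((K * C * (4 / c) + C) * (1 + 4 * θ / c) * (8 / c)) := by
  have hC := k.C_nonneg
  have hp := k.cont
  have hp0 := k.cont₀
  have ht0 := continuous_tail hp0
  set q : ℝ → ℝ := fun s => Real.exp (s * r) * p s with hq
  have hqc : Continuous q := by fun_prop
  have htq := continuous_tail hqc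
  have hqi : IntegrableOn q (Ioi 0) := k.integrableOn_tilt hc hr
  set K₁ := K * C * (4 / c) + C with hK₁
  have hK₁0 : 0 ≤ K₁ := by positivity
  have hsub : ∀ s, 0 ≤ s → |q s - p₀ s| ≤ K₁ * V * Real.exp (-(c / 4) * s) := fun s hs =>
    k.tilt_sub_bound hc hV hr0 hr hrV hs
  have htsub : ∀ s, 0 ≤ s → |tail q s - tail p₀ s| ≤
      K₁ * V / (c / 4) * Real.exp (-(c / 4) * s) := by
    intro s hs
    have e : tail q s - tail p₀ s = tail (fun s => q s - p₀ s) s := by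
      simp only [tail]
      rw [integral_sub hqi (k.integrableOn₀ hc), intervalIntegral.integral_sub
        (hqc.intervalIntegrable _ _) (hp0.intervalIntegrable _ _)]
      ring
    rw [e]
    exact tail_norm_le (by linarith) (hqc.sub hp0) hsub hs
  have ht0b : ∀ s, 0 ≤ s → |tail p₀ s| ≤ C / c * Real.exp (-c * s) := fun s hs =>
    tail_norm_le hc hp0 (fun s hs => by
      rw [Real.norm_eq_abs, abs_of_nonneg (k.nonneg₀ s)]; exact k.bound₀ s hs) hs
  have hw0b : ∀ s, 0 ≤ s → |p₀ s - θ * tail p₀ s| ≤ C * (1 + θ / c) * Real.exp (-c * s) := by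
    intro s hs
    have h1 := ht0b s hs
    have h2 := k.bound₀ s hs
    calc _ ≤ |p₀ s| + |θ * tail p₀ s| := abs_sub _ _
      _ ≤ C * Real.exp (-c * s) + θ * (C / c * Real.exp (-c * s)) := by
          rw [abs_of_nonneg (k.nonneg₀ s), abs_mul, abs_of_pos hθ]
          gcongr
      _ = _ := by ring
  have hi0 : IntegrableOn (fun s => |p₀ s - θ * tail p₀ s|) (Ioi 0) :=
    integrableOn_Ioi_of_exp_bound hc (C := C * (1 + θ / c)) (by fun_prop) fun s hs => by
      rw [Real.norm_eq_abs, abs_abs]; exact hw0b s hs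
  have hi1 := integrableOn_envelope hc (β * (C * (1 + θ / c) * (4 / c)))
  have hi2 : IntegrableOn (fun s => V * (K₁ * (1 + 4 * θ / c)) * Real.exp (-(c / 8) * s))
      (Ioi 0) := (exp_neg_integrableOn_Ioi 0 (by linarith : 0 < c / 8)).const_mul _
  have hle : ∀ s, 0 < s → Real.exp (β * s) * |q s - θ * tail q s| ≤
      |p₀ s - θ * tail p₀ s| + β * (C * (1 + θ / c) * (4 / c)) * Real.exp (-(c / 4) * s) +
        V * (K₁ * (1 + 4 * θ / c)) * Real.exp (-(c / 8) * s) := by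
    intro s hs
    have hs0 := hs.le
    have a1 : |q s - θ * tail q s| ≤ |p₀ s - θ * tail p₀ s| +
        V * (K₁ * (1 + 4 * θ / c)) * Real.exp (-(c / 4) * s) := by
      have e : q s - θ * tail q s = (p₀ s - θ * tail p₀ s) +
          ((q s - p₀ s) - θ * (tail q s - tail p₀ s)) := by ring
      rw [e]
      refine (abs_add_le _ _).trans (add_le_add le_rfl ((abs_sub _ _).trans ?_))
      rw [abs_mul, abs_of_pos hθ]
      calc _ ≤ K₁ * V * Real.exp (-(c / 4) * s) +
            θ * (K₁ * V / (c / 4) * Real.exp (-(c / 4) * s)) := by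
            have := hsub s hs0
            have := htsub s hs0
            gcongr
        _ = _ := by field_simp
    have a2 : (Real.exp (β * s) - 1) * |p₀ s - θ * tail p₀ s| ≤
        β * (C * (1 + θ / c) * (4 / c)) * Real.exp (-(c / 4) * s) := by
      have e := exp_sub_exp_le (a := 0) (b := s * β)
      simp only [Real.exp_zero, sub_zero] at e
      have e3 := mul_exp_mul_exp_le hc hs0 (by linarith : β ≤ c / 2)
      rw [mul_comm β s]
      calc _ ≤ (s * β * Real.exp (s * β)) * (C * (1 + θ / c) * Real.exp (-c * s)) :=
            mul_le_mul e (hw0b s hs0) (abs_nonneg _) (by positivity)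
        _ = β * (C * (1 + θ / c)) * (s * (Real.exp (s * β) * Real.exp (-c * s))) := by ring
        _ ≤ β * (C * (1 + θ / c)) * (4 / c * Real.exp (-(c / 4) * s)) := by gcongr
        _ = _ := by ring
    have a3 : Real.exp (β * s) * Real.exp (-(c / 4) * s) ≤ Real.exp (-(c / 8) * s) := by
      rw [← Real.exp_add]; exact Real.exp_le_exp.mpr (by nlinarith)
    have a4 : Real.exp (β * s) * (V * (K₁ * (1 + 4 * θ / c)) * Real.exp (-(c / 4) * s)) ≤
        V * (K₁ * (1 + 4 * θ / c)) * Real.exp (-(c / 8) * s) := by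
      calc _ = V * (K₁ * (1 + 4 * θ / c)) *
            (Real.exp (β * s) * Real.exp (-(c / 4) * s)) := by ring
        _ ≤ _ := by gcongr
    have a5 := mul_le_mul_of_nonneg_left a1 (Real.exp_pos (β * s)).le
    linarith
  have hi01 : IntegrableOn (fun s => |p₀ s - θ * tail p₀ s| +
      β * (C * (1 + θ / c) * (4 / c)) * Real.exp (-(c / 4) * s)) (Ioi 0) := hi0.add hi1
  calc _ ≤ ∫ s in Ioi (0 : ℝ), (|p₀ s - θ * tail p₀ s| +
        β * (C * (1 + θ / c) * (4 / c)) * Real.exp (-(c / 4) * s) +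
        V * (K₁ * (1 + 4 * θ / c)) * Real.exp (-(c / 8) * s)) := by
        refine integral_mono_of_nonneg (ae_of_all _ fun s => by
          simp only [Pi.zero_apply]; positivity) (hi01.add hi2) ?_
        filter_upwards [ae_restrict_mem measurableSet_Ioi] with s hs using hle s hs
    _ = (∫ s in Ioi (0 : ℝ), |p₀ s - θ * tail p₀ s|) +
        β * (C * (1 + θ / c) * (4 / c)) * (4 / c) + V * (K₁ * (1 + 4 * θ / c)) * (8 / c) := by
        rw [integral_add hi01 hi2, integral_add hi0 hi1, integral_envelope hc,
          integral_const_mul, integral_Ioi_exp_neg_mul (by linarith : 0 < c / 8)]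
        simp
    _ ≤ _ := by
        have h1 := k.contraction
        have h2 : β * (C * (1 + θ / c) * (4 / c)) * (4 / c) =
            β * (C * (1 + θ / c) * (16 / c ^ 2)) := by field_simp; norm_num
        rw [h2]
        linarith

end KernelPair
end

/-- Existence of the decay rate `R` and the amplitude `a` of a mode with kernel `p`, with
quantitative bounds and the asymptotics of the corresponding renewal equation. -/
structure SlowMode (γ c β K : ℝ) (p : ℝ → ℝ) (V R a : ℝ) : Prop where
  rate_mem : R ∈ Icc 0 β
  rate_eq : 1 = ∫ s in Ioi (0 : ℝ), Real.exp (s * R) * p s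
  rate_unique : ∀ r ∈ Icc 0 β, 1 = ∫ s in Ioi (0 : ℝ), Real.exp (s * r) * p s → r = R
  amp_pos : 0 < a
  amp_eq : 1 / a = ∫ s in Ioi (0 : ℝ), s * Real.exp (s * R) * p s
  amp_le : a ≤ K
  rate_le : R ≤ K * V
  le_rate : V ≤ K * R
  rate_diff : |γ * (1 - ∫ s in Ioi (0 : ℝ), p s) - R| ≤ K * V ^ 2
  asymptotics : ∀ (Y f : ℝ → ℂ) (G : ℝ), Continuous Y → Continuous f →
    (∀ t, 0 ≤ t → ‖f t‖ ≤ G * Real.exp (-c * t)) →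
    (∀ t, 0 ≤ t → Y t = f t + ∫ s in (0 : ℝ)..t, p s • Y (t - s)) → ∀ t, 0 ≤ t →
    ‖Y t - (a * Real.exp (-R * t)) • ∫ s in Ioi (0 : ℝ), Real.exp (s * R) • f s‖ ≤
      K * G * Real.exp (-β * t)

/-! ### Slow and fast modes -/

section
variable {γ C c κ θ ρ : ℝ} {p₀ p : ℝ → ℝ} {V : ℝ}

/-- Multiplying the solution by $e^{tR}$ gives a renewal equation whose kernel has mass one and
whose mean is the first moment $m$ of the tilted kernel. Undoing the tilt only improves the
remainder, since $R\ge0$. -/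
lemma KernelPair.asymptotics (k : KernelPair γ C c κ θ ρ p₀ p V) (hc : 0 < c)
    (hθ : 0 < θ) {β K R m ρ' m₀ : ℝ} (hR0 : 0 ≤ R) (hRβ : R ≤ β) (hβ : 0 < β) (hβc : β ≤ c / 8)
    (hrate : 1 = ∫ s in Ioi (0 : ℝ), Real.exp (s * R) * p s)
    (hm : m = ∫ s in Ioi (0 : ℝ), s * Real.exp (s * R) * p s) (hm₀ : 0 < m₀) (hmm : m₀ ≤ m)
    (hcontr : ∫ s in Ioi (0 : ℝ), Real.exp (β * s) * |Real.exp (s * R) * p s -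
      θ * tail (fun s => Real.exp (s * R) * p s) s| ≤ ρ') (hρ' : ρ' < 1)
    (hK : (1 + θ / (2 * β)) * (1 + C / ((2 * β) ^ 2 * m₀)) / (1 - ρ') ≤ K)
    {Y f : ℝ → ℂ} {G : ℝ} (hY : Continuous Y) (hf : Continuous f)
    (hfb : ∀ t, 0 ≤ t → ‖f t‖ ≤ G * Real.exp (-c * t))
    (heq : ∀ t, 0 ≤ t → Y t = f t + ∫ s in (0 : ℝ)..t, p s • Y (t - s)) {t : ℝ} (ht : 0 ≤ t) :
    ‖Y t - (m⁻¹ * Real.exp (-R * t)) • ∫ s in Ioi (0 : ℝ), Real.exp (s * R) • f s‖ ≤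
      K * G * Real.exp (-β * t) := by
  have hp := k.cont
  have hG : 0 ≤ G := by simpa using (norm_nonneg _).trans (hfb 0 le_rfl)
  have hR : R ≤ c / 2 := by linarith
  have hdec : ∀ s, 0 ≤ s → Real.exp (-(c / 2) * s) ≤ Real.exp (-(2 * β) * s) := fun s hs =>
    Real.exp_le_exp.mpr (by nlinarith)
  have hqb : ∀ s, 0 ≤ s → |Real.exp (s * R) * p s| ≤ C * Real.exp (-(2 * β) * s) :=
    fun s hs => (k.tilt_bound hs hR).trans (mul_le_mul_of_nonneg_left (hdec s hs) k.C_nonneg)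
  have hqc : Continuous fun s => Real.exp (s * R) * p s := by fun_prop
  have key := renewal_asymptotics (q := fun s => Real.exp (s * R) * p s)
    (Y := fun t => Real.exp (t * R) • Y t) (f := fun t => Real.exp (t * R) • f t)
    (A := C) (G := G) (m := m) hβ hqc hqb hrate.symm hθ hcontr hρ' (by
      rw [integral_tail (by linarith : 0 < 2 * β) hqc hqb, hm]
      simp only [mul_assoc]) (hm₀.trans_le hmm) (by fun_prop) (fun s hs => by
      rw [norm_smul, Real.norm_eq_abs, abs_of_pos (Real.exp_pos _)]
      calc _ ≤ Real.exp (s * R) * (G * Real.exp (-c * s)) := by gcongr; exact hfb s hs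
        _ = G * (Real.exp (s * R) * Real.exp (-c * s)) := by ring
        _ ≤ _ := mul_le_mul_of_nonneg_left ((exp_mul_exp_le hs hR).trans (hdec s hs)) hG)
    (by fun_prop) (fun t ht => by
      rw [heq t ht, smul_add, ← intervalIntegral.integral_smul]
      congr 1
      refine intervalIntegral.integral_congr fun s _ => ?_
      simp only [smul_smul]
      congr 1
      rw [mul_right_comm, ← Real.exp_add]; ring_nf) ht
  have e : Y t - (m⁻¹ * Real.exp (-R * t)) • ∫ s in Ioi (0 : ℝ), Real.exp (s * R) • f s =
      Real.exp (-R * t) • (Real.exp (t * R) • Y t -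
        m⁻¹ • ∫ s in Ioi (0 : ℝ), Real.exp (s * R) • f s) := by
    rw [smul_sub, smul_smul, smul_smul, ← Real.exp_add, mul_comm m⁻¹]
    have : -R * t + t * R = 0 := by ring
    rw [this, Real.exp_zero, one_smul]
  rw [e, norm_smul, Real.norm_eq_abs, abs_of_pos (Real.exp_pos _)]
  have h1 : Real.exp (-R * t) ≤ 1 := by rw [Real.exp_le_one_iff]; nlinarith
  have hC := k.C_nonneg
  have h2 : (G * (1 + θ / (2 * β)) * (1 + C / ((2 * β) ^ 2 * m))) / (1 - ρ') ≤ K * G := by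
    have h3 : 1 + C / ((2 * β) ^ 2 * m) ≤ 1 + C / ((2 * β) ^ 2 * m₀) := by gcongr
    have h4 : 0 < 1 - ρ' := by linarith
    calc _ ≤ (G * (1 + θ / (2 * β)) * (1 + C / ((2 * β) ^ 2 * m₀))) / (1 - ρ') := by gcongr
      _ = ((1 + θ / (2 * β)) * (1 + C / ((2 * β) ^ 2 * m₀)) / (1 - ρ')) * G := by ring
      _ ≤ _ := by gcongr
  calc _ ≤ 1 * ((G * (1 + θ / (2 * β)) * (1 + C / ((2 * β) ^ 2 * m))) / (1 - ρ') *
        Real.exp (-β * t)) := mul_le_mul h1 key (norm_nonneg _) zero_le_one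
    _ ≤ _ := by rw [one_mul]; gcongr

set_option maxHeartbeats 400000 in
/-- Modes with small `V` decay slowly, at a rate comparable to `V`. -/
theorem exists_slowMode (hγ : 0 < γ) (hC : 0 < C) (hc : 0 < c) (hκ : 0 < κ) (hθ : 0 < θ)
    (hρ : ρ < 1) : ∃ β > 0, ∃ ε > 0, ∃ K > 0, ∀ (p₀ p : ℝ → ℝ) (V : ℝ), 0 ≤ V → V ≤ ε →
      KernelPair γ C c κ θ ρ p₀ p V → ∃ R a, SlowMode γ c β K p V R a := by
  obtain ⟨KR, hKR⟩ : ∃ x, x = 2 * γ * C / c := ⟨_, rfl⟩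
  obtain ⟨L₁, hL₁⟩ : ∃ x, x = C * (1 + θ / c) * (16 / c ^ 2) := ⟨_, rfl⟩
  obtain ⟨L₂, hL₂⟩ : ∃ x, x = (KR * C * (4 / c) + C) * (1 + 4 * θ / c) * (8 / c) := ⟨_, rfl⟩
  have hKR0 : 0 < KR := by rw [hKR]; positivity
  have hL₁0 : 0 < L₁ := by rw [hL₁]; positivity
  have hL₂0 : 0 < L₂ := by rw [hL₂]; positivity
  have hρ0 : 0 < 1 - ρ := by linarith
  -- The weight may use up at most a quarter of the gap $1-\rho$; the tilt will use up at most
  -- another quarter.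
  set β := min (c / 8) ((1 - ρ) / (4 * L₁)) with hβd
  have hβ : 0 < β := lt_min (by positivity) (by positivity)
  have hβc : β ≤ c / 8 := min_le_left _ _
  have hβ1 : β * L₁ ≤ (1 - ρ) / 4 := by
    calc _ ≤ (1 - ρ) / (4 * L₁) * L₁ := by gcongr; exact min_le_right _ _
      _ = _ := by field_simp
  -- The three bounds on $V$ ensure, in order: the perturbed kernel still contracts; the tilted mass
  -- has slope at least $1/(2\gamma)$; the missing mass can be recovered by a tilt of at most
  -- $\beta$.
  set ε := min (min ((1 - ρ) / (4 * L₂)) (1 / (2 * γ) / (C * (16 / c ^ 2))))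
    (β / (2 * γ) / (C / c)) with hεd
  have hε : 0 < ε := lt_min (lt_min (by positivity) (by positivity)) (by positivity)
  have hε1 : ε * L₂ ≤ (1 - ρ) / 4 := by
    calc _ ≤ (1 - ρ) / (4 * L₂) * L₂ := by
          gcongr; exact (min_le_left _ _).trans (min_le_left _ _)
      _ = _ := by field_simp
  have hε2 : ε * (C * (16 / c ^ 2)) ≤ 1 / (2 * γ) := by
    calc _ ≤ 1 / (2 * γ) / (C * (16 / c ^ 2)) * (C * (16 / c ^ 2)) := by
          gcongr; exact (min_le_left _ _).trans (min_le_right _ _)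
      _ = _ := by field_simp
  have hε3 : ε * (C / c) ≤ β / (2 * γ) := by
    calc _ ≤ β / (2 * γ) / (C / c) * (C / c) := by gcongr; exact min_le_right _ _
      _ = _ := by field_simp
  clear_value β ε
  set ρ' := (1 + ρ) / 2 with hρ'd
  have hρ' : ρ' < 1 := by rw [hρ'd]; linarith
  obtain ⟨k₁, hk₁⟩ : ∃ x, x = C * (16 / c ^ 2) / κ := ⟨_, rfl⟩
  obtain ⟨k₂, hk₂⟩ : ∃ x, x =
    γ * ((KR ^ 2 * C * (64 / c ^ 2) + KR * C * (4 / c)) * (4 / c)) := ⟨_, rfl⟩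
  obtain ⟨k₃, hk₃⟩ : ∃ x, x =
    (1 + θ / (2 * β)) * (1 + C / ((2 * β) ^ 2 * (1 / (2 * γ)))) / (1 - ρ') := ⟨_, rfl⟩
  have hk₁0 : 0 < k₁ := by rw [hk₁]; positivity
  have hk₂0 : 0 < k₂ := by rw [hk₂]; positivity
  have hk₃0 : 0 < k₃ := by
    have : 0 < 1 - ρ' := by linarith
    rw [hk₃]; positivity
  refine ⟨β, hβ, ε, hε, 2 * γ + KR + k₁ + k₂ + k₃, by positivity, fun p₀ p V hV hVε k => ?_⟩
  set P : ℝ → ℝ := fun r => ∫ s in Ioi (0 : ℝ), Real.exp (s * r) * p s with hP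
  have hP0 : P 0 = ∫ s in Ioi (0 : ℝ), p s := by simp [hP]
  have hVε2 : C * V * (16 / c ^ 2) ≤ 1 / (2 * γ) := by
    calc _ = V * (C * (16 / c ^ 2)) := by ring
      _ ≤ ε * (C * (16 / c ^ 2)) := by gcongr
      _ ≤ _ := hε2
  have hhalf : 1 / (2 * γ) ≤ 1 / γ - C * V * (16 / c ^ 2) := by
    have : 1 / γ = 1 / (2 * γ) + 1 / (2 * γ) := by field_simp; norm_num
    linarith
  have hlow : ∀ r r', 0 ≤ r → r ≤ r' → r' ≤ β → (r' - r) * (1 / (2 * γ)) ≤ P r' - P r := by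
    intro r r' h0 h1 h2
    refine le_trans ?_ (k.integral_tilt_sub_ge hc hV h0 h1 (by linarith : r' ≤ c / 2))
    have : 0 ≤ r' - r := by linarith
    gcongr
  have hup : ∀ r r', r ≤ r' → r' ≤ β → P r' - P r ≤ (r' - r) * (C * (16 / c ^ 2)) :=
    fun r r' h1 h2 => k.integral_tilt_sub_le hc h1 (by linarith : r' ≤ c / 2)
  have hPcont : ContinuousOn P (Icc 0 β) := by
    refine LipschitzOnWith.continuousOn (K := (C * (16 / c ^ 2)).toNNReal)
      (LipschitzOnWith.of_dist_le_mul fun r hr r' hr' => ?_)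
    rw [Real.coe_toNNReal _ (by positivity), Real.dist_eq, Real.dist_eq]
    rcases le_total r r' with h | h
    · rw [abs_sub_comm, abs_sub_comm r, abs_of_nonneg (sub_nonneg.mpr h), abs_of_nonneg]
      · rw [mul_comm]; exact hup r r' h hr'.2
      · exact le_trans (mul_nonneg (by linarith) (by positivity)) (hlow r r' hr.1 h hr'.2)
    · rw [abs_of_nonneg (sub_nonneg.mpr h), abs_of_nonneg]
      · rw [mul_comm]; exact hup r' r h hr.2
      · exact le_trans (mul_nonneg (by linarith) (by positivity)) (hlow r' r hr'.1 h hr.2)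
  have hm1 := k.one_sub_mass_le hc
  have hm2 := k.le_one_sub_mass hc
  rw [← hP0] at hm1 hm2
  have hPβ : 1 ≤ P β := by
    have h1 := hlow 0 β le_rfl hβ.le le_rfl
    have h2 : C * V / c ≤ β / (2 * γ) := by
      calc _ = V * (C / c) := by ring
        _ ≤ ε * (C / c) := by gcongr
        _ ≤ _ := hε3
    have h3 : (β - 0) * (1 / (2 * γ)) = β / (2 * γ) := by ring
    linarith
  -- The mass is at most one without tilt, by the gap, and at least one at tilt $\beta$. The
  -- positive slope makes the crossing unique.
  obtain ⟨R, hR, hPR⟩ := intermediate_value_Icc hβ.le hPcont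
    (⟨by linarith [mul_nonneg hκ.le hV], hPβ⟩ : (1 : ℝ) ∈ Icc (P 0) (P β))
  have hRc : R ≤ c / 2 := by linarith [hR.2]
  have hRV : R ≤ KR * V := by
    have h1 := hlow 0 R le_rfl hR.1 hR.2
    have h2 : R * (1 / (2 * γ)) ≤ C * V / c := by
      rw [sub_zero] at h1; linarith
    calc R = 2 * γ * (R * (1 / (2 * γ))) := by field_simp
      _ ≤ 2 * γ * (C * V / c) := by gcongr
      _ = _ := by rw [hKR]; ring
  have hmean := hhalf.trans (k.mean_tilt_ge hc hV hR.1 hRc)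
  set m := ∫ s in Ioi (0 : ℝ), s * Real.exp (s * R) * p s with hmdef
  have hm0 : 0 < m := lt_of_lt_of_le (by positivity) hmean
  have hcontr := k.weighted_contraction hc hV hθ hR.1 hRc hRV hKR0.le hβ hβc
  rw [← hL₁, ← hL₂] at hcontr
  replace hcontr := hcontr.trans (show _ ≤ ρ' by
    have : V * L₂ ≤ ε * L₂ := by gcongr
    rw [hρ'd]; linarith)
  have hm₀ : 0 < 1 / (2 * γ) := by positivity
  have hk₃K : k₃ ≤ 2 * γ + KR + k₁ + k₂ + k₃ := by linarith
  refine ⟨R, m⁻¹, hR, hPR.symm, fun r hr hr1 => ?_, inv_pos.mpr hm0, by rw [one_div, inv_inv],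
    ?_, ?_, ?_, ?_, ?_⟩
  · have hr1' : P r = 1 := hr1.symm
    rcases le_total r R with h | h
    · have h3 : (R - r) * (1 / (2 * γ)) ≤ 0 := by linarith [hlow r R hr.1 h hR.2]
      linarith [nonpos_of_mul_nonpos_left h3 (by positivity)]
    · have h3 : (r - R) * (1 / (2 * γ)) ≤ 0 := by linarith [hlow R r hR.1 h hr.2]
      linarith [nonpos_of_mul_nonpos_left h3 (by positivity)]
  · have : m⁻¹ ≤ 2 * γ := by
      rw [inv_le_comm₀ hm0 (by positivity), ← one_div]; exact hmean
    linarith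
  · exact hRV.trans (by gcongr; linarith)
  -- The gap says that at least $\kappa V$ of mass is missing, and the Lipschitz bound limits what
  -- the tilt $R$ can restore.
  · have h1 := hup 0 R hR.1 hR.2
    rw [sub_zero] at h1
    have h2 : κ * V ≤ R * (C * (16 / c ^ 2)) := by linarith
    calc V = κ * V / κ := by field_simp
      _ ≤ R * (C * (16 / c ^ 2)) / κ := by gcongr
      _ = k₁ * R := by rw [hk₁]; ring
      _ ≤ _ := by
        have := hR.1
        gcongr; linarith
  · refine (k.abs_rate_sub_le hγ hc hV hR.1 hRc hRV hKR0.le hPR.symm).trans ?_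
    gcongr; linarith
  · intro Y f G hY hf hfb heq t ht
    exact k.asymptotics hc hθ hR.1 hR.2 hβ hβc hPR.symm hmdef hm₀ hmean hcontr hρ' (hk₃ ▸ hk₃K) hY hf
      hfb heq ht

/-- Modes with `V` bounded away from zero decay exponentially. -/
theorem exists_fastMode (hC : 0 < C) (hc : 0 < c) (hκ : 0 < κ) {V₀ : ℝ} (hV₀ : 0 < V₀) :
    ∃ β > 0, ∃ K > 0, ∀ (p₀ p : ℝ → ℝ) (V : ℝ), V₀ ≤ V →
      KernelPair γ C c κ θ ρ p₀ p V → ∀ (Y f : ℝ → ℂ) (G : ℝ), Continuous Y →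
      (∀ t, 0 ≤ t → ‖f t‖ ≤ G * Real.exp (-c * t)) →
      (∀ t, 0 ≤ t → Y t = f t + ∫ s in (0 : ℝ)..t, p s • Y (t - s)) → ∀ t, 0 ≤ t →
      ‖Y t‖ ≤ K * G * Real.exp (-β * t) := by
  -- The weight $e^{\beta s}$ may restore at most half of the missing mass $\kappa V_0$, so the
  -- weighted kernel is still a strict contraction.
  set β := min (c / 2) (κ * V₀ / 2 / (C * (16 / c ^ 2))) with hβd
  have hβ : 0 < β := lt_min (by positivity) (by positivity)
  have hβc : β ≤ c / 2 := min_le_left _ _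
  have hβ1 : β * (C * (16 / c ^ 2)) ≤ κ * V₀ / 2 := by
    calc _ ≤ κ * V₀ / 2 / (C * (16 / c ^ 2)) * (C * (16 / c ^ 2)) := by
          gcongr; exact min_le_right _ _
      _ = _ := by field_simp
  refine ⟨β, hβ, 2 / (κ * V₀), by positivity,
    fun p₀ p V hV k Y f G hY hfb heq t ht => ?_⟩
  have hG : 0 ≤ G := by simpa using (norm_nonneg _).trans (hfb 0 le_rfl)
  have hp := k.cont
  have hi1 : IntegrableOn (fun s => |p s|) (Ioi 0) := (k.integrableOn hc).abs
  have hi2 := KernelPair.integrableOn_envelope hc (β * (C * (4 / c)))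
  have hw : IntegrableOn (fun s => Real.exp (β * s) * |p s|) (Ioi 0) := by
    refine integrableOn_Ioi_of_exp_bound (C := C) (by linarith : 0 < c / 2) (by fun_prop)
      fun s hs => ?_
    have := k.tilt_bound hs hβc
    rwa [Real.norm_eq_abs, abs_mul, abs_abs, ← abs_mul, mul_comm β]
  have h := volterra_norm_le (ρ := 1 - κ * V₀ / 2) (H := G) hY hw ?_
    (by linarith [mul_pos hκ hV₀]) (fun t ht => (hfb t ht).trans (by gcongr; linarith)) heq ht
  · refine h.trans (le_of_eq ?_)
    rw [sub_sub_cancel]; field_simp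
  · have hle : ∫ s in Ioi (0 : ℝ), Real.exp (β * s) * |p s| ≤ ∫ s in Ioi (0 : ℝ),
        (|p s| + β * (C * (4 / c)) * Real.exp (-(c / 4) * s)) := by
      refine setIntegral_mono_on hw (hi1.add hi2) measurableSet_Ioi fun s hs => ?_
      have hs0 : 0 ≤ s := le_of_lt hs
      have e := exp_sub_exp_le (a := 0) (b := s * β)
      simp only [Real.exp_zero, sub_zero] at e
      have e3 := mul_exp_mul_exp_le hc hs0 hβc
      have a2 : (Real.exp (s * β) - 1) * |p s| ≤
          β * (C * (4 / c)) * Real.exp (-(c / 4) * s) := by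
        calc _ ≤ (s * β * Real.exp (s * β)) * (C * Real.exp (-c * s)) :=
              mul_le_mul e (k.abs_le_exp hs0) (abs_nonneg _) (by positivity)
          _ = β * C * (s * (Real.exp (s * β) * Real.exp (-c * s))) := by ring
          _ ≤ β * C * (4 / c * Real.exp (-(c / 4) * s)) := by gcongr
          _ = _ := by ring
      rw [mul_comm β s]; linarith
    rw [integral_add hi1 hi2, KernelPair.integral_envelope hc] at hle
    have h1 := k.gap
    have h2 : β * (C * (4 / c)) * (4 / c) = β * (C * (16 / c ^ 2)) := by field_simp; norm_num
    have h3 : κ * V₀ ≤ κ * V := by gcongr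
    rw [h2] at hle
    linarith

end

/-! ### Memory kernels as averages over the dual lattice -/

section
variable {L : ℕ} [NeZero L]

/-- Average over the cyclic group. -/
def cavg (f : ZMod L → ℝ) : ℝ := (1 / (L : ℝ)) * ∑ m, f m

lemma natCast_pos_of_neZero : 0 < (L : ℝ) := by
  exact_mod_cast Nat.pos_of_ne_zero (NeZero.ne L)

lemma cavg_mono {f g : ZMod L → ℝ} (h : ∀ m, f m ≤ g m) : cavg f ≤ cavg g := by
  unfold cavg
  have := natCast_pos_of_neZero (L := L)
  exact mul_le_mul_of_nonneg_left (Finset.sum_le_sum fun m _ => h m) (by positivity)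

lemma cavg_const (c : ℝ) : cavg (fun _ : ZMod L => c) = c := by
  have := natCast_pos_of_neZero (L := L)
  simp only [cavg, Finset.sum_const, Finset.card_univ, ZMod.card, nsmul_eq_mul]
  field_simp

lemma cavg_nonneg {f : ZMod L → ℝ} (h : ∀ m, 0 ≤ f m) : 0 ≤ cavg f := by
  rw [← cavg_const (L := L) 0]; exact cavg_mono h

lemma cavg_add (f g : ZMod L → ℝ) : cavg (fun m => f m + g m) = cavg f + cavg g := by
  simp only [cavg, Finset.sum_add_distrib, mul_add]

lemma cavg_sub (f g : ZMod L → ℝ) : cavg (fun m => f m - g m) = cavg f - cavg g := by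
  simp only [cavg, Finset.sum_sub_distrib, mul_sub]

lemma cavg_const_mul (c : ℝ) (f : ZMod L → ℝ) : cavg (fun m => c * f m) = c * cavg f := by
  simp only [cavg, ← Finset.mul_sum]; ring

lemma cavg_shift (f : ZMod L → ℝ) (n : ZMod L) : cavg (fun m => f (m + n)) = cavg f := by
  unfold cavg
  congr 1
  exact Fintype.sum_equiv (Equiv.addRight n) _ _ fun _ => rfl

lemma abs_cavg_le (f : ZMod L → ℝ) : |cavg f| ≤ cavg fun m => |f m| := by
  have := natCast_pos_of_neZero (L := L)
  unfold cavg
  rw [abs_mul, abs_of_pos (by positivity : 0 < 1 / (L : ℝ))]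
  exact mul_le_mul_of_nonneg_left (Finset.abs_sum_le_sum_abs _ _) (by positivity)

lemma continuous_cavg {f : ZMod L → ℝ → ℝ} (h : ∀ m, Continuous (f m)) :
    Continuous fun s => cavg fun m => f m s := by
  unfold cavg
  exact continuous_const.mul (continuous_finsetSum _ fun m _ => h m)

lemma integral_cavg {f : ZMod L → ℝ → ℝ} {S : Set ℝ} (h : ∀ m, IntegrableOn (f m) S) :
    ∫ s in S, cavg (fun m => f m s) = cavg fun m => ∫ s in S, f m s := by
  unfold cavg
  rw [integral_const_mul, integral_finsetSum _ fun m _ => h m]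

lemma integrableOn_cavg {f : ZMod L → ℝ → ℝ} {S : Set ℝ} (h : ∀ m, IntegrableOn (f m) S) :
    IntegrableOn (fun s => cavg fun m => f m s) S := by
  unfold cavg
  exact (integrable_finsetSum _ fun m _ => h m).const_mul _

/-- Fourier transform of the memory kernel in terms of the squared frequencies `v`. -/
def modeKernel (γ : ℝ) (v : ZMod L → ℝ) (n : ZMod L) (s : ℝ) : ℝ :=
  2 * γ * cavg fun m => respF γ (v m) s * respF γ (v (m + n)) s

/-- Mean square variation of the squared frequencies under a shift by `n`. -/
def modeVar (v : ZMod L → ℝ) (n : ZMod L) : ℝ := cavg fun m => (v (m + n) - v m) ^ 2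

lemma modeVar_nonneg (v : ZMod L → ℝ) (n : ZMod L) : 0 ≤ modeVar v n :=
  cavg_nonneg fun _ => sq_nonneg _

lemma modeKernel_zero (γ : ℝ) (v : ZMod L → ℝ) (s : ℝ) : modeKernel γ v 0 s =
    cavg fun m => 2 * γ * (respF γ (v m) s * respF γ (v m) s) := by
  simp only [modeKernel, add_zero, cavg_const_mul]

lemma continuous_modeKernel (γ : ℝ) (v : ZMod L → ℝ) (n : ZMod L) :
    Continuous (modeKernel γ v n) :=
  continuous_const.mul (continuous_cavg fun m =>
    (continuous_respF γ (v m)).mul (continuous_respF γ (v (m + n))))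

lemma modeKernel_zero_eq (γ : ℝ) (v : ZMod L → ℝ) (n : ZMod L) (s : ℝ) : modeKernel γ v 0 s =
    γ * cavg fun m => (respF γ (v m) s ^ 2 + respF γ (v (m + n)) s ^ 2) := by
  rw [cavg_add, cavg_shift (fun m => respF γ (v m) s ^ 2), modeKernel]
  simp only [add_zero, pow_two]; ring

/-- Polarization: by shift invariance the zero mode is the average of $F_{v_m}^2+F_{v_{m+n}}^2$,
which completes the square. The companion identity with a plus sign gives $|p_n|\le p_0$. -/
lemma modeKernel_zero_sub (γ : ℝ) (v : ZMod L → ℝ) (n : ZMod L) (s : ℝ) :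
    modeKernel γ v 0 s - modeKernel γ v n s =
      γ * cavg fun m => (respF γ (v (m + n)) s - respF γ (v m) s) ^ 2 := by
  rw [modeKernel_zero_eq γ v n, modeKernel, mul_comm 2 γ, mul_assoc γ 2, ← mul_sub,
    ← cavg_const_mul, ← cavg_sub]
  congr 2; funext m; ring

lemma modeKernel_zero_add (γ : ℝ) (v : ZMod L → ℝ) (n : ZMod L) (s : ℝ) :
    modeKernel γ v 0 s + modeKernel γ v n s =
      γ * cavg fun m => (respF γ (v (m + n)) s + respF γ (v m) s) ^ 2 := by
  rw [modeKernel_zero_eq γ v n, modeKernel, mul_comm 2 γ, mul_assoc γ 2, ← mul_add,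
    ← cavg_const_mul, ← cavg_add]
  congr 2; funext m; ring

lemma abs_modeKernel_le {γ : ℝ} (hγ : 0 < γ) (v : ZMod L → ℝ) (n : ZMod L) (s : ℝ) :
    |modeKernel γ v n s| ≤ modeKernel γ v 0 s := by
  have h1 := modeKernel_zero_sub γ v n s
  have h2 := modeKernel_zero_add γ v n s
  have h3 : 0 ≤ γ * cavg fun m => (respF γ (v (m + n)) s - respF γ (v m) s) ^ 2 :=
    mul_nonneg hγ.le (cavg_nonneg fun _ => sq_nonneg _)
  have h4 : 0 ≤ γ * cavg fun m => (respF γ (v (m + n)) s + respF γ (v m) s) ^ 2 :=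
    mul_nonneg hγ.le (cavg_nonneg fun _ => sq_nonneg _)
  rw [abs_le]; constructor <;> linarith

end

/-! ### Uniform bounds on the kernels of all modes -/

section
variable {γ v₀ v₁ : ℝ}

lemma Overdamped.modeKernel_zero_le (h : Overdamped γ v₀ v₁) {L : ℕ} [NeZero L]
    {v : ZMod L → ℝ} (hv : ∀ m, v m ∈ Icc v₀ v₁) {s : ℝ} (hs : 0 ≤ s) :
    modeKernel γ v 0 s ≤ 2 * γ * respBound γ v₁ ^ 2 * Real.exp (-respRate γ v₀ * s) := by
  have hγ := h.gamma_pos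
  rw [modeKernel_zero, ← cavg_const (L := L) (2 * γ * _ * _)]
  refine cavg_mono fun m => ?_
  have h1 := (le_abs_self _).trans (h.abs_FF_le (hv m) (hv m) hs)
  have h2 : Real.exp (-(2 * respRate γ v₀) * s) ≤ Real.exp (-respRate γ v₀ * s) :=
    Real.exp_le_exp.mpr (by nlinarith [mul_nonneg h.rate_pos.le hs])
  rw [mul_assoc (2 * γ)]
  refine mul_le_mul_of_nonneg_left (h1.trans ?_) (by linarith)
  gcongr

lemma Overdamped.integrableOn_modeKernel (h : Overdamped γ v₀ v₁) {L : ℕ} [NeZero L]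
    {v : ZMod L → ℝ} (hv : ∀ m, v m ∈ Icc v₀ v₁) (n : ZMod L) :
    IntegrableOn (modeKernel γ v n) (Ioi 0) :=
  integrableOn_Ioi_of_exp_bound h.rate_pos (continuous_modeKernel γ v n) fun s hs =>
    (abs_modeKernel_le h.gamma_pos v n s).trans (h.modeKernel_zero_le hv hs)

lemma Overdamped.integral_Ioi_modeKernel_zero (h : Overdamped γ v₀ v₁) {L : ℕ} [NeZero L]
    {v : ZMod L → ℝ} (hv : ∀ m, v m ∈ Icc v₀ v₁) {t : ℝ} (ht : 0 ≤ t) :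
    ∫ s in Ioi t, modeKernel γ v 0 s = cavg fun m => modeQ γ (v m) t := by
  simp_rw [modeKernel_zero]
  have hi : ∀ m, IntegrableOn (fun s => 2 * γ * (respF γ (v m) s * respF γ (v m) s)) (Ioi t) :=
    fun m => ((h.integrableOn_FF (hv m) (hv m)).mono_set (Ioi_subset_Ioi ht)).const_mul (2 * γ)
  rw [integral_cavg hi]
  congr 1; funext m
  exact h.integral_Ioi_FF (hv m) ht

lemma Overdamped.integral_modeKernel_zero (h : Overdamped γ v₀ v₁) {L : ℕ} [NeZero L]
    {v : ZMod L → ℝ} (hv : ∀ m, v m ∈ Icc v₀ v₁) :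
    ∫ s in Ioi (0 : ℝ), modeKernel γ v 0 s = 1 := by
  rw [h.integral_Ioi_modeKernel_zero hv le_rfl]
  have : ∀ m, modeQ γ (v m) 0 = 1 := fun m => by
    simp [modeQ, respX_zero, respF_zero (h.mem_lt (hv m))]
  simp_rw [this, cavg_const]

lemma Overdamped.mul_FF_integrableOn (h : Overdamped γ v₀ v₁) {v : ℝ} (hv : v ∈ Icc v₀ v₁) :
    IntegrableOn (fun s => s * (2 * γ * (respF γ v s * respF γ v s))) (Ioi 0) := by
  -- The integral of a non-integrable function is $0$ by convention, whereas here it is known to be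
  -- $1/\gamma$.
  by_contra hn
  have h1 := h.integral_mul_FF hv
  rw [integral_undef hn] at h1
  have := h.gamma_pos
  have : 0 < 1 / γ := by positivity
  linarith

lemma Overdamped.integral_mul_modeKernel_zero (h : Overdamped γ v₀ v₁) {L : ℕ} [NeZero L]
    {v : ZMod L → ℝ} (hv : ∀ m, v m ∈ Icc v₀ v₁) :
    ∫ s in Ioi (0 : ℝ), s * modeKernel γ v 0 s = 1 / γ := by
  have e : ∀ s, s * modeKernel γ v 0 s =
      cavg fun m => s * (2 * γ * (respF γ (v m) s * respF γ (v m) s)) := fun s => by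
    rw [modeKernel_zero, ← cavg_const_mul]
  simp_rw [e]
  rw [integral_cavg fun m => h.mul_FF_integrableOn (hv m)]
  simp_rw [fun m => h.integral_mul_FF (hv m), cavg_const]

lemma Overdamped.modeKernel_sub_le (h : Overdamped γ v₀ v₁) {L : ℕ} [NeZero L]
    {v : ZMod L → ℝ} (hv : ∀ m, v m ∈ Icc v₀ v₁) (n : ZMod L) {s : ℝ} (hs : 0 ≤ s) :
    modeKernel γ v 0 s - modeKernel γ v n s ≤
      γ * (respBound γ v₁ ^ 4 * (2 / respRate γ v₀) ^ 2) * modeVar v n *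
        Real.exp (-respRate γ v₀ * s) := by
  have hγ := h.gamma_pos
  rw [modeKernel_zero_sub]
  calc _ ≤ γ * cavg fun m => (respBound γ v₁ ^ 4 * (2 / respRate γ v₀) ^ 2 *
        Real.exp (-respRate γ v₀ * s)) * (v (m + n) - v m) ^ 2 := by
        refine mul_le_mul_of_nonneg_left (cavg_mono fun m => ?_) hγ.le
        refine (h.sq_sub_respF_le (hv _) (hv _) hs).trans (le_of_eq (by ring))
    _ = _ := by rw [cavg_const_mul, modeVar]; ring

/-- Up to `smallTime` every response exceeds $1/2$, so the mode kernel is nonnegative and its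
absolute value can be dropped; polarization and the short-time lower bound then apply. -/
lemma Overdamped.abs_modeKernel_add_le (h : Overdamped γ v₀ v₁) {L : ℕ} [NeZero L]
    {v : ZMod L → ℝ} (hv : ∀ m, v m ∈ Icc v₀ v₁) (n : ZMod L) {s : ℝ} (hs : 0 ≤ s)
    (hs' : s ≤ smallTime γ v₁) :
    γ * modeVar v n / 64 * s ^ 4 ≤ modeKernel γ v 0 s - |modeKernel γ v n s| := by
  have hγ := h.gamma_pos
  have h0 : 0 ≤ modeKernel γ v n s := by
    refine mul_nonneg (by linarith) (cavg_nonneg fun m => mul_nonneg ?_ ?_)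
    · linarith [h.half_le_respF (hv m) hs hs']
    · linarith [h.half_le_respF (hv (m + n)) hs hs']
  rw [abs_of_nonneg h0, modeKernel_zero_sub]
  calc _ = γ * cavg fun m => s ^ 4 / 64 * (v (m + n) - v m) ^ 2 := by
        rw [cavg_const_mul, modeVar]; ring
    _ ≤ _ := by
        refine mul_le_mul_of_nonneg_left (cavg_mono fun m => ?_) hγ.le
        rw [mul_comm]
        exact h.sq_sub_respF_ge (hv _) (hv _) hs hs'

/-- Mass is lost already at short times, whatever the sign of the kernel later. The constant is
$320=64\cdot5$, from integrating $s^4/64$. -/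
lemma Overdamped.integral_abs_modeKernel_le (h : Overdamped γ v₀ v₁) (hv01 : v₀ ≤ v₁) {L : ℕ}
    [NeZero L] {v : ZMod L → ℝ} (hv : ∀ m, v m ∈ Icc v₀ v₁) (n : ZMod L) :
    ∫ s in Ioi (0 : ℝ), |modeKernel γ v n s| ≤
      1 - γ * smallTime γ v₁ ^ 5 / 320 * modeVar v n := by
  have hγ := h.gamma_pos
  have hst := h.smallTime_pos hv01
  have i0 := h.integrableOn_modeKernel hv 0
  have i1 : IntegrableOn (fun s => |modeKernel γ v n s|) (Ioi 0) :=
    (h.integrableOn_modeKernel hv n).abs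
  have e1 : ∫ s in Ioi (0 : ℝ), (modeKernel γ v 0 s - |modeKernel γ v n s|) =
      1 - ∫ s in Ioi (0 : ℝ), |modeKernel γ v n s| := by
    rw [integral_sub i0 i1, h.integral_modeKernel_zero hv]
  have e2 : ∫ s in Ioc 0 (smallTime γ v₁), (modeKernel γ v 0 s - |modeKernel γ v n s|) ≤
      ∫ s in Ioi (0 : ℝ), (modeKernel γ v 0 s - |modeKernel γ v n s|) :=
    setIntegral_mono_set (i0.sub i1) (ae_of_all _ fun s =>
      sub_nonneg.mpr (abs_modeKernel_le hγ v n s))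
      (Filter.Eventually.of_forall (Ioc_subset_Ioi_self : Ioc 0 (smallTime γ v₁) ⊆ Ioi 0))
  have e3 : ∫ s in Ioc 0 (smallTime γ v₁), γ * modeVar v n / 64 * s ^ 4 ≤
      ∫ s in Ioc 0 (smallTime γ v₁), (modeKernel γ v 0 s - |modeKernel γ v n s|) := by
    refine setIntegral_mono_on ?_ ((i0.sub i1).mono_set Ioc_subset_Ioi_self) measurableSet_Ioc
      fun s hs => h.abs_modeKernel_add_le hv n hs.1.le hs.2
    exact (Continuous.integrableOn_Icc (by fun_prop)).mono_set Ioc_subset_Icc_self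
  rw [← intervalIntegral.integral_of_le hst.le, intervalIntegral.integral_const_mul,
    integral_pow] at e3
  have e4 : γ * modeVar v n / 64 * ((smallTime γ v₁ ^ (4 + 1) - 0 ^ (4 + 1)) / (((4 : ℕ) : ℝ) + 1)) =
      γ * smallTime γ v₁ ^ 5 / 320 * modeVar v n := by push_cast; ring
  linarith

/-- The kernels of all modes satisfy the assumptions of `KernelPair` with constants that do not
depend on the size of the lattice. -/
theorem Overdamped.exists_kernelPair (h : Overdamped γ v₀ v₁) (hv01 : v₀ ≤ v₁) :
    ∃ C > 0, ∃ κ > 0, ∃ θ > 0, ∃ ρ < 1, ∀ (L : ℕ) [NeZero L] (v : ZMod L → ℝ),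
      (∀ m, v m ∈ Icc v₀ v₁) → ∀ n, KernelPair γ C (respRate γ v₀) κ θ ρ
        (modeKernel γ v 0) (modeKernel γ v n) (modeVar v n) := by
  have hγ := h.gamma_pos
  have hB := h.bound_pos
  have hr := h.rate_pos
  have hst := h.smallTime_pos hv01
  obtain ⟨θ, hθ, hcontr⟩ := h.exists_theta hv01
  refine ⟨2 * γ * respBound γ v₁ ^ 2 + γ * (respBound γ v₁ ^ 4 * (2 / respRate γ v₀) ^ 2),
    by positivity, γ * smallTime γ v₁ ^ 5 / 320, by positivity, θ, hθ, 1 - θ / (2 * γ),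
    by linarith [div_pos hθ (by linarith : 0 < 2 * γ)], fun L _ v hv n => ?_⟩
  refine ⟨continuous_modeKernel γ v 0, continuous_modeKernel γ v n, fun s hs => ?_,
    abs_modeKernel_le hγ v n, fun s hs => ?_, h.integral_modeKernel_zero hv,
    h.integral_mul_modeKernel_zero hv, h.integral_abs_modeKernel_le hv01 hv n, ?_⟩
  · refine (h.modeKernel_zero_le hv hs).trans ?_
    gcongr
    exact le_add_of_nonneg_right (by positivity)
  · refine (h.modeKernel_sub_le hv n hs).trans ?_
    have := modeVar_nonneg v n
    gcongr
    exact le_add_of_nonneg_left (by positivity)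
  -- The tail of the zero mode is the average energy, so the contraction holds mode by mode and
  -- survives averaging by the triangle inequality.
  · have e : ∀ s ∈ Ioi (0 : ℝ), |modeKernel γ v 0 s - θ * tail (modeKernel γ v 0) s| ≤
        cavg fun m => |2 * γ * (respF γ (v m) s * respF γ (v m) s) - θ * modeQ γ (v m) s| := by
      intro s hs
      rw [tail_eq (h.integrableOn_modeKernel hv 0) (le_of_lt hs),
        h.integral_Ioi_modeKernel_zero hv (le_of_lt hs), modeKernel_zero, ← cavg_const_mul,
        ← cavg_sub]
      exact abs_cavg_le _
    have i : ∀ m, IntegrableOn (fun s => |2 * γ * (respF γ (v m) s * respF γ (v m) s) -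
        θ * modeQ γ (v m) s|) (Ioi 0) := fun m =>
      (((h.integrableOn_FF (hv m) (hv m)).const_mul (2 * γ)).sub
        ((h.integrableOn_modeQ (hv m)).const_mul θ)).abs
    calc _ ≤ ∫ s in Ioi (0 : ℝ), cavg fun m =>
          |2 * γ * (respF γ (v m) s * respF γ (v m) s) - θ * modeQ γ (v m) s| := by
          refine integral_mono_of_nonneg (ae_of_all _ fun s => abs_nonneg _)
            (integrableOn_cavg i) ?_
          filter_upwards [ae_restrict_mem measurableSet_Ioi] with s hs using e s hs
      _ = cavg fun m => ∫ s in Ioi (0 : ℝ),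
          |2 * γ * (respF γ (v m) s * respF γ (v m) s) - θ * modeQ γ (v m) s| := integral_cavg i
      _ ≤ cavg fun _ : ZMod L => 1 - θ / (2 * γ) := cavg_mono fun m => hcontr _ (hv m)
      _ = _ := cavg_const _

end

/-! ### Fourier analysis on the cyclic group -/

lemma norm_wave {L : ℕ} (n x : ZMod L) : ‖wave L n x‖ = 1 := by
  rw [wave, mul_comm]; exact Complex.norm_exp_ofReal_mul_I _

lemma wave_re {L : ℕ} (n x : ZMod L) :
    (wave L n x).re = Real.cos (2 * Real.pi * dualPt L n * (x.valMinAbs : ℝ)) := by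
  rw [wave, mul_comm, Complex.exp_ofReal_mul_I_re]

section
variable {L : ℕ} [NeZero L]

/-- The product of the two representatives represents $nx$ modulo $L$, and the exponential depends
on that class only. All algebra of plane waves follows from the additive character. -/
lemma wave_eq (n x : ZMod L) : wave L n x = ZMod.stdAddChar (n * x) := by
  have h : n * x = ((n.valMinAbs * x.valMinAbs : ℤ) : ZMod L) := by
    push_cast [ZMod.coe_valMinAbs]; rfl
  rw [h, ZMod.stdAddChar_coe, wave, dualPt]
  congr 1
  push_cast
  ring

lemma wave_comm (n x : ZMod L) : wave L n x = wave L x n := by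
  rw [wave_eq, wave_eq, mul_comm]

lemma wave_add_right (n x y : ZMod L) : wave L n (x + y) = wave L n x * wave L n y := by
  simp only [wave_eq, mul_add, AddChar.map_add_eq_mul]

lemma wave_add_left (n m x : ZMod L) : wave L (n + m) x = wave L n x * wave L m x := by
  simp only [wave_eq, add_mul, AddChar.map_add_eq_mul]

lemma wave_zero_left (x : ZMod L) : wave L 0 x = 1 := by simp [wave_eq]

lemma wave_neg_left (n x : ZMod L) : wave L (-n) x = wave L n (-x) := by
  simp only [wave_eq, neg_mul, mul_neg]

lemma wave_neg_right (n x : ZMod L) : wave L n (-x) = starRingEnd ℂ (wave L n x) := by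
  rw [wave_eq, wave_eq, mul_neg, AddChar.map_neg_eq_conj]

lemma sum_wave (n : ZMod L) : ∑ x, wave L n x = if n = 0 then (L : ℂ) else 0 := by
  have h := AddChar.sum_mulShift (R := ZMod L) n (ZMod.isPrimitive_stdAddChar L)
  simp only [wave_eq, mul_comm n]
  rw [h, ZMod.card]
  split_ifs <;> simp

lemma natCast_ne_zero_complex : (L : ℂ) ≠ 0 := by exact_mod_cast NeZero.ne L

/-- Inverse discrete Fourier transform. -/
def invFT (f : ZMod L → ℝ) (x : ZMod L) : ℂ := (1 / (L : ℂ)) * ∑ n, wave L n x * (f n : ℂ)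

/-- Even functions on the cyclic group. -/
def IsEvenFn (f : ZMod L → ℝ) : Prop := ∀ n, f (-n) = f n

lemma invFT_neg {f : ZMod L → ℝ} (hf : IsEvenFn f) (x : ZMod L) : invFT f (-x) = invFT f x := by
  unfold invFT
  congr 1
  refine Fintype.sum_equiv (Equiv.neg _) _ _ fun n => ?_
  simp only [Equiv.neg_apply, hf n, wave_neg_left]

lemma conj_invFT {f : ZMod L → ℝ} (x : ZMod L) :
    starRingEnd ℂ (invFT f x) = invFT f (-x) := by
  simp only [invFT, map_mul, map_sum, wave_neg_right, Complex.conj_ofReal, map_div₀, map_one,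
    map_natCast]

lemma ofReal_re_invFT {f : ZMod L → ℝ} (hf : IsEvenFn f) (x : ZMod L) :
    (((invFT f x).re : ℝ) : ℂ) = invFT f x :=
  Complex.conj_eq_iff_re.mp ((conj_invFT x).trans (invFT_neg hf x))

lemma sum_invFT_mul_invFT {f g : ZMod L → ℝ} (x z : ZMod L) :
    ∑ y, invFT f (x - y) * invFT g (y - z) = invFT (fun n => f n * g n) (x - z) := by
  have hL := natCast_ne_zero_complex (L := L)
  have e : ∀ y n m, wave L n (x - y) * (f n : ℂ) * (wave L m (y - z) * (g m : ℂ)) =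
      (wave L n x * wave L m (-z) * (f n : ℂ) * (g m : ℂ)) * wave L (m - n) y := by
    intro y n m
    rw [sub_eq_add_neg, sub_eq_add_neg, sub_eq_add_neg, wave_add_right, wave_add_right,
      wave_add_left, wave_neg_left]
    ring
  calc _ = ∑ y, (1 / (L : ℂ)) ^ 2 * ∑ n, ∑ m,
        (wave L n x * wave L m (-z) * (f n : ℂ) * (g m : ℂ)) * wave L (m - n) y := by
        refine Finset.sum_congr rfl fun y _ => ?_
        simp only [invFT, ← e]
        rw [mul_mul_mul_comm, Finset.sum_mul_sum, pow_two]
    _ = (1 / (L : ℂ)) ^ 2 * ∑ n, ∑ m, (wave L n x * wave L m (-z) * (f n : ℂ) * (g m : ℂ)) *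
        ∑ y, wave L (m - n) y := by
        rw [← Finset.mul_sum, Finset.sum_comm]
        congr 1
        refine Finset.sum_congr rfl fun n _ => ?_
        rw [Finset.sum_comm]
        simp only [Finset.mul_sum]
    _ = _ := by
        simp only [sum_wave, sub_eq_zero, mul_ite, mul_zero, Finset.sum_ite_eq', Finset.mem_univ,
          if_true]
        unfold invFT
        rw [Finset.mul_sum, Finset.mul_sum]
        refine Finset.sum_congr rfl fun n _ => ?_
        rw [sub_eq_add_neg x z, wave_add_right]
        push_cast
        field_simp

/-- The transform of a product is a convolution; evenness of $g$ turns it into a correlation $\sum_m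
f(m)g(m+n)$, the shape of `modeKernel`. -/
lemma sum_invFT_mul_wave {f g : ZMod L → ℝ} (hg : IsEvenFn g) (n : ZMod L) :
    ∑ y, invFT f y * invFT g y * wave L n y = (1 / (L : ℂ)) * ∑ m, (f m : ℂ) * (g (m + n) : ℂ) := by
  have hL := natCast_ne_zero_complex (L := L)
  calc _ = ∑ y, (1 / (L : ℂ)) ^ 2 * ∑ m, ∑ m',
        ((f m : ℂ) * (g m' : ℂ)) * wave L (m' + (m + n)) y := by
        refine Finset.sum_congr rfl fun y _ => ?_
        simp only [invFT]
        rw [mul_mul_mul_comm, Finset.sum_mul_sum, pow_two, mul_assoc, Finset.sum_mul]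
        congr 1
        refine Finset.sum_congr rfl fun m _ => ?_
        rw [Finset.sum_mul]
        refine Finset.sum_congr rfl fun m' _ => ?_
        rw [wave_add_left, wave_add_left]; ring
    _ = (1 / (L : ℂ)) ^ 2 * ∑ m, ∑ m', ((f m : ℂ) * (g m' : ℂ)) *
        ∑ y, wave L (m' + (m + n)) y := by
        rw [← Finset.mul_sum, Finset.sum_comm]
        congr 1
        refine Finset.sum_congr rfl fun m _ => ?_
        rw [Finset.sum_comm]
        simp only [Finset.mul_sum]
    _ = _ := by
        simp only [sum_wave, add_eq_zero_iff_eq_neg, mul_ite, mul_zero, Finset.sum_ite_eq',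
          Finset.mem_univ, if_true]
        rw [Finset.mul_sum, Finset.mul_sum]
        refine Finset.sum_congr rfl fun m _ => ?_
        rw [hg (m + n)]
        field_simp

/-- The circulant matrix with symbol `f`. -/
def circ (f : ZMod L → ℝ) : Matrix (ZMod L) (ZMod L) ℝ := Matrix.of fun x' x => (invFT f (x' - x)).re

lemma circ_apply (f : ZMod L → ℝ) (x y : ZMod L) : circ f x y = (invFT f (x - y)).re := rfl

lemma circ_transpose {f : ZMod L → ℝ} (hf : IsEvenFn f) : (circ f)ᵀ = circ f := by
  ext x y
  rw [Matrix.transpose_apply, circ_apply, circ_apply, ← invFT_neg hf, neg_sub]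

lemma circ_mul {f g : ZMod L → ℝ} (hf : IsEvenFn f) (hg : IsEvenFn g) :
    circ f * circ g = circ fun n => f n * g n := by
  ext x z
  rw [Matrix.mul_apply, circ_apply, ← sum_invFT_mul_invFT, Complex.re_sum]
  refine Finset.sum_congr rfl fun y _ => ?_
  rw [← ofReal_re_invFT hf, ← ofReal_re_invFT hg, ← Complex.ofReal_mul, Complex.ofReal_re]
  rfl

lemma circ_add (f g : ZMod L → ℝ) : circ f + circ g = circ fun n => f n + g n := by
  ext x y
  rw [Matrix.add_apply, circ_apply, circ_apply, circ_apply, ← Complex.add_re]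
  simp only [invFT]
  rw [← mul_add, ← Finset.sum_add_distrib]
  congr 2
  refine Finset.sum_congr rfl fun n _ => ?_
  push_cast; ring

lemma circ_smul (c : ℝ) (f : ZMod L → ℝ) : c • circ f = circ fun n => c * f n := by
  ext x y
  rw [Matrix.smul_apply, circ_apply, circ_apply, smul_eq_mul, ← Complex.re_ofReal_mul]
  simp only [invFT]
  rw [mul_left_comm, Finset.mul_sum]
  congr 2
  refine Finset.sum_congr rfl fun n _ => ?_
  push_cast; ring

lemma circ_neg (f : ZMod L → ℝ) : -circ f = circ fun n => -f n := by
  rw [← neg_one_smul ℝ, circ_smul]; simp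

lemma invFT_one (x : ZMod L) : invFT (fun _ : ZMod L => (1 : ℝ)) x = if x = 0 then 1 else 0 := by
  have hL := natCast_ne_zero_complex (L := L)
  unfold invFT
  simp only [Complex.ofReal_one, mul_one]
  simp_rw [wave_comm _ x]
  rw [sum_wave]
  split_ifs <;> simp [hL]

lemma circ_one : circ (fun _ : ZMod L => (1 : ℝ)) = 1 := by
  ext x y
  rw [circ_apply, invFT_one, Matrix.one_apply]
  simp only [sub_eq_zero]
  split_ifs <;> simp

lemma circ_zero : circ (fun _ : ZMod L => (0 : ℝ)) = 0 := by
  ext x y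
  simp [circ_apply, invFT]

lemma circ_re (f : ZMod L → ℝ) (x y : ZMod L) :
    circ f x y = cavg fun n => (wave L n (x - y)).re * f n := by
  rw [circ_apply, invFT, cavg]
  rw [show (1 / (L : ℂ)) = ((1 / (L : ℝ) : ℝ) : ℂ) by push_cast; rfl, Complex.re_ofReal_mul,
    Complex.re_sum]
  congr 1
  refine Finset.sum_congr rfl fun n _ => ?_
  rw [mul_comm, Complex.re_ofReal_mul, mul_comm]

lemma hasDerivAt_circ {f f' : ℝ → ZMod L → ℝ} {t : ℝ}
    (h : ∀ n, HasDerivAt (fun t => f t n) (f' t n) t) (x y : ZMod L) :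
    HasDerivAt (fun t => circ (f t) x y) (circ (f' t) x y) t := by
  simp only [circ_re, cavg]
  exact (HasDerivAt.fun_sum fun n _ => (h n).const_mul _).const_mul _

/-- Discrete Fourier transform. -/
def dFT (T : ZMod L → ℝ) (n : ZMod L) : ℂ := ∑ x, wave L n (-x) * (T x : ℂ)

lemma norm_dFT_le (T : ZMod L → ℝ) (n : ZMod L) : ‖dFT T n‖ ≤ ∑ x, |T x| := by
  refine (norm_sum_le _ _).trans (Finset.sum_le_sum fun x _ => ?_)
  rw [norm_mul, norm_wave, one_mul, Complex.norm_real, Real.norm_eq_abs]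

lemma dFT_zero (T : ZMod L → ℝ) : dFT T 0 = ((∑ x, T x : ℝ) : ℂ) := by
  simp [dFT, wave_zero_left]

lemma inversion (T : ZMod L → ℝ) (x : ZMod L) :
    (T x : ℂ) = (1 / (L : ℂ)) * ∑ n, wave L n x * dFT T n := by
  have hL := natCast_ne_zero_complex (L := L)
  have e : ∑ n, wave L n x * dFT T n = ∑ y, (T y : ℂ) * ∑ n, wave L n (x - y) := by
    simp only [dFT, Finset.mul_sum]
    rw [Finset.sum_comm]
    refine Finset.sum_congr rfl fun y _ => Finset.sum_congr rfl fun n _ => ?_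
    rw [sub_eq_add_neg, wave_add_right]; ring
  rw [e]
  simp_rw [wave_comm _ (x - _), sum_wave, sub_eq_zero]
  simp only [mul_ite, mul_zero, Finset.sum_ite_eq, Finset.mem_univ, if_true]
  field_simp

lemma circ_mulVec {f : ZMod L → ℝ} (hf : IsEvenFn f) (T : ZMod L → ℝ) (x : ZMod L) :
    (((circ f *ᵥ T) x : ℝ) : ℂ) = (1 / (L : ℂ)) * ∑ n, wave L n x * ((f n : ℂ) * dFT T n) := by
  simp only [Matrix.mulVec, dotProduct, circ_apply]
  push_cast
  simp only [ofReal_re_invFT hf]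
  simp only [invFT, dFT, Finset.mul_sum, Finset.sum_mul]
  rw [Finset.sum_comm]
  refine Finset.sum_congr rfl fun n _ => Finset.sum_congr rfl fun y _ => ?_
  rw [sub_eq_add_neg, wave_add_right]; ring

lemma dFT_convolution (p T : ZMod L → ℝ) (n : ZMod L) :
    dFT (fun x => ∑ y, p y * T (x - y)) n = dFT p n * dFT T n := by
  simp only [dFT]
  rw [Finset.sum_mul]
  push_cast
  simp only [Finset.mul_sum]
  rw [Finset.sum_comm]
  refine Finset.sum_congr rfl fun y _ => ?_
  refine Fintype.sum_equiv (Equiv.subRight y) _ _ fun x => ?_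
  simp only [Equiv.subRight_apply]
  rw [show -x = -y + -(x - y) by ring, wave_add_right]; ring

/-! ### Quadratic forms of circulant matrices -/

/-- The bilinear form of a circulant matrix. -/
def circForm (f : ZMod L → ℝ) (a b : ZMod L → ℝ) : ℝ := a ⬝ᵥ (circ f *ᵥ b)

/-- Parseval's identity. Inequalities between quadratic forms of circulant matrices thereby become
pointwise inequalities between symbols. -/
lemma circForm_eq_cavg {f : ZMod L → ℝ} (hf : IsEvenFn f) (a b : ZMod L → ℝ) :
    circForm f a b = cavg fun n => f n * (starRingEnd ℂ (dFT a n) * dFT b n).re := by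
  have h : ((circForm f a b : ℝ) : ℂ) =
      ((1 / (L : ℝ) : ℝ) : ℂ) * ∑ n, (f n : ℂ) * (starRingEnd ℂ (dFT a n) * dFT b n) := by
    simp only [circForm, dotProduct]
    push_cast
    simp only [circ_mulVec hf]
    have hc : ∀ n, starRingEnd ℂ (dFT a n) = ∑ x, wave L n x * (a x : ℂ) := by
      intro n
      simp only [dFT, map_sum, map_mul, Complex.conj_ofReal, wave_neg_right, Complex.conj_conj]
    simp only [hc, Finset.mul_sum, Finset.sum_mul]
    rw [Finset.sum_comm]
    refine Finset.sum_congr rfl fun n _ => Finset.sum_congr rfl fun x _ => ?_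
    ring
  have h2 := congrArg Complex.re h
  rw [Complex.ofReal_re, Complex.re_ofReal_mul, Complex.re_sum] at h2
  rw [h2, cavg]
  congr 1
  refine Finset.sum_congr rfl fun n _ => ?_
  rw [Complex.re_ofReal_mul]

lemma circForm_self {f : ZMod L → ℝ} (hf : IsEvenFn f) (a : ZMod L → ℝ) :
    circForm f a a = cavg fun n => f n * ‖dFT a n‖ ^ 2 := by
  rw [circForm_eq_cavg hf]
  congr 1; funext n
  rw [← Complex.normSq_eq_conj_mul_self, Complex.ofReal_re, Complex.normSq_eq_norm_sq]

lemma circForm_mono {f g : ZMod L → ℝ} (hf : IsEvenFn f) (hg : IsEvenFn g)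
    (hfg : ∀ n, f n ≤ g n) (a : ZMod L → ℝ) : circForm f a a ≤ circForm g a a := by
  rw [circForm_self hf, circForm_self hg]
  exact cavg_mono fun n => mul_le_mul_of_nonneg_right (hfg n) (sq_nonneg _)

lemma circForm_mulVec {f g : ZMod L → ℝ} (hf : IsEvenFn f) (hg : IsEvenFn g) (a b : ZMod L → ℝ) :
    (circ f *ᵥ a) ⬝ᵥ (circ g *ᵥ b) = circForm (fun n => f n * g n) a b := by
  rw [circForm, ← circ_mul hf hg, ← Matrix.mulVec_mulVec, Matrix.dotProduct_mulVec a,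
    ← Matrix.mulVec_transpose, circ_transpose hf]

lemma circForm_smul (c : ℝ) (f : ZMod L → ℝ) (a b : ZMod L → ℝ) :
    circForm (fun n => c * f n) a b = c * circForm f a b := by
  rw [circForm, circForm, ← circ_smul, Matrix.smul_mulVec, dotProduct_smul, smul_eq_mul]

end

/-! ### Matrix exponentials -/

section
variable {ι : Type*} [Fintype ι] [DecidableEq ι]

attribute [local instance] Matrix.linftyOpNormedRing Matrix.linftyOpNormedAlgebra

lemma hasDerivAt_exp_smul_apply (B : Matrix ι ι ℝ) (t : ℝ) (i j : ι) :
    HasDerivAt (fun t : ℝ => NormedSpace.exp (t • B) i j) ((NormedSpace.exp (t • B) * B) i j) t := by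
  have h := hasDerivAt_exp_smul_const (𝕂 := ℝ) B t
  let l : Matrix ι ι ℝ →L[ℝ] ℝ :=
    LinearMap.toContinuousLinearMap (Matrix.entryLinearMap ℝ ℝ i j)
  exact l.hasFDerivAt.comp_hasDerivAt t h

/-- Matrix exponentials are determined by their differential equation. -/
lemma eq_exp_of_hasDerivAt {B : Matrix ι ι ℝ} {E : ℝ → Matrix ι ι ℝ} (h0 : E 0 = 1)
    (hE : ∀ t i j, HasDerivAt (fun t => E t i j) ((B * E t) i j) t) (t : ℝ) :
    E t = NormedSpace.exp (t • B) := by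
  -- The product $e^{-tB}E(t)$ is constant, hence equal to its initial value $1$.
  have hd : ∀ t i j, HasDerivAt (fun t => (NormedSpace.exp (t • (-B)) * E t) i j) 0 t := by
    intro t i j
    simp only [Matrix.mul_apply (M := NormedSpace.exp _)]
    have h1 := HasDerivAt.fun_sum (u := Finset.univ) (fun k _ =>
      (hasDerivAt_exp_smul_apply (-B) t i k).mul (hE t k j))
    refine h1.congr_deriv ?_
    rw [Finset.sum_add_distrib]
    have e1 : ∑ k, (NormedSpace.exp (t • -B) * -B) i k * E t k j =
        (NormedSpace.exp (t • -B) * -B * E t) i j := by rw [Matrix.mul_apply]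
    have e2 : ∑ k, NormedSpace.exp (t • -B) i k * (B * E t) k j =
        (NormedSpace.exp (t • -B) * (B * E t)) i j := by rw [Matrix.mul_apply]
    rw [e1, e2, ← Matrix.add_apply]
    simp [Matrix.mul_assoc]
  have hc : NormedSpace.exp (t • (-B)) * E t = 1 := by
    ext i j
    have := is_const_of_deriv_eq_zero (f := fun t => (NormedSpace.exp (t • (-B)) * E t) i j)
      (fun t => (hd t i j).differentiableAt) (fun t => (hd t i j).deriv) t 0
    simpa [h0] using this
  have h2 : NormedSpace.exp (t • B) * NormedSpace.exp (t • (-B)) = 1 := by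
    rw [← Matrix.exp_add_of_commute]
    · simp
    · rw [smul_neg]; exact (Commute.refl _).neg_right
  calc E t = NormedSpace.exp (t • B) * NormedSpace.exp (t • (-B)) * E t := by rw [h2, one_mul]
    _ = _ := by rw [Matrix.mul_assoc, hc, mul_one]

end

/-! ### The dispersion relation -/

section
variable {Φ : ℤ → ℝ}

lemma summable_exp_neg_mul_abs {δ : ℝ} (hδ : 0 < δ) :
    Summable fun x : ℤ => Real.exp (-δ * |(x : ℝ)|) := by
  have h : Summable fun n : ℕ => Real.exp (-δ * (n : ℝ)) := by
    have := Real.summable_exp_nat_mul_iff.mpr (neg_lt_zero.mpr hδ)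
    simpa [mul_comm] using this
  refine Summable.of_nat_of_neg ?_ ?_
  · simpa using h
  · simpa using h

lemma PhiAssumption.summable_mul (h : PhiAssumption Φ) :
    Summable fun x : ℤ => |Φ x| * |(x : ℝ)| := by
  obtain ⟨C, hC, δ, hδ, hb⟩ := h.exp_decay
  refine Summable.of_nonneg_of_le (fun x => by positivity) (fun x => ?_)
    ((summable_exp_neg_mul_abs (by linarith : 0 < δ / 2)).mul_left (C * (2 / δ)))
  calc |Φ x| * |(x : ℝ)| ≤ C * Real.exp (-δ * |(x : ℝ)|) * |(x : ℝ)| := by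
        gcongr; exact hb x
    _ = C * (|(x : ℝ)| * Real.exp (-δ * |(x : ℝ)|)) := by ring
    _ ≤ C * (2 / δ * Real.exp (-(δ / 2) * |(x : ℝ)|)) := by
        exact mul_le_mul_of_nonneg_left (mul_exp_neg_le hδ _) hC.le
    _ = _ := by ring

lemma PhiAssumption.summable_abs (h : PhiAssumption Φ) : Summable fun x : ℤ => |Φ x| := by
  obtain ⟨C, hC, δ, hδ, hb⟩ := h.exp_decay
  exact Summable.of_nonneg_of_le (fun x => abs_nonneg _) hb
    ((summable_exp_neg_mul_abs hδ).mul_left C)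

lemma PhiAssumption.hasSum_hatPhi (h : PhiAssumption Φ) (k : ℝ) :
    HasSum (fun x : ℤ => Φ x * Real.cos (2 * Real.pi * k * x)) (hatPhi Φ k) := by
  have hs : Summable fun x : ℤ =>
      (Φ x : ℂ) * Complex.exp (-(Complex.I * (2 * Real.pi * k * x : ℝ))) := by
    refine Summable.of_norm (h.summable_abs.congr fun x => ?_)
    rw [norm_mul, Complex.norm_real, Real.norm_eq_abs,
      show -(Complex.I * ((2 * Real.pi * k * x : ℝ) : ℂ)) =
        ((-(2 * Real.pi * k * x) : ℝ) : ℂ) * Complex.I by push_cast; ring,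
      Complex.norm_exp_ofReal_mul_I, mul_one]
  have h2 := Complex.hasSum_re hs.hasSum
  refine h2.congr_fun ?_ |> fun h => h
  intro x
  rw [Complex.re_ofReal_mul, show -(Complex.I * ((2 * Real.pi * k * x : ℝ) : ℂ)) =
        ((-(2 * Real.pi * k * x) : ℝ) : ℂ) * Complex.I by push_cast; ring,
      Complex.exp_ofReal_mul_I_re, Real.cos_neg]

lemma PhiAssumption.hatPhi_neg (h : PhiAssumption Φ) (k : ℝ) : hatPhi Φ (-k) = hatPhi Φ k := by
  refine (h.hasSum_hatPhi (-k)).unique ?_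
  have e : (fun x : ℤ => Φ x * Real.cos (2 * Real.pi * -k * x)) =
      fun x : ℤ => Φ x * Real.cos (2 * Real.pi * k * x) := by
    funext x; rw [← Real.cos_neg]; ring_nf
  rw [e]; exact h.hasSum_hatPhi k

lemma PhiAssumption.hatPhi_add_int (h : PhiAssumption Φ) (k : ℝ) (z : ℤ) :
    hatPhi Φ (k + z) = hatPhi Φ k := by
  refine (h.hasSum_hatPhi (k + z)).unique ?_
  have e : (fun x : ℤ => Φ x * Real.cos (2 * Real.pi * (k + z) * x)) =
      fun x : ℤ => Φ x * Real.cos (2 * Real.pi * k * x) := by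
    funext x
    rw [show 2 * Real.pi * (k + z) * x = 2 * Real.pi * k * x + ((z * x : ℤ) : ℝ) * (2 * Real.pi) by
      push_cast; ring, Real.cos_add_int_mul_two_pi]
  rw [e]; exact h.hasSum_hatPhi k

lemma PhiAssumption.exists_lipschitz (h : PhiAssumption Φ) :
    ∃ Λ > 0, ∀ k k' : ℝ, |hatPhi Φ k - hatPhi Φ k'| ≤ Λ * |k - k'| := by
  -- The summand $1$ keeps the constant positive when $\Phi$ is supported at the origin.
  refine ⟨2 * Real.pi * ∑' x : ℤ, |Φ x| * |(x : ℝ)| + 1, ?_, fun k k' => ?_⟩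
  · have : 0 ≤ ∑' x : ℤ, |Φ x| * |(x : ℝ)| := tsum_nonneg fun x => by positivity
    positivity
  · have h1 := (h.hasSum_hatPhi k).sub (h.hasSum_hatPhi k')
    have h2 : Summable fun x : ℤ => 2 * Real.pi * |k - k'| * (|Φ x| * |(x : ℝ)|) :=
      h.summable_mul.mul_left _
    have h3 : ∀ x : ℤ, ‖Φ x * Real.cos (2 * Real.pi * k * x) -
        Φ x * Real.cos (2 * Real.pi * k' * x)‖ ≤ 2 * Real.pi * |k - k'| * (|Φ x| * |(x : ℝ)|) := by
      intro x
      rw [← mul_sub, Real.norm_eq_abs, abs_mul]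
      have h4 : |Real.cos (2 * Real.pi * k * x) - Real.cos (2 * Real.pi * k' * x)| ≤
          |2 * Real.pi * k * x - 2 * Real.pi * k' * x| := by
        have := Real.lipschitzWith_cos.dist_le_mul (2 * Real.pi * k * x) (2 * Real.pi * k' * x)
        simpa [Real.dist_eq] using this
      have h5 : |2 * Real.pi * k * x - 2 * Real.pi * k' * x| =
          2 * Real.pi * |k - k'| * |(x : ℝ)| := by
        rw [show 2 * Real.pi * k * x - 2 * Real.pi * k' * x = 2 * Real.pi * (k - k') * x by ring,
          abs_mul, abs_mul, abs_of_pos Real.two_pi_pos]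
      rw [h5] at h4
      calc _ ≤ |Φ x| * (2 * Real.pi * |k - k'| * |(x : ℝ)|) := by gcongr
        _ = _ := by ring
    have h6 := tsum_of_norm_bounded h2.hasSum h3
    rw [h1.tsum_eq, tsum_mul_left, Real.norm_eq_abs] at h6
    nlinarith [abs_nonneg (k - k')]

lemma PhiAssumption.continuous_hatPhi (h : PhiAssumption Φ) : Continuous (hatPhi Φ) := by
  obtain ⟨Λ, hΛ, hl⟩ := h.exists_lipschitz
  refine (LipschitzWith.of_dist_le_mul (K := Λ.toNNReal) fun k k' => ?_).continuous
  rw [Real.coe_toNNReal _ hΛ.le]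
  exact hl k k'

lemma PhiAssumption.omega_sq (h : PhiAssumption Φ) (k : ℝ) : omega Φ k ^ 2 = hatPhi Φ k := by
  obtain ⟨w, _, hb⟩ := h.pinning
  exact Real.sq_sqrt ((sq_nonneg w).trans (hb k))

lemma PhiAssumption.hatA2_eq (h : PhiAssumption Φ) (γ t k : ℝ) :
    hatA2 Φ γ t k = respF γ (hatPhi Φ k) t := by
  simp only [hatA2, respF, uFun, muPlus, muMinus, modeU, h.omega_sq]

/-- Periodicity and continuity give a maximum over one period, so the pointwise strict bound on
$\hat\Phi$ becomes a uniform one. -/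
lemma GammaAssumption.exists_overdamped {γ : ℝ} (h : GammaAssumption Φ γ) :
    ∃ v₀ v₁, Overdamped γ v₀ v₁ ∧ v₀ ≤ v₁ ∧ ∀ k, hatPhi Φ k ∈ Icc v₀ v₁ := by
  obtain ⟨w, hw, hb⟩ := h.pinning
  obtain ⟨k₁, _, hk₁⟩ := isCompact_Icc.exists_isMaxOn (nonempty_Icc.mpr (zero_le_one (α := ℝ)))
    h.continuous_hatPhi.continuousOn
  refine ⟨w ^ 2, hatPhi Φ k₁, ⟨h.gamma_pos, by positivity, ?_⟩, hb k₁, fun k => ⟨hb k, ?_⟩⟩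
  · have := h.noise_dominates k₁
    nlinarith
  · have e : hatPhi Φ k = hatPhi Φ (Int.fract k) := by
      conv_lhs => rw [← Int.fract_add_floor k]
      exact h.hatPhi_add_int _ _
    rw [e]
    exact hk₁ ⟨Int.fract_nonneg k, (Int.fract_lt_one k).le⟩

/-! ### Riemann sums over the dual lattice -/

section
variable {L : ℕ} [NeZero L]

lemma exists_dualPt_intCast (j : ℤ) :
    ∃ z : ℤ, dualPt L (j : ZMod L) = (j : ℝ) / L + z := by
  have hL := natCast_pos_of_neZero (L := L)
  have h : (((j : ZMod L).valMinAbs - j : ℤ) : ZMod L) = 0 := by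
    push_cast [ZMod.coe_valMinAbs]; simp
  obtain ⟨z, hz⟩ := (ZMod.intCast_zmod_eq_zero_iff_dvd _ L).mp h
  refine ⟨z, ?_⟩
  have h2 : ((j : ZMod L).valMinAbs : ℝ) = j + L * z := by
    have := congrArg (fun i : ℤ => (i : ℝ)) hz
    push_cast at this
    linarith
  rw [dualPt, h2]; field_simp

lemma dualPt_intCast_of_periodic {f : ℝ → ℝ} (hf : ∀ (k : ℝ) (z : ℤ), f (k + z) = f k) (j : ℤ) :
    f (dualPt L (j : ZMod L)) = f (j / L) := by
  obtain ⟨z, hz⟩ := exists_dualPt_intCast (L := L) j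
  rw [hz, hf]

lemma dualPt_comb_of_periodic {f : ℝ → ℝ} (hf : ∀ (k : ℝ) (z : ℤ), f (k + z) = f k)
    (m n : ZMod L) (j : ℕ) :
    f (dualPt L (m + j * n)) = f (dualPt L m + j * dualPt L n) := by
  have e : m + j * n = ((m.valMinAbs + j * n.valMinAbs : ℤ) : ZMod L) := by
    push_cast [ZMod.coe_valMinAbs]; rfl
  rw [e, dualPt_intCast_of_periodic hf, dualPt, dualPt]
  congr 1; push_cast; ring

lemma dualPt_neg_of_periodic {f : ℝ → ℝ} (hf : ∀ (k : ℝ) (z : ℤ), f (k + z) = f k)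
    (n : ZMod L) : f (dualPt L (-n)) = f (-dualPt L n) := by
  have e : -n = ((-n.valMinAbs : ℤ) : ZMod L) := by
    push_cast [ZMod.coe_valMinAbs]; rfl
  rw [e, dualPt_intCast_of_periodic hf, dualPt]
  congr 1; push_cast; ring

lemma abs_dualPt_neg (n : ZMod L) : |dualPt L (-n)| = |dualPt L n| := by
  have hL := natCast_pos_of_neZero (L := L)
  unfold dualPt
  rw [abs_div, abs_div]
  congr 1
  have := ZMod.natAbs_valMinAbs_neg n
  rw [← Int.cast_abs, ← Int.cast_abs, Int.abs_eq_natAbs, Int.abs_eq_natAbs, this]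

lemma abs_dualPt_le (n : ZMod L) : |dualPt L n| ≤ 1 / 2 := by
  have hL := natCast_pos_of_neZero (L := L)
  have h := ZMod.natAbs_valMinAbs_le n
  unfold dualPt
  have h2 : 2 * n.valMinAbs.natAbs ≤ L := by omega
  have h3 : (2 : ℝ) * (n.valMinAbs.natAbs : ℝ) ≤ L := by exact_mod_cast h2
  rw [Nat.cast_natAbs, Int.cast_abs] at h3
  rw [abs_div, abs_of_pos hL, div_le_iff₀ hL]
  linarith

lemma sum_dualPt_eq_sum_range {f : ℝ → ℝ} (hf : ∀ (k : ℝ) (z : ℤ), f (k + z) = f k) :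
    ∑ m : ZMod L, f (dualPt L m) = ∑ j ∈ Finset.range L, f (j / L) := by
  refine Finset.sum_nbij' (fun m => m.val) (fun j => (j : ZMod L)) ?_ ?_ ?_ ?_ ?_
  · intro m _; exact Finset.mem_range.mpr (ZMod.val_lt m)
  · intro j _; exact Finset.mem_univ _
  · intro m _; exact ZMod.natCast_zmod_val m
  · intro j hj; exact ZMod.val_cast_of_lt (Finset.mem_range.mp hj)
  · intro m _
    have := dualPt_intCast_of_periodic (L := L) hf (m.val : ℤ)
    rw [Int.cast_natCast, ZMod.natCast_zmod_val] at this
    rw [this]; simp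

/-- Each of the $L$ cells of length $1/L$ contributes an error of at most $K/L$ times its length. -/
lemma abs_cavg_sub_integral_le {f : ℝ → ℝ} {K : ℝ} (hf : ∀ (k : ℝ) (z : ℤ), f (k + z) = f k)
    (hc : Continuous f) (hK : ∀ k k', |f k - f k'| ≤ K * |k - k'|) :
    |(cavg fun m : ZMod L => f (dualPt L m)) - ∫ k in (0 : ℝ)..1, f k| ≤ K / L := by
  have hL := natCast_pos_of_neZero (L := L)
  have hK0 : 0 ≤ K := by
    have := (abs_nonneg _).trans (hK 1 0)
    simpa using this
  have e1 : ∫ k in (0 : ℝ)..1, f k =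
      ∑ j ∈ Finset.range L, ∫ k in (j / L : ℝ)..((j + 1 : ℕ) / L : ℝ), f k := by
    rw [intervalIntegral.sum_integral_adjacent_intervals (a := fun j : ℕ => (j / L : ℝ))
      fun j _ => hc.intervalIntegrable _ _]
    simp [hL.ne']
  have e2 : (cavg fun m : ZMod L => f (dualPt L m)) =
      ∑ j ∈ Finset.range L, ∫ k in (j / L : ℝ)..((j + 1 : ℕ) / L : ℝ), f (j / L) := by
    rw [cavg, sum_dualPt_eq_sum_range hf, Finset.mul_sum]
    refine Finset.sum_congr rfl fun j _ => ?_
    rw [intervalIntegral.integral_const, smul_eq_mul]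
    congr 1; push_cast; field_simp; ring
  rw [e1, e2, ← Finset.sum_sub_distrib]
  have e3 : ∀ j ∈ Finset.range L,
      |(∫ k in (j / L : ℝ)..((j + 1 : ℕ) / L : ℝ), f (j / L)) -
        ∫ k in (j / L : ℝ)..((j + 1 : ℕ) / L : ℝ), f k| ≤ K / L * (1 / L) := by
    intro j _
    have hd : ((j + 1 : ℕ) / L : ℝ) - j / L = 1 / L := by push_cast; field_simp; ring
    have hle : (j / L : ℝ) ≤ ((j + 1 : ℕ) / L : ℝ) := by
      have : (0 : ℝ) < 1 / L := by positivity
      linarith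
    rw [← intervalIntegral.integral_sub (intervalIntegrable_const)
      (hc.intervalIntegrable _ _)]
    have := intervalIntegral.norm_integral_le_of_norm_le_const (a := (j / L : ℝ))
      (b := ((j + 1 : ℕ) / L : ℝ)) (f := fun k => f (j / L) - f k) (C := K / L) (fun k hk => by
        rw [uIoc_of_le hle] at hk
        refine (hK _ _).trans ?_
        rw [div_eq_mul_one_div K, abs_sub_comm, abs_of_nonneg (by linarith [hk.1])]
        gcongr
        linarith [hk.2])
    rwa [hd, abs_of_pos (by positivity : (0 : ℝ) < 1 / L)] at this
  calc _ ≤ ∑ j ∈ Finset.range L, K / L * (1 / (L : ℝ)) :=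
        (Finset.abs_sum_le_sum_abs _ _).trans (Finset.sum_le_sum e3)
    _ = K / L := by
        rw [Finset.sum_const, Finset.card_range, nsmul_eq_mul]; field_simp

end

/-- Squared frequencies on the dual lattice. -/
def freqSq (Φ : ℤ → ℝ) (L : ℕ) (n : ZMod L) : ℝ := hatPhi Φ (dualPt L n)

lemma PhiAssumption.isEvenFn_freqSq (h : PhiAssumption Φ) (L : ℕ) [NeZero L] :
    IsEvenFn (freqSq Φ L) := fun n => by
  rw [freqSq, dualPt_neg_of_periodic h.hatPhi_add_int, h.hatPhi_neg, freqSq]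

lemma PhiAssumption.freqSq_comb (h : PhiAssumption Φ) {L : ℕ} [NeZero L] (m n : ZMod L) (j : ℕ) :
    freqSq Φ L (m + j * n) = hatPhi Φ (dualPt L m + j * dualPt L n) :=
  dualPt_comb_of_periodic h.hatPhi_add_int m n j

lemma PhiAssumption.freqSq_add (h : PhiAssumption Φ) {L : ℕ} [NeZero L] (m n : ZMod L) :
    freqSq Φ L (m + n) = hatPhi Φ (dualPt L m + dualPt L n) := by
  simpa using h.freqSq_comb m n 1

/-- A shift by $jn$ is telescoped into $j$ shifts by $n$; Cauchy–Schwarz gives one factor $j$, and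
shift invariance of the average makes the $j$ terms equal. -/
lemma modeVar_natCast_mul_le {L : ℕ} [NeZero L] (v : ZMod L → ℝ) (n : ZMod L) (j : ℕ) :
    modeVar v (j * n) ≤ (j : ℝ) ^ 2 * modeVar v n := by
  have h1 : ∀ m, (v (m + j * n) - v m) ^ 2 ≤
      (j : ℝ) * ∑ i ∈ Finset.range j, (v (m + i * n + n) - v (m + i * n)) ^ 2 := by
    intro m
    have e : v (m + j * n) - v m =
        ∑ i ∈ Finset.range j, (v (m + i * n + n) - v (m + i * n)) := by
      have := Finset.sum_range_sub (fun i : ℕ => v (m + i * n)) j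
      simp only [Nat.cast_zero, zero_mul, add_zero] at this
      rw [← this]
      refine Finset.sum_congr rfl fun i _ => ?_
      push_cast; ring_nf
    rw [e]
    have := sq_sum_le_card_mul_sum_sq (s := Finset.range j)
      (f := fun i : ℕ => v (m + i * n + n) - v (m + i * n))
    simpa using this
  calc modeVar v (j * n) ≤ cavg fun m : ZMod L => (j : ℝ) *
        ∑ i ∈ Finset.range j, (v (m + i * n + n) - v (m + i * n)) ^ 2 := cavg_mono h1
    _ = (j : ℝ) * ∑ i ∈ Finset.range j,
        cavg fun m : ZMod L => (v (m + i * n + n) - v (m + i * n)) ^ 2 := by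
        rw [cavg_const_mul]
        congr 1
        simp only [cavg]
        rw [Finset.sum_comm, Finset.mul_sum]
    _ = _ := by
        have e : ∀ i : ℕ, (cavg fun m : ZMod L => (v (m + i * n + n) - v (m + i * n)) ^ 2) =
            modeVar v n := fun i => cavg_shift (fun m => (v (m + n) - v m) ^ 2) (i * n)
        simp only [e, Finset.sum_const, Finset.card_range, nsmul_eq_mul]
        ring

lemma PhiAssumption.exists_modeVar_le (h : PhiAssumption Φ) :
    ∃ Λ > 0, ∀ (L : ℕ) [NeZero L] (n : ZMod L),
      modeVar (freqSq Φ L) n ≤ Λ * dualPt L n ^ 2 := by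
  obtain ⟨Λ, hΛ, hl⟩ := h.exists_lipschitz
  refine ⟨Λ ^ 2, by positivity, fun L _ n => ?_⟩
  rw [modeVar, ← cavg_const (L := L) (Λ ^ 2 * _)]
  refine cavg_mono fun m => ?_
  rw [h.freqSq_add, freqSq]
  have := hl (dualPt L m + dualPt L n) (dualPt L m)
  rw [add_sub_cancel_left] at this
  rw [← sq_abs, ← sq_abs (dualPt L n), ← mul_pow]
  gcongr

/-- Mean square variation of the dispersion relation in infinite volume. -/
lemma GammaAssumption.exists_variation_ge {γ : ℝ} (h : GammaAssumption Φ γ) {ε : ℝ} (hε : 0 < ε) :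
    ∃ c > 0, ∀ k₀, ε ≤ |k₀| → |k₀| ≤ 1 / 2 →
      c ≤ ∫ k in (0 : ℝ)..1, (hatPhi Φ (k + k₀) - hatPhi Φ k) ^ 2 := by
  obtain ⟨v₀, v₁, ho, hv01, hv⟩ := h.exists_overdamped
  obtain ⟨Cε, hCε, hnd⟩ := h.nondegenerate ε hε
  have hr := ho.rate_pos
  have hB := ho.bound_pos
  have hcont := h.continuous_hatPhi
  set A := respBound γ v₁ ^ 4 * (2 / respRate γ v₀) ^ 2 with hA
  have hA0 : 0 < A := by positivity
  refine ⟨Cε / (A / respRate γ v₀), by positivity, fun k₀ h1 h2 => ?_⟩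
  have key := hnd k₀ h1 h2
  set W := ∫ k in (0 : ℝ)..1, (hatPhi Φ (k + k₀) - hatPhi Φ k) ^ 2 with hW
  -- The symmetric shift by $\pm k_0/2$ in the assumption becomes a one-sided shift by translating
  -- over a period.
  have hW2 : ∫ k in (-(1 / 2) : ℝ)..(1 / 2),
      (hatPhi Φ (k + k₀ / 2) - hatPhi Φ (k - k₀ / 2)) ^ 2 = W := by
    have hper : Function.Periodic (fun k => (hatPhi Φ (k + k₀) - hatPhi Φ k) ^ 2) 1 := by
      intro k
      have e1 := h.hatPhi_add_int (k + k₀) 1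
      have e2 := h.hatPhi_add_int k 1
      push_cast at e1 e2
      simp only [e2, show k + 1 + k₀ = k + k₀ + 1 by ring, e1]
    have e3 := intervalIntegral.integral_comp_sub_right (a := -(1 / 2)) (b := 1 / 2)
      (fun k => (hatPhi Φ (k + k₀) - hatPhi Φ k) ^ 2) (k₀ / 2)
    have e4 := hper.intervalIntegral_add_eq (-(1 / 2) - k₀ / 2) 0
    rw [show -(1 / 2) - k₀ / 2 + 1 = 1 / 2 - k₀ / 2 by ring, zero_add] at e4
    rw [hW, ← e4, ← e3]
    congr 1; funext k; congr 3; ring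
  -- The response is Lipschitz in the squared frequency with an exponentially decaying constant, so
  -- the assumed lower bound on responses passes to $\hat\Phi$.
  have hin : ∀ t, 0 ≤ t → ∫ k in (-(1 / 2) : ℝ)..(1 / 2),
      (hatA2 Φ γ t (k + k₀ / 2) - hatA2 Φ γ t (k - k₀ / 2)) ^ 2 ≤
        A * W * Real.exp (-respRate γ v₀ * t) := by
    intro t ht
    have e : A * W * Real.exp (-respRate γ v₀ * t) = ∫ k in (-(1 / 2) : ℝ)..(1 / 2),
        A * Real.exp (-respRate γ v₀ * t) *
          (hatPhi Φ (k + k₀ / 2) - hatPhi Φ (k - k₀ / 2)) ^ 2 := by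
      rw [intervalIntegral.integral_const_mul, hW2]; ring
    rw [e, intervalIntegral.integral_of_le (by norm_num), intervalIntegral.integral_of_le
      (by norm_num)]
    refine integral_mono_of_nonneg (ae_of_all _ fun k => sq_nonneg _) ?_
      (ae_of_all _ fun k => ?_)
    · exact (Continuous.integrableOn_Icc (by fun_prop)).mono_set Ioc_subset_Icc_self
    · simp only [h.hatA2_eq]
      refine (ho.sq_sub_respF_le (hv _) (hv _) ht).trans (le_of_eq ?_)
      rw [hA]; ring
  have hfin : ∫ t in Ioi (0 : ℝ), ∫ k in (-(1 / 2) : ℝ)..(1 / 2),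
      (hatA2 Φ γ t (k + k₀ / 2) - hatA2 Φ γ t (k - k₀ / 2)) ^ 2 ≤ A * W / respRate γ v₀ := by
    have e : A * W / respRate γ v₀ =
        ∫ t in Ioi (0 : ℝ), A * W * Real.exp (-respRate γ v₀ * t) := by
      rw [integral_const_mul, integral_Ioi_exp_neg_mul hr]; simp; ring
    rw [e]
    refine integral_mono_of_nonneg (ae_of_all _ fun t =>
      intervalIntegral.integral_nonneg (by norm_num) fun k _ => sq_nonneg _)
      ((exp_neg_integrableOn_Ioi 0 hr).const_mul _) ?_
    filter_upwards [ae_restrict_mem measurableSet_Ioi] with t ht using hin t (le_of_lt ht)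
  rw [div_le_iff₀ (by positivity)]
  calc Cε ≤ _ := key
    _ ≤ _ := hfin
    _ = _ := by ring

/-- For $|k|\ge\varepsilon$ the lattice average is close to its infinite volume integral once $L$ is
large; this is the origin of $L_0$. Smaller $k$ are multiplied by an integer $j$ until
$j|k|\ge\varepsilon$, and the quadratic growth of the variation in $j$ gives the factor $k^2$. -/
theorem GammaAssumption.exists_modeVar_ge {γ : ℝ} (h : GammaAssumption Φ γ) {ε : ℝ} (hε : 0 < ε)
    (hε' : ε ≤ 1 / 4) : ∃ L₀ : ℕ, ∃ c > 0, ∀ (L : ℕ) [NeZero L], L₀ ≤ L → ∀ n : ZMod L,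
      (ε ≤ |dualPt L n| → c ≤ modeVar (freqSq Φ L) n) ∧
      (|dualPt L n| ≤ ε → c * dualPt L n ^ 2 ≤ modeVar (freqSq Φ L) n) := by
  obtain ⟨v₀, v₁, ho, hv01, hv⟩ := h.exists_overdamped
  obtain ⟨c, hc, hge⟩ := h.exists_variation_ge hε
  obtain ⟨Λ, hΛ, hl⟩ := h.exists_lipschitz
  have hcont := h.continuous_hatPhi
  have hv0 := ho.pos
  have hv1 : 0 < v₁ := hv0.trans_le hv01
  have hdiff : ∀ k k', |hatPhi Φ k - hatPhi Φ k'| ≤ v₁ := fun k k' => by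
    rw [abs_le]; constructor <;> linarith [(hv k).1, (hv k).2, (hv k').1, (hv k').2]
  set K := 2 * v₁ * (2 * Λ) with hK
  have hK0 : 0 < K := by positivity
  obtain ⟨L₀, hL₀⟩ := exists_nat_gt (K / (c / 2))
  refine ⟨L₀, min (c / 2) (c / 2 / (4 * ε ^ 2)), lt_min (by positivity) (by positivity),
    fun L _ hL => ?_⟩
  have hLpos := natCast_pos_of_neZero (L := L)
  have hKL : K / L ≤ c / 2 := by
    rw [div_lt_iff₀ (by positivity)] at hL₀
    rw [div_le_iff₀ hLpos]
    have : (L₀ : ℝ) ≤ L := by exact_mod_cast hL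
    nlinarith
  have hfin : ∀ (k₀ : ℝ), ε ≤ |k₀| → |k₀| ≤ 1 / 2 →
      c / 2 ≤ cavg fun m : ZMod L =>
        (hatPhi Φ (dualPt L m + k₀) - hatPhi Φ (dualPt L m)) ^ 2 := by
    intro k₀ h1 h2
    have h3 := abs_cavg_sub_integral_le (L := L) (K := K)
      (f := fun k => (hatPhi Φ (k + k₀) - hatPhi Φ k) ^ 2) (fun k z => by
        simp only [h.hatPhi_add_int k z, show k + z + k₀ = k + k₀ + z by ring,
          h.hatPhi_add_int (k + k₀) z]) (by fun_prop) (fun k k' => by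
        rw [sq_sub_sq, abs_mul]
        refine (mul_le_mul ((abs_add_le _ _).trans (add_le_add (hdiff _ _) (hdiff _ _)))
          ?_ (abs_nonneg _) (by linarith)).trans (le_of_eq
            (show (v₁ + v₁) * (2 * Λ * |k - k'|) = _ by rw [hK]; ring))
        have a1 := hl (k + k₀) (k' + k₀)
        have a2 := hl k k'
        rw [add_sub_add_right_eq_sub] at a1
        calc _ = |(hatPhi Φ (k + k₀) - hatPhi Φ (k' + k₀)) - (hatPhi Φ k - hatPhi Φ k')| := by
              congr 1; ring
          _ ≤ _ := abs_sub _ _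
          _ ≤ Λ * |k - k'| + Λ * |k - k'| := add_le_add a1 a2
          _ = _ := by ring)
    have h4 := hge k₀ h1 h2
    have h5 := (abs_le.mp (h3.trans hKL)).1
    linarith
  have hcomb : ∀ (n : ZMod L) (j : ℕ), ε ≤ j * |dualPt L n| → j * |dualPt L n| ≤ 1 / 2 →
      c / 2 ≤ modeVar (freqSq Φ L) (j * n) := by
    intro n j h1 h2
    have e : |(j : ℝ) * dualPt L n| = j * |dualPt L n| := by rw [abs_mul, Nat.abs_cast]
    have := hfin (j * dualPt L n) (by rwa [e]) (by rwa [e])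
    refine this.trans (le_of_eq ?_)
    unfold modeVar
    congr 1; funext m
    rw [h.freqSq_comb, freqSq]
  intro n
  refine ⟨fun h1 => (min_le_left _ _).trans ?_, fun h1 => ?_⟩
  · simpa using hcomb n 1 (by simpa using h1) (by simpa using abs_dualPt_le n)
  · rcases eq_or_ne (dualPt L n) 0 with h0 | h0
    · rw [h0]; simpa using modeVar_nonneg _ _
    · have hpos : 0 < |dualPt L n| := abs_pos.mpr h0
      -- Then $\varepsilon\le j|k|\le2\varepsilon\le\frac12$, inside the range where the lower bound
      -- is available.
      set j := ⌈ε / |dualPt L n|⌉₊ with hj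
      have hj1 : ε ≤ j * |dualPt L n| := by
        rw [← div_le_iff₀ hpos]; exact Nat.le_ceil _
      have hj2 : j * |dualPt L n| ≤ 2 * ε := by
        have : (j : ℝ) < ε / |dualPt L n| + 1 := Nat.ceil_lt_add_one (by positivity)
        calc j * |dualPt L n| ≤ (ε / |dualPt L n| + 1) * |dualPt L n| := by gcongr
          _ = ε + |dualPt L n| := by field_simp
          _ ≤ _ := by linarith
      have h2 := hcomb n j hj1 (by linarith)
      have h3 := h2.trans (modeVar_natCast_mul_le (freqSq Φ L) n j)
      have hV := modeVar_nonneg (freqSq Φ L) n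
      have h4 : (j : ℝ) ^ 2 * dualPt L n ^ 2 ≤ 4 * ε ^ 2 := by
        rw [← sq_abs (dualPt L n), ← mul_pow]
        calc _ ≤ (2 * ε) ^ 2 := by gcongr
          _ = _ := by ring
      calc _ ≤ c / 2 / (4 * ε ^ 2) * dualPt L n ^ 2 := by gcongr; exact min_le_right _ _
        _ ≤ ((j : ℝ) ^ 2 * modeVar (freqSq Φ L) n) / (4 * ε ^ 2) * dualPt L n ^ 2 := by gcongr
        _ = (j : ℝ) ^ 2 * dualPt L n ^ 2 / (4 * ε ^ 2) * modeVar (freqSq Φ L) n := by ring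
        _ ≤ 1 * modeVar (freqSq Φ L) n := by
            gcongr
            rw [div_le_one (by positivity)]; exact h4
        _ = _ := one_mul _

end

/-! ### The damped harmonic dynamics -/

section
variable {Φ : ℤ → ℝ} {γ : ℝ} {L : ℕ} [NeZero L]

lemma PhiAssumption.phiMat_eq (h : PhiAssumption Φ) : phiMat L Φ = circ (freqSq Φ L) := by
  ext x y
  simp only [phiMat, Matrix.of_apply, circ_apply, invFT, h.omega_sq, freqSq]

/-- Block form of `e^{-tM_γ}`. -/
def expBlock (γ : ℝ) (v : ZMod L → ℝ) (t : ℝ) : Matrix (Coord L) (Coord L) ℝ :=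
  Matrix.fromBlocks (circ fun n => respF γ (v n) t + γ * respX γ (v n) t)
    (circ fun n => -(v n * respX γ (v n) t)) (circ fun n => respX γ (v n) t)
    (circ fun n => respF γ (v n) t)

omit [NeZero L] in
lemma IsEvenFn.comp {v : ZMod L → ℝ} (hv : IsEvenFn v) (F : ℝ → ℝ) : IsEvenFn fun n => F (v n) :=
  fun n => by simp only [hv n]

/-- All blocks are circulant, so the matrix differential equation reduces to the oscillator equation
for each symbol, and uniqueness identifies the exponential. -/
lemma expBlock_eq {v : ZMod L → ℝ} (hv : IsEvenFn v) (hlt : ∀ n, v n < (γ / 2) ^ 2) (t : ℝ) :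
    expBlock γ v t = NormedSpace.exp ((-t) • Matrix.fromBlocks 0 (circ v) (-1) (γ • 1)) := by
  have hB : -(Matrix.fromBlocks 0 (circ v) (-1) (γ • 1) : Matrix (Coord L) (Coord L) ℝ) =
      Matrix.fromBlocks 0 (-circ v) 1 (-(γ • 1)) := by
    rw [Matrix.fromBlocks_neg]; simp
  rw [neg_smul, ← smul_neg, hB]
  refine eq_exp_of_hasDerivAt ?_ ?_ t
  · simp only [expBlock, respX_zero, respF_zero (hlt _), mul_zero, add_zero, neg_zero, circ_one,
      circ_zero, Matrix.fromBlocks_one]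
  · intro t i j
    have hX : IsEvenFn fun n => respX γ (v n) t := hv.comp fun v => respX γ v t
    have hF : IsEvenFn fun n => respF γ (v n) t := hv.comp fun v => respF γ v t
    have e : Matrix.fromBlocks 0 (-circ v) 1 (-(γ • 1)) * expBlock γ v t =
        Matrix.fromBlocks (circ fun n => -(v n * respX γ (v n) t))
          (circ fun n => -(v n * respF γ (v n) t)) (circ fun n => respF γ (v n) t)
          (circ fun n => -γ * respF γ (v n) t - v n * respX γ (v n) t) := by
      rw [expBlock, Matrix.fromBlocks_multiply]
      simp only [Matrix.zero_mul, zero_add, one_mul, Matrix.neg_mul, Matrix.smul_mul,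
        circ_mul hv hX, circ_mul hv hF]
      simp only [circ_smul, circ_neg, circ_add]
      congr 2 <;> funext n <;> ring
    rw [e]
    rcases i with i | i <;> rcases j with j | j
    · exact hasDerivAt_circ (f := fun t n => respF γ (v n) t + γ * respX γ (v n) t)
        (f' := fun t n => -(v n * respX γ (v n) t)) (fun n => ((hasDerivAt_respF (hlt n) t).add
        ((hasDerivAt_respX γ (v n) t).const_mul γ)).congr_deriv (by ring)) i j
    · exact hasDerivAt_circ (f := fun t n => -(v n * respX γ (v n) t))
        (f' := fun t n => -(v n * respF γ (v n) t))
        (fun n => ((hasDerivAt_respX γ (v n) t).const_mul (v n)).neg) i j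
    · exact hasDerivAt_circ (f := fun t n => respX γ (v n) t)
        (f' := fun t n => respF γ (v n) t) (fun n => hasDerivAt_respX γ (v n) t) i j
    · exact hasDerivAt_circ (f := fun t n => respF γ (v n) t)
        (f' := fun t n => -γ * respF γ (v n) t - v n * respX γ (v n) t)
        (fun n => hasDerivAt_respF (hlt n) t) i j

omit [NeZero L] in
lemma GammaAssumption.freqSq_lt (h : GammaAssumption Φ γ) (n : ZMod L) :
    freqSq Φ L n < (γ / 2) ^ 2 := by
  have := h.noise_dominates (dualPt L n)
  unfold freqSq; linarith

lemma GammaAssumption.exp_mMat (h : GammaAssumption Φ γ) (t : ℝ) :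
    NormedSpace.exp ((-t) • mMat L Φ γ) = expBlock γ (freqSq Φ L) t := by
  rw [mMat, h.phiMat_eq, expBlock_eq (h.isEvenFn_freqSq L) h.freqSq_lt]

lemma GammaAssumption.isEvenFn_respF (h : GammaAssumption Φ γ) (t : ℝ) :
    IsEvenFn fun n : ZMod L => respF γ (freqSq Φ L n) t :=
  (h.isEvenFn_freqSq L).comp fun v => respF γ v t

lemma GammaAssumption.memKernel_eq (h : GammaAssumption Φ γ) (t : ℝ) (x : ZMod L) :
    (memKernel L Φ γ t x : ℂ) = 2 * γ *
      (invFT (fun n => respF γ (freqSq Φ L n) t) x * invFT (fun n => respF γ (freqSq Φ L n) t) x) := by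
  have he := h.isEvenFn_respF (L := L) t
  rw [memKernel, a2, h.exp_mMat, expBlock, Matrix.fromBlocks_apply₂₂, circ_apply, sub_zero]
  push_cast
  rw [ofReal_re_invFT he, invFT_neg he, pow_two]

lemma GammaAssumption.memKernel_neg (h : GammaAssumption Φ γ) (t : ℝ) (x : ZMod L) :
    memKernel L Φ γ t (-x) = memKernel L Φ γ t x := by
  have := h.memKernel_eq t (-x)
  rw [invFT_neg (h.isEvenFn_respF t), ← h.memKernel_eq] at this
  exact_mod_cast this

lemma GammaAssumption.memKernel_nonneg (h : GammaAssumption Φ γ) (t : ℝ) (x : ZMod L) :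
    0 ≤ memKernel L Φ γ t x := by
  have := h.gamma_pos
  unfold memKernel; positivity

/-- The kernel is $2\gamma$ times the square of an inverse transform, so its modes are correlations
of the even symbol with itself. In particular they are real. -/
lemma GammaAssumption.dFT_memKernel (h : GammaAssumption Φ γ) (t : ℝ) (n : ZMod L) :
    dFT (memKernel L Φ γ t) n = (modeKernel γ (freqSq Φ L) n t : ℂ) := by
  have he := h.isEvenFn_respF (L := L) t
  have e : dFT (memKernel L Φ γ t) n = 2 * γ * ∑ y,
      invFT (fun n => respF γ (freqSq Φ L n) t) y *
        invFT (fun n => respF γ (freqSq Φ L n) t) y * wave L n y := by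
    rw [dFT, Finset.mul_sum]
    refine Fintype.sum_equiv (Equiv.neg _) _ _ fun y => ?_
    rw [Equiv.neg_apply, h.memKernel_eq, invFT_neg he]; ring
  rw [e, sum_invFT_mul_wave he, modeKernel, cavg]
  push_cast; rfl

lemma GammaAssumption.cosKernel_eq (h : GammaAssumption Φ γ) (t : ℝ) (n : ZMod L) :
    cosKernel L Φ γ t n = modeKernel γ (freqSq Φ L) n t := by
  have h1 := congrArg Complex.re (h.dFT_memKernel t n)
  rw [Complex.ofReal_re] at h1
  rw [← h1, dFT, Complex.re_sum, cosKernel]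
  refine Finset.sum_congr rfl fun y _ => ?_
  rw [mul_comm (wave L n (-y)), Complex.re_ofReal_mul, wave_neg_right, Complex.conj_re, wave_re]

lemma GammaAssumption.sum_memKernel (h : GammaAssumption Φ γ) (t : ℝ) :
    ∑ y : ZMod L, memKernel L Φ γ t y = modeKernel γ (freqSq Φ L) 0 t := by
  have := h.dFT_memKernel (L := L) t 0
  rw [dFT_zero] at this
  exact_mod_cast this

lemma GammaAssumption.memKernel_le (h : GammaAssumption Φ γ) (t : ℝ) (x : ZMod L) :
    memKernel L Φ γ t x ≤ modeKernel γ (freqSq Φ L) 0 t := by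
  rw [← h.sum_memKernel]
  exact Finset.single_le_sum (fun y _ => h.memKernel_nonneg t y) (Finset.mem_univ x)

lemma continuous_expBlock (γ : ℝ) (v : ZMod L → ℝ) (i j : Coord L) :
    Continuous fun t => expBlock γ v t i j := by
  have hc : ∀ (f : ℝ → ZMod L → ℝ), (∀ n, Continuous fun t => f t n) → ∀ x y,
      Continuous fun t => circ (f t) x y := by
    intro f hf x y
    simp only [circ_re]
    exact continuous_cavg fun n => continuous_const.mul (hf n)
  rcases i with i | i <;> rcases j with j | j <;>
    simp only [expBlock, Matrix.fromBlocks_apply₁₁, Matrix.fromBlocks_apply₁₂,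
      Matrix.fromBlocks_apply₂₁, Matrix.fromBlocks_apply₂₂]
  · exact hc _ (fun n => (continuous_respF _ _).add (continuous_const.mul (continuous_respX _ _))) i j
  · exact hc _ (fun n => (continuous_const.mul (continuous_respX _ _)).neg) i j
  · exact hc _ (fun n => continuous_respX _ _) i j
  · exact hc _ (fun n => continuous_respF _ _) i j

lemma GammaAssumption.continuous_memKernel (h : GammaAssumption Φ γ) (x : ZMod L) :
    Continuous fun t => memKernel L Φ γ t x := by
  have h1 := continuous_expBlock γ (freqSq Φ L) (Sum.inr (-x)) (Sum.inr 0)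
  have e : (fun t => memKernel L Φ γ t x) =
      fun t => 2 * γ * expBlock γ (freqSq Φ L) t (Sum.inr (-x)) (Sum.inr 0) ^ 2 := by
    funext t; rw [memKernel, a2, h.exp_mMat]
  rw [e]; fun_prop

/-! ### The source term -/

/-- Momentum field at time `t` of the damped dynamics started at `X`. -/
def momentum (γ : ℝ) (v : ZMod L → ℝ) (t : ℝ) (X : Phase L) : ZMod L → ℝ :=
  circ (fun n => -(v n * respX γ (v n) t)) *ᵥ (fun y => X (Sum.inl y)) +
    circ (fun n => respF γ (v n) t) *ᵥ (fun y => X (Sum.inr y))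

lemma momentum_eq_sum {v : ZMod L → ℝ} (hv : IsEvenFn v) (t : ℝ) (X : Phase L) (x : ZMod L) :
    momentum γ v t X x =
      ∑ j, expBlock γ v t j (Sum.inr 0) * X (Sum.map (x + ·) (x + ·) j) := by
  have key : ∀ (f : ZMod L → ℝ), IsEvenFn f → ∀ a : ZMod L → ℝ,
      (circ f *ᵥ a) x = ∑ y, circ f y 0 * a (x + y) := by
    intro f hf a
    simp only [Matrix.mulVec, dotProduct]
    symm
    refine Fintype.sum_equiv (Equiv.addLeft x) _ _ fun y => ?_
    simp only [Equiv.coe_addLeft]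
    rw [circ_apply, circ_apply, ← invFT_neg hf]
    congr 3; ring
  have h1 : IsEvenFn fun n => -(v n * respX γ (v n) t) := hv.comp fun v => -(v * respX γ v t)
  have h2 : IsEvenFn fun n => respF γ (v n) t := hv.comp fun v => respF γ v t
  rw [momentum, Pi.add_apply, key _ h1, key _ h2, Fintype.sum_sum_type]
  rfl

variable {μ₀ : Measure (Phase L)}

lemma GammaAssumption.source_eq_sum (h : GammaAssumption Φ γ) (t : ℝ) (x : ZMod L) :
    source L Φ γ μ₀ t x = ∑ j', ∑ j, expBlock γ (freqSq Φ L) t j' (Sum.inr 0) *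
      expBlock γ (freqSq Φ L) t j (Sum.inr 0) * gammaMat L μ₀ x j' j := by
  have e : (-t) • (mMat L Φ γ)ᵀ = ((-t) • mMat L Φ γ)ᵀ := by rw [Matrix.transpose_smul]
  rw [source, e, Matrix.exp_transpose, h.exp_mMat, Matrix.mul_apply, Finset.sum_comm]
  refine Finset.sum_congr rfl fun j _ => ?_
  rw [Matrix.mul_apply, Finset.sum_mul]
  refine Finset.sum_congr rfl fun j' _ => ?_
  rw [Matrix.transpose_apply]; ring

lemma GammaAssumption.continuous_source (h : GammaAssumption Φ γ) (x : ZMod L) :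
    Continuous fun t => source L Φ γ μ₀ t x := by
  simp only [h.source_eq_sum]
  exact continuous_finsetSum _ fun j' _ => continuous_finsetSum _ fun j _ =>
    ((continuous_expBlock γ _ j' _).mul (continuous_expBlock γ _ j _)).mul continuous_const

/-- The source is the mean square momentum of the damped dynamics without flips, hence nonnegative
and controlled by the initial energy. -/
lemma GammaAssumption.source_eq_integral (h : GammaAssumption Φ γ) (hμ : HasSecondMoments L μ₀)
    (t : ℝ) (x : ZMod L) :
    source L Φ γ μ₀ t x = ∫ X, momentum γ (freqSq Φ L) t X x ^ 2 ∂μ₀ := by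
  have e : ∀ X : Phase L, momentum γ (freqSq Φ L) t X x ^ 2 = ∑ j', ∑ j,
      expBlock γ (freqSq Φ L) t j' (Sum.inr 0) * expBlock γ (freqSq Φ L) t j (Sum.inr 0) *
        (X (Sum.map (x + ·) (x + ·) j') * X (Sum.map (x + ·) (x + ·) j)) := by
    intro X
    rw [momentum_eq_sum (h.isEvenFn_freqSq L), pow_two, Finset.sum_mul_sum]
    refine Finset.sum_congr rfl fun j' _ => Finset.sum_congr rfl fun j _ => ?_
    ring
  simp only [e, h.source_eq_sum]
  rw [integral_finsetSum _ fun j' _ => integrable_finsetSum _ fun j _ => (hμ _ _).const_mul _]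
  refine Finset.sum_congr rfl fun j' _ => ?_
  rw [integral_finsetSum _ fun j _ => (hμ _ _).const_mul _]
  refine Finset.sum_congr rfl fun j _ => ?_
  rw [integral_const_mul]; rfl

lemma GammaAssumption.source_nonneg (h : GammaAssumption Φ γ) (hμ : HasSecondMoments L μ₀)
    (t : ℝ) (x : ZMod L) : 0 ≤ source L Φ γ μ₀ t x := by
  rw [h.source_eq_integral hμ]
  exact integral_nonneg fun X => sq_nonneg _

lemma HasSecondMoments.integrable_circForm (hμ : HasSecondMoments L μ₀) (f : ZMod L → ℝ)
    (a b : ZMod L → Coord L) :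
    Integrable (fun X => circForm f (fun y => X (a y)) (fun y => X (b y))) μ₀ := by
  simp only [circForm, dotProduct, Matrix.mulVec, Finset.mul_sum]
  refine integrable_finsetSum _ fun x _ => integrable_finsetSum _ fun y _ => ?_
  refine ((hμ (a x) (b y)).const_mul (circ f x y)).congr (ae_of_all _ fun X => ?_)
  simp only []
  ring

lemma GammaAssumption.hamiltonian_eq (h : GammaAssumption Φ γ) (X : Phase L) :
    hamiltonian L Φ X = 1 / 2 * (circForm (fun _ => 1) (fun y => X (Sum.inr y)) (fun y => X (Sum.inr y)) +
      circForm (freqSq Φ L) (fun y => X (Sum.inl y)) (fun y => X (Sum.inl y))) := by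
  rw [hamiltonian, circForm, circ_one, Matrix.one_mulVec, mul_add, h.phiMat_eq]
  simp only [circForm, dotProduct, Matrix.mulVec, Finset.mul_sum]
  congr 1
  · refine Finset.sum_congr rfl fun x _ => ?_
    ring
  · refine Finset.sum_congr rfl fun x _ => Finset.sum_congr rfl fun y _ => ?_
    ring

lemma GammaAssumption.integrable_hamiltonian (h : GammaAssumption Φ γ)
    (hμ : HasSecondMoments L μ₀) : Integrable (hamiltonian L Φ) μ₀ := by
  have e : hamiltonian L Φ = _ := funext h.hamiltonian_eq
  rw [e]
  exact ((hμ.integrable_circForm _ Sum.inr Sum.inr).add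
    (hμ.integrable_circForm _ Sum.inl Sum.inl)).const_mul _

lemma GammaAssumption.sum_momentum_sq (h : GammaAssumption Φ γ) (t : ℝ) (X : Phase L) :
    ∑ x, momentum γ (freqSq Φ L) t X x ^ 2 =
      circForm (fun n => freqSq Φ L n ^ 2 * (respX γ (freqSq Φ L n) t * respX γ (freqSq Φ L n) t))
        (fun y => X (Sum.inl y)) (fun y => X (Sum.inl y)) +
      2 * circForm (fun n => -(freqSq Φ L n * (respF γ (freqSq Φ L n) t * respX γ (freqSq Φ L n) t)))
        (fun y => X (Sum.inl y)) (fun y => X (Sum.inr y)) +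
      circForm (fun n => respF γ (freqSq Φ L n) t * respF γ (freqSq Φ L n) t)
        (fun y => X (Sum.inr y)) (fun y => X (Sum.inr y)) := by
  have hv := h.isEvenFn_freqSq L
  have h1 : IsEvenFn fun n : ZMod L => -(freqSq Φ L n * respX γ (freqSq Φ L n) t) :=
    hv.comp fun v => -(v * respX γ v t)
  have h2 : IsEvenFn fun n : ZMod L => respF γ (freqSq Φ L n) t := hv.comp fun v => respF γ v t
  have e : ∑ x, momentum γ (freqSq Φ L) t X x ^ 2 =
      momentum γ (freqSq Φ L) t X ⬝ᵥ momentum γ (freqSq Φ L) t X := by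
    simp only [dotProduct, pow_two]
  rw [e, momentum, add_dotProduct, dotProduct_add, dotProduct_add, circForm_mulVec h1 h1,
    circForm_mulVec h1 h2, circForm_mulVec h2 h2, dotProduct_comm (circ _ *ᵥ _) (circ _ *ᵥ _),
    circForm_mulVec h1 h2]
  have e1 : (fun n => -(freqSq Φ L n * respX γ (freqSq Φ L n) t) *
      -(freqSq Φ L n * respX γ (freqSq Φ L n) t)) = fun n => freqSq Φ L n ^ 2 *
        (respX γ (freqSq Φ L n) t * respX γ (freqSq Φ L n) t) := by funext n; ring
  have e2 : (fun n => -(freqSq Φ L n * respX γ (freqSq Φ L n) t) * respF γ (freqSq Φ L n) t) =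
      fun n => -(freqSq Φ L n * (respF γ (freqSq Φ L n) t * respX γ (freqSq Φ L n) t)) := by
    funext n; ring
  rw [e1, e2]; ring

/-- The symbols are compared pointwise: positions enter with $v^2X^2\le v\cdot v_1X^2$, so the
potential energy appears. The factor $4$ combines $(a+b)^2\le2a^2+2b^2$ with the $\frac12$ in the
Hamiltonian. -/
lemma GammaAssumption.sum_momentum_sq_le (h : GammaAssumption Φ γ) {v₀ v₁ : ℝ}
    (ho : Overdamped γ v₀ v₁) (hv : ∀ k, hatPhi Φ k ∈ Icc v₀ v₁) {t : ℝ} (ht : 0 ≤ t)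
    (X : Phase L) : ∑ x, momentum γ (freqSq Φ L) t X x ^ 2 ≤
      4 * respBound γ v₁ ^ 2 * (1 + v₁) * Real.exp (-(2 * respRate γ v₀) * t) *
        hamiltonian L Φ X := by
  have hvL : ∀ n : ZMod L, freqSq Φ L n ∈ Icc v₀ v₁ := fun n => hv _
  have hv0 := ho.pos
  have hv1 : 0 < v₁ := hv0.trans_le ((hv 0).1.trans (hv 0).2)
  have hev := h.isEvenFn_freqSq L
  have h1 : IsEvenFn fun n : ZMod L => -(freqSq Φ L n * respX γ (freqSq Φ L n) t) :=
    hev.comp fun v => -(v * respX γ v t)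
  have h2 : IsEvenFn fun n : ZMod L => respF γ (freqSq Φ L n) t := hev.comp fun v => respF γ v t
  set D := respBound γ v₁ ^ 2 * Real.exp (-(2 * respRate γ v₀) * t) with hD
  have hD0 : 0 ≤ D := by positivity
  have b1 : (circ (fun n => -(freqSq Φ L n * respX γ (freqSq Φ L n) t)) *ᵥ fun y => X (Sum.inl y)) ⬝ᵥ
      (circ (fun n => -(freqSq Φ L n * respX γ (freqSq Φ L n) t)) *ᵥ fun y => X (Sum.inl y)) ≤
      D * v₁ * circForm (freqSq Φ L) (fun y => X (Sum.inl y)) (fun y => X (Sum.inl y)) := by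
    rw [circForm_mulVec h1 h1, ← circForm_smul]
    refine circForm_mono (fun n => by simp only [hev n]) (fun n => by simp only [hev n]) (fun n => ?_) _
    have hX := (le_abs_self _).trans (ho.abs_XX_le (hvL n) ht)
    have hn := hvL n
    have hn0 : 0 < freqSq Φ L n := hv0.trans_le hn.1
    calc _ = freqSq Φ L n * (freqSq Φ L n *
          (respX γ (freqSq Φ L n) t * respX γ (freqSq Φ L n) t)) := by ring
      _ ≤ freqSq Φ L n * (v₁ * D) := by
          refine mul_le_mul_of_nonneg_left (mul_le_mul hn.2 hX (mul_self_nonneg _) hv1.le) hn0.le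
      _ = _ := by ring
  have b2 : (circ (fun n => respF γ (freqSq Φ L n) t) *ᵥ fun y => X (Sum.inr y)) ⬝ᵥ
      (circ (fun n => respF γ (freqSq Φ L n) t) *ᵥ fun y => X (Sum.inr y)) ≤
      D * circForm (fun _ : ZMod L => 1) (fun y => X (Sum.inr y)) (fun y => X (Sum.inr y)) := by
    rw [circForm_mulVec h2 h2, ← circForm_smul]
    refine circForm_mono (fun n => by simp only [hev n]) (fun n => rfl) (fun n => ?_) _
    rw [mul_one]
    exact (le_abs_self _).trans (ho.abs_FF_le (hvL n) (hvL n) ht)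
  have b3 : ∑ x, momentum γ (freqSq Φ L) t X x ^ 2 ≤
      2 * ((circ (fun n => -(freqSq Φ L n * respX γ (freqSq Φ L n) t)) *ᵥ fun y => X (Sum.inl y)) ⬝ᵥ
      (circ (fun n => -(freqSq Φ L n * respX γ (freqSq Φ L n) t)) *ᵥ fun y => X (Sum.inl y))) +
      2 * ((circ (fun n => respF γ (freqSq Φ L n) t) *ᵥ fun y => X (Sum.inr y)) ⬝ᵥ
      (circ (fun n => respF γ (freqSq Φ L n) t) *ᵥ fun y => X (Sum.inr y))) := by
    simp only [dotProduct, Finset.mul_sum, ← Finset.sum_add_distrib]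
    refine Finset.sum_le_sum fun x _ => ?_
    simp only [momentum, Pi.add_apply]
    nlinarith [sq_nonneg ((circ (fun n => -(freqSq Φ L n * respX γ (freqSq Φ L n) t)) *ᵥ
      fun y => X (Sum.inl y)) x - (circ (fun n => respF γ (freqSq Φ L n) t) *ᵥ
        fun y => X (Sum.inr y)) x)]
  have c1 : 0 ≤ circForm (freqSq Φ L) (fun y => X (Sum.inl y)) (fun y => X (Sum.inl y)) := by
    rw [circForm_self hev]
    exact cavg_nonneg fun n => mul_nonneg (hv0.le.trans (hvL n).1) (sq_nonneg _)
  have c2 : 0 ≤ circForm (fun _ : ZMod L => 1) (fun y => X (Sum.inr y)) (fun y => X (Sum.inr y)) := by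
    rw [circForm_self (fun n => rfl)]
    exact cavg_nonneg fun n => mul_nonneg zero_le_one (sq_nonneg _)
  rw [h.hamiltonian_eq]
  have e : 4 * respBound γ v₁ ^ 2 * (1 + v₁) * Real.exp (-(2 * respRate γ v₀) * t) =
      4 * D * (1 + v₁) := by rw [hD]; ring
  rw [e]
  have d1 := mul_nonneg hD0 c1
  have d2 := mul_nonneg (mul_nonneg hD0 hv1.le) c2
  nlinarith

lemma energyDensity_mul : (L : ℝ) * energyDensity L Φ μ₀ = ∫ X, hamiltonian L Φ X ∂μ₀ := by
  have := natCast_pos_of_neZero (L := L)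
  rw [energyDensity]; field_simp

lemma GammaAssumption.integrable_momentum_sq (h : GammaAssumption Φ γ)
    (hμ : HasSecondMoments L μ₀) (t : ℝ) (x : ZMod L) :
    Integrable (fun X => momentum γ (freqSq Φ L) t X x ^ 2) μ₀ := by
  simp only [momentum_eq_sum (h.isEvenFn_freqSq L), pow_two, Finset.sum_mul_sum]
  refine integrable_finsetSum _ fun j' _ => integrable_finsetSum _ fun j _ => ?_
  refine ((hμ (Sum.map (x + ·) (x + ·) j') (Sum.map (x + ·) (x + ·) j)).const_mul
    (expBlock γ (freqSq Φ L) t j' (Sum.inr 0) *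
      expBlock γ (freqSq Φ L) t j (Sum.inr 0))).congr (ae_of_all _ fun X => ?_)
  simp only []
  ring

lemma GammaAssumption.sum_source_eq (h : GammaAssumption Φ γ) (hμ : HasSecondMoments L μ₀)
    (t : ℝ) : ∑ x, source L Φ γ μ₀ t x = ∫ X, ∑ x, momentum γ (freqSq Φ L) t X x ^ 2 ∂μ₀ := by
  rw [integral_finsetSum _ fun x _ => h.integrable_momentum_sq hμ t x]
  simp only [h.source_eq_integral hμ]

lemma GammaAssumption.sum_source_le (h : GammaAssumption Φ γ) {v₀ v₁ : ℝ}
    (ho : Overdamped γ v₀ v₁) (hv : ∀ k, hatPhi Φ k ∈ Icc v₀ v₁) (hμ : HasSecondMoments L μ₀)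
    {t : ℝ} (ht : 0 ≤ t) : ∑ x, source L Φ γ μ₀ t x ≤
      4 * respBound γ v₁ ^ 2 * (1 + v₁) * (L * energyDensity L Φ μ₀) *
        Real.exp (-(2 * respRate γ v₀) * t) := by
  rw [h.sum_source_eq hμ, energyDensity_mul]
  calc _ ≤ ∫ X, 4 * respBound γ v₁ ^ 2 * (1 + v₁) * Real.exp (-(2 * respRate γ v₀) * t) *
        hamiltonian L Φ X ∂μ₀ :=
        integral_mono (integrable_finsetSum _ fun x _ => h.integrable_momentum_sq hμ t x)
          ((h.integrable_hamiltonian hμ).const_mul _) fun X => h.sum_momentum_sq_le ho hv ht X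
    _ = _ := by rw [integral_const_mul]; ring

lemma GammaAssumption.energyDensity_nonneg (h : GammaAssumption Φ γ) :
    0 ≤ energyDensity L Φ μ₀ := by
  have hL := natCast_pos_of_neZero (L := L)
  obtain ⟨v₀, v₁, ho, _, hv⟩ := h.exists_overdamped
  refine mul_nonneg (by positivity) (integral_nonneg fun X => ?_)
  rw [Pi.zero_apply, h.hamiltonian_eq, circForm_self (h.isEvenFn_freqSq L),
    circForm_self (fun n => rfl)]
  refine mul_nonneg (by norm_num) (add_nonneg (cavg_nonneg fun n => ?_) (cavg_nonneg fun n => ?_))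
  · positivity
  · exact mul_nonneg (ho.pos.le.trans (hv _).1) (sq_nonneg _)

/-- The total source equals the total energy divided by `γ`. -/
lemma GammaAssumption.integral_sum_source (h : GammaAssumption Φ γ)
    (hμ : HasSecondMoments L μ₀) :
    γ * ∫ t in Ioi (0 : ℝ), ∑ x, source L Φ γ μ₀ t x = L * energyDensity L Φ μ₀ := by
  obtain ⟨v₀, v₁, ho, _, hv⟩ := h.exists_overdamped
  have hvL : ∀ n : ZMod L, freqSq Φ L n ∈ Icc v₀ v₁ := fun n => hv _
  have hγ := h.gamma_pos
  have hev := h.isEvenFn_freqSq L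
  have avg : ∀ (f : ZMod L → ℝ) (a b : ZMod L → Coord L),
      ∫ X, circForm f (fun y => X (a y)) (fun y => X (b y)) ∂μ₀ =
        ∑ x, ∑ y, circ f x y * ∫ X, X (a x) * X (b y) ∂μ₀ := by
    intro f a b
    have e : ∀ X : Phase L, circForm f (fun y => X (a y)) (fun y => X (b y)) =
        ∑ x, ∑ y, circ f x y * (X (a x) * X (b y)) := by
      intro X
      simp only [circForm, dotProduct, Matrix.mulVec, Finset.mul_sum]
      exact Finset.sum_congr rfl fun x _ => Finset.sum_congr rfl fun y _ => by ring
    have hi : ∀ x y, Integrable (fun X : Phase L => circ f x y * (X (a x) * X (b y))) μ₀ :=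
      fun x y => (hμ (a x) (b y)).const_mul _
    simp only [e]
    rw [integral_finsetSum _ fun x _ => integrable_finsetSum _ fun y _ => hi x y]
    refine Finset.sum_congr rfl fun x _ => ?_
    rw [integral_finsetSum _ fun y _ => hi x y]
    exact Finset.sum_congr rfl fun y _ => by rw [integral_const_mul]
  -- Time integration acts on the symbols only; the second moments of the initial field are constant
  -- weights.
  have tint : ∀ (f : ℝ → ℝ → ℝ) (F : ℝ → ℝ) (W : ZMod L → ZMod L → ℝ),
      (∀ v ∈ Icc v₀ v₁, IntegrableOn (fun t => f v t) (Ioi 0)) →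
      (∀ v ∈ Icc v₀ v₁, ∫ t in Ioi (0 : ℝ), f v t = F v) →
      IntegrableOn (fun t => ∑ x, ∑ y, circ (fun n => f (freqSq Φ L n) t) x y * W x y) (Ioi 0) ∧
      ∫ t in Ioi (0 : ℝ), ∑ x, ∑ y, circ (fun n => f (freqSq Φ L n) t) x y * W x y =
        ∑ x, ∑ y, circ (fun n => F (freqSq Φ L n)) x y * W x y := by
    intro f F W hi hF
    have hic : ∀ x y : ZMod L, IntegrableOn
        (fun t => circ (fun n => f (freqSq Φ L n) t) x y * W x y) (Ioi 0) := by
      intro x y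
      simp only [circ_re]
      exact (integrableOn_cavg fun n => (hi _ (hvL n)).const_mul _).mul_const _
    refine ⟨integrable_finsetSum _ fun x _ => integrable_finsetSum _ fun y _ => hic x y, ?_⟩
    rw [integral_finsetSum _ fun x _ => integrable_finsetSum _ fun y _ => hic x y]
    refine Finset.sum_congr rfl fun x _ => ?_
    rw [integral_finsetSum _ fun y _ => hic x y]
    refine Finset.sum_congr rfl fun y _ => ?_
    rw [integral_mul_const]
    simp only [circ_re]
    rw [integral_cavg fun n => (hi _ (hvL n)).const_mul _]
    congr 2; funext n
    rw [integral_const_mul, hF _ (hvL n)]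
  have iFX : ∀ v ∈ Icc v₀ v₁, IntegrableOn (fun t => respF γ v t * respX γ v t) (Ioi 0) :=
    fun v hv => integrableOn_Ioi_of_exp_bound (by linarith [ho.rate_pos])
      ((continuous_respF γ v).mul (continuous_respX γ v)) (fun s hs => ho.abs_FX_le hv hs)
  -- After integration the position symbol is $v/(2\gamma)$, the mixed one vanishes and the momentum
  -- one is $1/(2\gamma)$: the Hamiltonian divided by $\gamma$.
  obtain ⟨i1, t1⟩ := tint (fun v t => v ^ 2 * (respX γ v t * respX γ v t))
    (fun v => 1 / (2 * γ) * v) (fun x y => ∫ X, X (Sum.inl x) * X (Sum.inl y) ∂μ₀)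
    (fun v hv => (ho.integrableOn_XX hv).const_mul _) (fun v hv => by
      have := ho.integral_XX hv
      rw [integral_const_mul] at this ⊢
      calc _ = v * (v * ∫ t in Ioi (0 : ℝ), respX γ v t * respX γ v t) := by ring
        _ = _ := by rw [this]; ring)
  obtain ⟨i2, t2⟩ := tint (fun v t => -(v * (respF γ v t * respX γ v t)))
    (fun v => 0) (fun x y => ∫ X, X (Sum.inl x) * X (Sum.inr y) ∂μ₀)
    (fun v hv => ((iFX v hv).const_mul _).neg) (fun v hv => by
      rw [integral_neg, integral_const_mul, ho.integral_FX hv]; simp)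
  obtain ⟨i3, t3⟩ := tint (fun v t => respF γ v t * respF γ v t)
    (fun v => 1 / (2 * γ) * 1) (fun x y => ∫ X, X (Sum.inr x) * X (Sum.inr y) ∂μ₀)
    (fun v hv => ho.integrableOn_FF hv hv) (fun v hv => by rw [ho.integral_FF hv, mul_one])
  have key : ∀ t, ∑ x, source L Φ γ μ₀ t x =
      (∑ x, ∑ y, circ (fun n => freqSq Φ L n ^ 2 *
        (respX γ (freqSq Φ L n) t * respX γ (freqSq Φ L n) t)) x y *
          ∫ X, X (Sum.inl x) * X (Sum.inl y) ∂μ₀) +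
      2 * (∑ x, ∑ y, circ (fun n => -(freqSq Φ L n *
        (respF γ (freqSq Φ L n) t * respX γ (freqSq Φ L n) t))) x y *
          ∫ X, X (Sum.inl x) * X (Sum.inr y) ∂μ₀) +
      ∑ x, ∑ y, circ (fun n => respF γ (freqSq Φ L n) t * respF γ (freqSq Φ L n) t) x y *
          ∫ X, X (Sum.inr x) * X (Sum.inr y) ∂μ₀ := fun t => by
    rw [h.sum_source_eq hμ, ← avg _ Sum.inl Sum.inl, ← avg _ Sum.inl Sum.inr,
      ← avg _ Sum.inr Sum.inr, ← integral_const_mul, ← integral_add, ← integral_add]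
    · simp only [h.sum_momentum_sq]
    · exact (hμ.integrable_circForm _ Sum.inl Sum.inl).add
        ((hμ.integrable_circForm _ Sum.inl Sum.inr).const_mul 2)
    · exact hμ.integrable_circForm _ Sum.inr Sum.inr
    · exact hμ.integrable_circForm _ Sum.inl Sum.inl
    · exact (hμ.integrable_circForm _ Sum.inl Sum.inr).const_mul 2
  simp only [key]
  have i12 := i1.add (i2.const_mul 2)
  have a1 := integral_add i12 i3
  have a2 := integral_add i1 (i2.const_mul 2)
  simp only [Pi.add_apply] at a1 a2
  rw [a1, a2, integral_const_mul, t1, t2, t3, energyDensity_mul]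
  simp only [h.hamiltonian_eq]
  rw [integral_const_mul, integral_add (hμ.integrable_circForm _ Sum.inr Sum.inr)
    (hμ.integrable_circForm _ Sum.inl Sum.inl), avg _ Sum.inr Sum.inr, avg _ Sum.inl Sum.inl]
  simp only [← circ_smul, circ_zero, Matrix.zero_apply, zero_mul, Finset.sum_const_zero, mul_zero,
    Matrix.smul_apply, smul_eq_mul, mul_assoc, ← Finset.mul_sum]
  field_simp
  ring

end

/-! ### The lattice diffusion in Fourier variables -/

section
variable {Φ : ℤ → ℝ} {γ : ℝ} {L : ℕ} [NeZero L]

lemma dFT_neg_left (T : ZMod L → ℝ) (n : ZMod L) : dFT T (-n) = starRingEnd ℂ (dFT T n) := by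
  simp only [dFT, map_sum, map_mul, Complex.conj_ofReal, ← wave_neg_right, wave_neg_left]

lemma eq_of_dFT_eq {T S : ZMod L → ℝ} (h : ∀ n, dFT T n = dFT S n) : T = S := by
  funext x
  have := inversion T x
  simp only [h] at this
  rw [← inversion S x] at this
  exact_mod_cast this

lemma GammaAssumption.isEvenFn_modeKernel (h : GammaAssumption Φ γ) (s : ℝ) :
    IsEvenFn fun n : ZMod L => modeKernel γ (freqSq Φ L) n s := fun n => by
  have h1 := h.dFT_memKernel (L := L) s (-n)
  rw [dFT_neg_left, h.dFT_memKernel, Complex.conj_ofReal] at h1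
  exact_mod_cast h1.symm

lemma GammaAssumption.integrableOn_memKernel (h : GammaAssumption Φ γ) (x : ZMod L) :
    IntegrableOn (fun s => memKernel L Φ γ s x) (Ioi 0) := by
  obtain ⟨v₀, v₁, ho, _, hv⟩ := h.exists_overdamped
  refine Integrable.mono' (ho.integrableOn_modeKernel (v := freqSq Φ L) (fun n => hv _) 0)
    (h.continuous_memKernel x).aestronglyMeasurable (ae_of_all _ fun s => ?_)
  rw [Real.norm_eq_abs, abs_of_nonneg (h.memKernel_nonneg s x)]
  exact h.memKernel_le s x

lemma GammaAssumption.pTilde_nonneg (h : GammaAssumption Φ γ) (x : ZMod L) :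
    0 ≤ pTilde L Φ γ x :=
  mul_nonneg (by linarith [h.gamma_pos]) (integral_nonneg fun s => h.memKernel_nonneg s x)

lemma GammaAssumption.pTilde_neg (h : GammaAssumption Φ γ) (x : ZMod L) :
    pTilde L Φ γ (-x) = pTilde L Φ γ x := by
  simp only [pTilde, h.memKernel_neg]

lemma dFT_integral {g : ℝ → ZMod L → ℝ} (hg : ∀ x, IntegrableOn (fun s => g s x) (Ioi 0))
    (n : ZMod L) :
    dFT (fun x => ∫ s in Ioi (0 : ℝ), g s x) n = ∫ s in Ioi (0 : ℝ), dFT (g s) n := by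
  simp only [dFT]
  rw [integral_finsetSum _ fun x _ => ((hg x).ofReal.const_mul _)]
  refine Finset.sum_congr rfl fun x _ => ?_
  rw [integral_const_mul, integral_complex_ofReal]

lemma dFT_const_mul (c : ℝ) (T : ZMod L → ℝ) (n : ZMod L) :
    dFT (fun x => c * T x) n = c * dFT T n := by
  simp only [dFT, Finset.mul_sum]
  exact Finset.sum_congr rfl fun x _ => by push_cast; ring

lemma dFT_mul_sub_mul (a b : ℝ) (T S : ZMod L → ℝ) (n : ZMod L) :
    dFT (fun x => a * T x - b * S x) n = a * dFT T n - b * dFT S n := by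
  simp only [dFT, Finset.mul_sum, ← Finset.sum_sub_distrib]
  exact Finset.sum_congr rfl fun x _ => by push_cast; ring

lemma GammaAssumption.dFT_pTilde (h : GammaAssumption Φ γ) (n : ZMod L) :
    dFT (pTilde L Φ γ) n =
      ((γ / 2 * ∫ s in Ioi (0 : ℝ), modeKernel γ (freqSq Φ L) n s : ℝ) : ℂ) := by
  have e : pTilde L Φ γ = fun x => γ / 2 * ∫ s in Ioi (0 : ℝ), memKernel L Φ γ s x := rfl
  rw [e, dFT_const_mul, dFT_integral h.integrableOn_memKernel]
  simp only [h.dFT_memKernel]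
  rw [integral_complex_ofReal]
  push_cast; ring

/-- Eigenvalues of the lattice diffusion operator. -/
def diffRate (γ : ℝ) (v : ZMod L → ℝ) (n : ZMod L) : ℝ :=
  γ * (1 - ∫ s in Ioi (0 : ℝ), modeKernel γ v n s)

lemma GammaAssumption.isEvenFn_diffRate (h : GammaAssumption Φ γ) :
    IsEvenFn (diffRate γ (freqSq Φ L)) := fun n => by
  simp only [diffRate, h.isEvenFn_modeKernel _ n]

/-- The weights $\tilde p$ are even with total $\gamma/2$, so $D$ is $\gamma$ minus twice the
convolution with $\tilde p$, a Fourier multiplier. -/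
lemma GammaAssumption.dFT_diffOp (h : GammaAssumption Φ γ) (τ : ZMod L → ℝ) (n : ZMod L) :
    dFT (diffOp L Φ γ τ) n = (diffRate γ (freqSq Φ L) n : ℂ) * dFT τ n := by
  obtain ⟨v₀, v₁, ho, _, hv⟩ := h.exists_overdamped
  have hsum : ∑ y : ZMod L, pTilde L Φ γ y = γ / 2 := by
    have h0 := h.dFT_pTilde (L := L) 0
    rw [dFT_zero, ho.integral_modeKernel_zero (v := freqSq Φ L) (fun n => hv _), mul_one] at h0
    exact_mod_cast h0
  have e : diffOp L Φ γ τ =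
      fun x => γ * τ x - 2 * ∑ y, pTilde L Φ γ y * τ (x - y) := by
    funext x
    have e1 : ∑ y, pTilde L Φ γ y * τ (x + y) = ∑ y, pTilde L Φ γ y * τ (x - y) :=
      Fintype.sum_equiv (Equiv.neg _) _ _ fun y => by
        rw [Equiv.neg_apply, h.pTilde_neg, sub_neg_eq_add]
    calc diffOp L Φ γ τ x = ∑ y, pTilde L Φ γ y * (2 * τ x - τ (x + y) - τ (x - y)) := rfl
      _ = (∑ y, pTilde L Φ γ y) * (2 * τ x) - ∑ y, pTilde L Φ γ y * τ (x + y) -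
          ∑ y, pTilde L Φ γ y * τ (x - y) := by
        rw [Finset.sum_mul, ← Finset.sum_sub_distrib, ← Finset.sum_sub_distrib]
        exact Finset.sum_congr rfl fun y _ => by ring
      _ = _ := by rw [e1, hsum]; ring
  rw [e, dFT_mul_sub_mul, dFT_convolution, h.dFT_pTilde, diffRate]
  push_cast; ring

lemma dFT_circ_mulVec {f : ZMod L → ℝ} (hf : IsEvenFn f) (T : ZMod L → ℝ) (n : ZMod L) :
    dFT (circ f *ᵥ T) n = (f n : ℂ) * dFT T n := by
  have hL := natCast_ne_zero_complex (L := L)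
  simp only [dFT, circ_mulVec hf T]
  calc ∑ x, wave L n (-x) * ((1 / (L : ℂ)) * ∑ m, wave L m x * ((f m : ℂ) * dFT T m))
      = ∑ m, (1 / (L : ℂ)) * ((f m : ℂ) * dFT T m) * ∑ x, wave L (m - n) x := by
        simp only [Finset.mul_sum]
        rw [Finset.sum_comm]
        refine Finset.sum_congr rfl fun m _ => Finset.sum_congr rfl fun x _ => ?_
        rw [sub_eq_add_neg, wave_add_left, wave_neg_left]; ring
    _ = (1 / (L : ℂ)) * ((f n : ℂ) * dFT T n) * L := by
        simp only [sum_wave, sub_eq_zero]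
        rw [Finset.sum_eq_single n (fun m _ hm => by simp [hm]) (fun hn => absurd (Finset.mem_univ _) hn)]
        simp
    _ = _ := by rw [← dFT]; field_simp

lemma GammaAssumption.toMatrix_diffOp (h : GammaAssumption Φ γ) :
    LinearMap.toMatrix' (diffOp L Φ γ) = circ (diffRate γ (freqSq Φ L)) := by
  apply Matrix.toLin'.injective
  rw [Matrix.toLin'_toMatrix']
  refine LinearMap.ext fun τ => eq_of_dFT_eq fun n => ?_
  rw [h.dFT_diffOp, Matrix.toLin'_apply, dFT_circ_mulVec h.isEvenFn_diffRate]

lemma exp_circ {f : ZMod L → ℝ} (hf : IsEvenFn f) (t : ℝ) :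
    NormedSpace.exp (t • circ f) = circ fun n => Real.exp (t * f n) := by
  symm
  refine eq_exp_of_hasDerivAt (E := fun t => circ fun n => Real.exp (t * f n)) ?_ ?_ t
  · simp only [zero_mul, Real.exp_zero, circ_one]
  · intro t i j
    rw [circ_mul hf (fun n => by simp only [hf n])]
    refine hasDerivAt_circ (f := fun t n => Real.exp (t * f n))
      (f' := fun t n => f n * Real.exp (t * f n)) (fun n => ?_) i j
    have := ((hasDerivAt_id t).mul_const (f n)).exp
    exact this.congr_deriv (by simp; ring)

lemma GammaAssumption.dFT_diffFlow (h : GammaAssumption Φ γ) (t : ℝ) (τ : ZMod L → ℝ)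
    (n : ZMod L) : dFT (diffFlow L Φ γ t τ) n =
      ((Real.exp (-t * diffRate γ (freqSq Φ L) n) : ℝ) : ℂ) * dFT τ n := by
  rw [diffFlow, h.toMatrix_diffOp, exp_circ h.isEvenFn_diffRate,
    dFT_circ_mulVec fun n => by simp only [h.isEvenFn_diffRate n]]

lemma initProfile_eq {μ₀ : Measure (Phase L)} {a : ZMod L → ℝ} (ha : IsEvenFn a) (x : ZMod L) :
    (((circ a *ᵥ fun y => ∫ s in Ioi (0 : ℝ), source L Φ γ μ₀ s y) x : ℝ) : ℂ) =
      initProfile L Φ γ μ₀ a x := by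
  simp only [Matrix.mulVec, dotProduct, initProfile]
  push_cast
  refine Finset.sum_congr rfl fun y _ => ?_
  rw [circ_apply, ofReal_re_invFT ha, invFT]

/-- The kernels of $n$ and $-n$ coincide, so uniqueness of the rate gives equal rates and
amplitudes. Evenness is what makes $\tau$ real. -/
lemma IsRateAmplitude.isEvenFn {ε₀ β : ℝ} {R a : ZMod L → ℝ} (h : GammaAssumption Φ γ)
    (hR : IsRateAmplitude L Φ γ ε₀ β R a) : IsEvenFn a := fun n => by
  have hk : ∀ s, cosKernel L Φ γ s (-n) = cosKernel L Φ γ s n := fun s => by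
    rw [h.cosKernel_eq, h.cosKernel_eq]; exact h.isEvenFn_modeKernel s n
  by_cases hn : |dualPt L n| ≤ ε₀
  · have hn' : |dualPt L (-n)| ≤ ε₀ := by rwa [abs_dualPt_neg]
    have h1 := hR.rate_eq (-n) hn'
    have h2 := hR.amp_eq (-n) hn'
    simp only [hk] at h1 h2
    have h3 := hR.rate_unique n hn _ (hR.rate_mem (-n) hn') h1
    rw [h3, ← hR.amp_eq n hn] at h2
    have := hR.amp_pos n hn
    have := hR.amp_pos (-n) hn'
    field_simp at h2
    exact h2.symm
  · push Not at hn
    rw [hR.amp_large n hn, hR.amp_large (-n) (by rwa [abs_dualPt_neg])]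

end

/-! ### Gaussian sums over the dual lattice -/

section
variable {L : ℕ} [NeZero L]

/-- Each positive distance from the origin is attained by at most two residues. -/
lemma sum_ne_zero_natAbs_le {f : ℕ → ℝ} (hf : ∀ j, 0 ≤ f j) :
    ∑ n ∈ Finset.univ.erase (0 : ZMod L), f n.valMinAbs.natAbs ≤
      2 * ∑ j ∈ Finset.range L, f (j + 1) := by
  classical
  have hmaps : ∀ n ∈ Finset.univ.erase (0 : ZMod L),
      n.valMinAbs.natAbs - 1 ∈ Finset.range L := fun n _ => by
    have h1 := ZMod.natAbs_valMinAbs_le n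
    have h2 := Nat.pos_of_ne_zero (NeZero.ne L)
    rw [Finset.mem_range]; omega
  rw [← Finset.sum_fiberwise_of_maps_to hmaps, Finset.mul_sum]
  refine Finset.sum_le_sum fun j _ => ?_
  have hj : ∀ n ∈ (Finset.univ.erase (0 : ZMod L)).filter
      (fun n => n.valMinAbs.natAbs - 1 = j), n.valMinAbs.natAbs = j + 1 := fun n hn => by
    rw [Finset.mem_filter, Finset.mem_erase] at hn
    have : n.valMinAbs.natAbs ≠ 0 := by
      rw [Int.natAbs_ne_zero, Ne, ZMod.valMinAbs_eq_zero]; exact hn.1.1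
    omega
  rw [Finset.sum_congr rfl fun n hn => by rw [hj n hn], Finset.sum_const, nsmul_eq_mul]
  refine mul_le_mul_of_nonneg_right ?_ (hf _)
  have hsub : (Finset.univ.erase (0 : ZMod L)).filter (fun n => n.valMinAbs.natAbs - 1 = j) ⊆
      {((j + 1 : ℕ) : ZMod L), -((j + 1 : ℕ) : ZMod L)} := fun n hn => by
    have h1 := hj n hn
    have h2 := ZMod.coe_valMinAbs n
    rw [Finset.mem_insert, Finset.mem_singleton]
    rcases Int.natAbs_eq n.valMinAbs with h | h
    · left; rw [← h2, h, h1]; push_cast; rfl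
    · right; rw [← h2, h, h1]; push_cast; rfl
  exact_mod_cast (Finset.card_le_card hsub).trans Finset.card_le_two

omit [NeZero L] in
lemma dualPt_sq (n : ZMod L) : dualPt L n ^ 2 = ((n.valMinAbs.natAbs : ℝ) ^ 2) / (L : ℝ) ^ 2 := by
  rw [dualPt, div_pow, Nat.cast_natAbs, Int.cast_abs, sq_abs]

/-- Since $(j+1)^2\ge1+2j$, the Gaussian sum is dominated by a geometric series, which produces the
quotient in the first estimate of the theorem. -/
lemma sum_exp_neg_dualPt_sq_le {x : ℝ} (hx : 0 < x) :
    ∑ n ∈ Finset.univ.erase (0 : ZMod L), Real.exp (-(x * dualPt L n ^ 2)) ≤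
      2 * (Real.exp (-(x / (L : ℝ) ^ 2)) / (1 - Real.exp (-(2 * (x / (L : ℝ) ^ 2))))) := by
  have hL := natCast_pos_of_neZero (L := L)
  set y := x / (L : ℝ) ^ 2 with hy
  have hy0 : 0 < y := by positivity
  have e : ∀ n : ZMod L, Real.exp (-(x * dualPt L n ^ 2)) =
      (fun j : ℕ => Real.exp (-(y * (j : ℝ) ^ 2))) n.valMinAbs.natAbs := fun n => by
    simp only [dualPt_sq, hy]; congr 2; ring
  rw [Finset.sum_congr rfl fun n _ => e n]
  refine (sum_ne_zero_natAbs_le (L := L) (f := fun j : ℕ => Real.exp (-(y * (j : ℝ) ^ 2)))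
    fun j => (Real.exp_pos _).le).trans (mul_le_mul_of_nonneg_left ?_ zero_le_two)
  have hr0 := (Real.exp_pos (-(2 * y))).le
  have hr1 : Real.exp (-(2 * y)) < 1 := Real.exp_lt_one_iff.mpr (by linarith)
  calc ∑ j ∈ Finset.range L, Real.exp (-(y * ((j + 1 : ℕ) : ℝ) ^ 2))
      ≤ ∑ j ∈ Finset.range L, Real.exp (-y) * Real.exp (-(2 * y)) ^ j := by
        refine Finset.sum_le_sum fun j _ => ?_
        rw [← Real.exp_nat_mul, ← Real.exp_add, Real.exp_le_exp]
        push_cast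
        nlinarith [mul_nonneg hy0.le (sq_nonneg (j : ℝ))]
    _ = Real.exp (-y) * ∑ j ∈ Finset.range L, Real.exp (-(2 * y)) ^ j := by rw [Finset.mul_sum]
    _ ≤ Real.exp (-y) * (1 - Real.exp (-(2 * y)))⁻¹ := by
        refine mul_le_mul_of_nonneg_left ?_ (Real.exp_pos _).le
        rw [← tsum_geometric_of_lt_one hr0 hr1]
        exact (summable_geometric_of_lt_one hr0 hr1).sum_le_tsum _ fun j _ => by positivity
    _ = _ := by rw [div_eq_mul_inv]

/-- Comparison of a decreasing sum with the Gaussian integral; this supplies the factor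
$L\,t^{-1/2}$ of the second estimate. -/
lemma sum_exp_neg_dualPt_sq_le_sqrt {x : ℝ} (hx : 0 < x) :
    ∑ n ∈ Finset.univ.erase (0 : ZMod L), Real.exp (-(x * dualPt L n ^ 2)) ≤
      L * Real.sqrt (Real.pi / x) := by
  have hL := natCast_pos_of_neZero (L := L)
  set y := x / (L : ℝ) ^ 2 with hy
  have hy0 : 0 < y := by positivity
  set f : ℝ → ℝ := fun u => Real.exp (-y * u ^ 2) with hf
  have e : ∀ n : ZMod L, Real.exp (-(x * dualPt L n ^ 2)) =
      (fun j : ℕ => f j) n.valMinAbs.natAbs := fun n => by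
    simp only [dualPt_sq, hf, hy]; congr 1; ring
  rw [Finset.sum_congr rfl fun n _ => e n]
  have hanti : AntitoneOn f (Icc ((0 : ℝ)) (0 + L)) := fun u hu w hw huw => by
    simp only [hf, Real.exp_le_exp]
    have : u ^ 2 ≤ w ^ 2 := pow_le_pow_left₀ hu.1 huw 2
    nlinarith
  have h1 := hanti.sum_le_integral
  have hint : IntegrableOn f (Ioi 0) := (integrable_exp_neg_mul_sq hy0).integrableOn
  have h2 : ∫ u in (0 : ℝ)..(0 + L), f u ≤ ∫ u in Ioi (0 : ℝ), f u := by
    rw [zero_add, intervalIntegral.integral_of_le hL.le]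
    exact setIntegral_mono_set hint (ae_of_all _ fun u => (Real.exp_pos _).le)
      Ioc_subset_Ioi_self.eventuallyLE
  have h3 : ∫ u in Ioi (0 : ℝ), f u = Real.sqrt (Real.pi / y) / 2 := integral_gaussian_Ioi y
  have h4 : Real.sqrt (Real.pi / y) = L * Real.sqrt (Real.pi / x) := by
    rw [hy, show Real.pi / (x / (L : ℝ) ^ 2) = (L : ℝ) ^ 2 * (Real.pi / x) by field_simp,
      Real.sqrt_mul (by positivity), Real.sqrt_sq hL.le]
  refine (sum_ne_zero_natAbs_le (L := L) (f := fun j : ℕ => f j)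
    fun j => (Real.exp_pos _).le).trans ?_
  simp only [zero_add] at h1
  rw [zero_add] at h2
  linarith

lemma exp_neg_mul_le_rpow {β t : ℝ} (hβ : 0 < β) (ht : 0 < t) :
    Real.exp (-β * t) ≤ (1 / β + 2 / β ^ 2) * t ^ (-(3 / 2) : ℝ) := by
  have h1 := Real.quadratic_le_exp_of_nonneg (mul_nonneg hβ.le ht.le)
  have h2 : Real.sqrt t ≤ 1 + t := by
    have := Real.sq_sqrt ht.le
    nlinarith [sq_nonneg (Real.sqrt t - 1), Real.sqrt_nonneg t]
  have h3 : t ^ (3 / 2 : ℝ) = t * Real.sqrt t := by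
    rw [Real.sqrt_eq_rpow, show (3 / 2 : ℝ) = 1 + 1 / 2 by norm_num, Real.rpow_add ht,
      Real.rpow_one]
  have h4 : t ^ (3 / 2 : ℝ) ≤ (1 / β + 2 / β ^ 2) * Real.exp (β * t) := by
    calc t ^ (3 / 2 : ℝ) ≤ t * (1 + t) := by rw [h3]; exact mul_le_mul_of_nonneg_left h2 ht.le
      _ = 1 / β * (β * t) + 2 / β ^ 2 * ((β * t) ^ 2 / 2) := by field_simp
      _ ≤ 1 / β * Real.exp (β * t) + 2 / β ^ 2 * Real.exp (β * t) := by
          have hb : 0 ≤ β * t := by positivity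
          gcongr
          · nlinarith [sq_nonneg (β * t)]
          · nlinarith
      _ = _ := by ring
  rw [Real.rpow_neg ht.le, ← div_eq_mul_inv, le_div_iff₀ (Real.rpow_pos_of_pos ht _)]
  calc Real.exp (-β * t) * t ^ (3 / 2 : ℝ)
      ≤ Real.exp (-β * t) * ((1 / β + 2 / β ^ 2) * Real.exp (β * t)) := by gcongr
    _ = (1 / β + 2 / β ^ 2) * (Real.exp (-β * t) * Real.exp (β * t)) := by ring
    _ = _ := by rw [← Real.exp_add]; simp

lemma sqrt_pi_div_div {A c t : ℝ} (ht : 0 < t) (hc : 0 < c) :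
    A / t * Real.sqrt (Real.pi / (c * t)) =
      A * Real.sqrt (Real.pi / c) * t ^ (-(3 / 2) : ℝ) := by
  have h3 : t ^ (3 / 2 : ℝ) = t * Real.sqrt t := by
    rw [Real.sqrt_eq_rpow, show (3 / 2 : ℝ) = 1 + 1 / 2 by norm_num, Real.rpow_add ht,
      Real.rpow_one]
  rw [Real.rpow_neg ht.le, h3, ← div_div, Real.sqrt_div (by positivity)]
  have := Real.sqrt_pos.mpr ht
  field_simp

lemma sq_mul_exp_neg_le {x c t : ℝ} (hc : 0 < c) (ht : 0 < t) :
    x * Real.exp (-(c * t * x)) ≤ 2 / (c * t) * Real.exp (-(c / 2 * t * x)) := by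
  have h := mul_exp_neg_le (mul_pos hc ht) x
  rw [← neg_mul]
  convert h using 3; ring

lemma mul_sq_mul_exp_neg_le {x c t : ℝ} (hc : 0 < c) (ht : 0 < t) (hx : 0 ≤ x) :
    t * x ^ 2 * Real.exp (-(c * t * x)) ≤ 8 / (c ^ 2 * t) * Real.exp (-(c / 2 * t * x)) := by
  have h1 := Real.quadratic_le_exp_of_nonneg (x := c / 2 * t * x) (by positivity)
  have h2 : t * x ^ 2 ≤ 8 / (c ^ 2 * t) * Real.exp (c / 2 * t * x) := by
    have h3 : (c / 2 * t * x) ^ 2 / 2 ≤ Real.exp (c / 2 * t * x) := by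
      have : 0 ≤ c / 2 * t * x := by positivity
      linarith
    calc t * x ^ 2 = 8 / (c ^ 2 * t) * ((c / 2 * t * x) ^ 2 / 2) := by field_simp; norm_num
      _ ≤ _ := by gcongr
  calc t * x ^ 2 * Real.exp (-(c * t * x))
      ≤ 8 / (c ^ 2 * t) * Real.exp (c / 2 * t * x) * Real.exp (-(c * t * x)) := by gcongr
    _ = _ := by rw [mul_assoc, ← Real.exp_add]; congr 2; ring

end

/-! ### Uniform bounds for all Fourier modes -/

/-- A continuous solution `Y` of a scalar renewal equation with exponentially small source. -/
structure RenewalMode (c G : ℝ) (p : ℝ → ℝ) (Y f : ℝ → ℂ) : Prop where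
  cont : Continuous Y
  cont_source : Continuous f
  bound : ∀ t, 0 ≤ t → ‖f t‖ ≤ G * Real.exp (-c * t)
  eq : ∀ t, 0 ≤ t → Y t = f t + ∫ s in (0 : ℝ)..t, p s • Y (t - s)

section
variable {γ c β K G V R a : ℝ} {p : ℝ → ℝ} {Y f : ℝ → ℂ}

lemma RenewalMode.nonneg (m : RenewalMode c G p Y f) : 0 ≤ G := by
  have := (norm_nonneg _).trans (m.bound 0 le_rfl)
  simpa using this

/-- The asymptotics at time $0$, where $Y(0)=f(0)$, bound the leading coefficient; the asymptotics
at time $t$ then bound the solution. -/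
lemma SlowMode.norm_le (sm : SlowMode γ c β K p V R a) (m : RenewalMode c G p Y f) (hK : 0 ≤ K)
    {t : ℝ} (ht : 0 ≤ t) : ‖Y t‖ ≤ (2 * K + 1) * G * Real.exp (-R * t) := by
  have hG := m.nonneg
  have h0 := sm.asymptotics Y f G m.cont m.cont_source m.bound m.eq 0 le_rfl
  have h1 := sm.asymptotics Y f G m.cont m.cont_source m.bound m.eq t ht
  set J := ∫ s in Ioi (0 : ℝ), Real.exp (s * R) • f s
  simp only [mul_zero, Real.exp_zero, mul_one] at h0
  have h2 : ‖Y 0‖ ≤ G := by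
    have := m.bound 0 le_rfl
    rw [m.eq 0 le_rfl]; simpa using this
  have h3 : ‖a • J‖ ≤ (K + 1) * G := by
    have := norm_sub_norm_le (a • J) (Y 0)
    rw [norm_sub_rev] at this
    linarith
  have h4 : ‖(a * Real.exp (-R * t)) • J‖ ≤ (K + 1) * G * Real.exp (-R * t) := by
    rw [mul_comm a, mul_smul, norm_smul, Real.norm_eq_abs, abs_of_pos (Real.exp_pos _), mul_comm]
    gcongr
  have h5 : Real.exp (-β * t) ≤ Real.exp (-R * t) :=
    Real.exp_le_exp.mpr (mul_le_mul_of_nonneg_right (neg_le_neg sm.rate_mem.2) ht)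
  have h6 : K * G * Real.exp (-β * t) ≤ K * G * Real.exp (-R * t) := by gcongr
  have h7 := norm_le_norm_add_norm_sub ((a * Real.exp (-R * t)) • J) (Y t)
  rw [norm_sub_rev] at h7
  calc ‖Y t‖ ≤ _ := h7
    _ ≤ (K + 1) * G * Real.exp (-R * t) + K * G * Real.exp (-R * t) := by linarith
    _ = _ := by ring

lemma norm_integral_tilt_sub_le (m : RenewalMode c G p Y f) (hc : 0 < c) (hR0 : 0 ≤ R)
    (hR : R ≤ c / 2) : ‖(∫ s in Ioi (0 : ℝ), Real.exp (s * R) • f s) -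
      ∫ s in Ioi (0 : ℝ), f s‖ ≤ R * (16 / c ^ 2) * G := by
  have hG := m.nonneg
  have hf := m.cont_source
  have i1 : IntegrableOn (fun s => Real.exp (s * R) • f s) (Ioi 0) := by
    refine integrableOn_Ioi_of_exp_bound (C := G) (half_pos hc) (by fun_prop) fun s hs => ?_
    rw [norm_smul, Real.norm_eq_abs, abs_of_pos (Real.exp_pos _)]
    calc _ ≤ Real.exp (s * R) * (G * Real.exp (-c * s)) := by gcongr; exact m.bound s hs
      _ = G * Real.exp (s * R + -c * s) := by rw [Real.exp_add]; ring
      _ ≤ _ := by gcongr; nlinarith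
  have i2 : IntegrableOn f (Ioi 0) := integrableOn_Ioi_of_exp_bound hc hf m.bound
  rw [← integral_sub i1 i2]
  have hb : ∀ s, 0 ≤ s → ‖Real.exp (s * R) • f s - f s‖ ≤
      R * (4 / c) * G * Real.exp (-(c / 4) * s) := by
    intro s hs
    have e : Real.exp (s * R) • f s - f s = (Real.exp (s * R) - 1) • f s := by
      rw [sub_smul, one_smul]
    have h1 := exp_sub_exp_le (a := 0) (b := s * R)
    rw [Real.exp_zero, sub_zero] at h1
    have h0 : 1 ≤ Real.exp (s * R) := Real.one_le_exp (by positivity)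
    have h2 := mul_exp_neg_le (half_pos hc) s
    rw [e, norm_smul, Real.norm_eq_abs, abs_of_nonneg (by linarith)]
    calc _ ≤ (s * R * Real.exp (s * R)) * (G * Real.exp (-c * s)) := by
          gcongr; exact m.bound s hs
      _ = R * G * (s * Real.exp (s * R + -c * s)) := by rw [Real.exp_add]; ring
      _ ≤ R * G * (s * Real.exp (-(c / 2) * s)) := by gcongr; nlinarith
      _ ≤ R * G * (2 / (c / 2) * Real.exp (-(c / 2 / 2) * s)) := by gcongr
      _ = _ := by
          rw [show c / 2 / 2 = c / 4 by ring]; field_simp; norm_num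
  have := norm_integral_Ioi_le_of_exp_bound (a := 0) (by positivity : 0 < c / 4) le_rfl hb
  refine this.trans (le_of_eq ?_)
  rw [mul_zero, Real.exp_zero]; field_simp; ring

/-- Three errors: the exponential remainder, the tilt in $\int e^{sR}f$ of order $R=O(V)$, and the
change of rate of order $tV^2$. The last two keep a factor $e^{-c'tV}$ because both rates are at
least $c'V$. -/
lemma SlowMode.diffusive (sm : SlowMode γ c β K p V R a) (m : RenewalMode c G p Y f)
    (hc : 0 < c) (hK : 0 < K) (hV : 0 ≤ V) (hR : R ≤ c / 2) {c' : ℝ} (hc' : c' ≤ 1 / K)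
    (hD : c' * V ≤ γ * (1 - ∫ s in Ioi (0 : ℝ), p s)) {t : ℝ} (ht : 0 ≤ t) :
    ‖Y t - (a * Real.exp (-t * (γ * (1 - ∫ s in Ioi (0 : ℝ), p s)))) •
      ∫ s in Ioi (0 : ℝ), f s‖ ≤ K * G * Real.exp (-β * t) +
        (16 * K ^ 2 / c ^ 2 + K ^ 2 / c) * G *
          (V * Real.exp (-(c' * t * V)) + t * V ^ 2 * Real.exp (-(c' * t * V))) := by
  have hG := m.nonneg
  have h1 := sm.asymptotics Y f G m.cont m.cont_source m.bound m.eq t ht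
  have h2 := norm_integral_tilt_sub_le m hc sm.rate_mem.1 hR
  have h3 := norm_integral_Ioi_le_of_exp_bound (a := 0) hc le_rfl m.bound
  rw [mul_zero, Real.exp_zero, mul_one] at h3
  set J := ∫ s in Ioi (0 : ℝ), Real.exp (s * R) • f s
  set J₀ := ∫ s in Ioi (0 : ℝ), f s
  set D := γ * (1 - ∫ s in Ioi (0 : ℝ), p s)
  have ha := sm.amp_pos
  have haK := sm.amp_le
  have hRV : c' * V ≤ R := by
    have h4 := sm.le_rate
    calc c' * V ≤ 1 / K * V := by gcongr
      _ ≤ 1 / K * (K * R) := by gcongr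
      _ = R := by field_simp
  have hR0 := sm.rate_mem.1
  have eR : Real.exp (-R * t) ≤ Real.exp (-(c' * t * V)) := by
    rw [Real.exp_le_exp]; nlinarith
  have eD : Real.exp (-t * D) ≤ Real.exp (-(c' * t * V)) := by
    rw [Real.exp_le_exp]; nlinarith
  have hdiff : |Real.exp (-R * t) - Real.exp (-t * D)| ≤
      t * (K * V ^ 2) * Real.exp (-(c' * t * V)) := by
    have hd := abs_le.mp sm.rate_diff
    rw [abs_le]
    constructor
    · have := exp_sub_exp_le (a := -R * t) (b := -t * D)
      have h5 : (-t * D - -R * t) * Real.exp (-t * D) ≤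
          t * (K * V ^ 2) * Real.exp (-(c' * t * V)) :=
        mul_le_mul (by nlinarith) eD (Real.exp_pos _).le (by positivity)
      linarith
    · have := exp_sub_exp_le (a := -t * D) (b := -R * t)
      have h5 : (-R * t - -t * D) * Real.exp (-R * t) ≤
          t * (K * V ^ 2) * Real.exp (-(c' * t * V)) :=
        mul_le_mul (by nlinarith) eR (Real.exp_pos _).le (by positivity)
      linarith
  have e : Y t - (a * Real.exp (-t * D)) • J₀ = (Y t - (a * Real.exp (-R * t)) • J) +
      (a * Real.exp (-R * t)) • (J - J₀) +
      (a * (Real.exp (-R * t) - Real.exp (-t * D))) • J₀ := by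
    rw [smul_sub, mul_sub, sub_smul]; abel
  have b2 : ‖(a * Real.exp (-R * t)) • (J - J₀)‖ ≤
      K * Real.exp (-(c' * t * V)) * (K * V * (16 / c ^ 2) * G) := by
    rw [norm_smul, Real.norm_eq_abs, abs_of_pos (by positivity)]
    refine mul_le_mul (by gcongr) (h2.trans ?_) (norm_nonneg _) (by positivity)
    have := sm.rate_le
    gcongr
  have b3 : ‖(a * (Real.exp (-R * t) - Real.exp (-t * D))) • J₀‖ ≤
      K * (t * (K * V ^ 2) * Real.exp (-(c' * t * V))) * (G / c) := by
    rw [norm_smul, Real.norm_eq_abs, abs_mul, abs_of_pos ha]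
    gcongr
  rw [e]
  have hx : 0 ≤ V * Real.exp (-(c' * t * V)) := by positivity
  have hy : 0 ≤ t * V ^ 2 * Real.exp (-(c' * t * V)) := by positivity
  calc _ ≤ ‖Y t - (a * Real.exp (-R * t)) • J‖ + ‖(a * Real.exp (-R * t)) • (J - J₀)‖ +
        ‖(a * (Real.exp (-R * t) - Real.exp (-t * D))) • J₀‖ := norm_add₃_le
    _ ≤ K * G * Real.exp (-β * t) + K * Real.exp (-(c' * t * V)) * (K * V * (16 / c ^ 2) * G) +
        K * (t * (K * V ^ 2) * Real.exp (-(c' * t * V))) * (G / c) := by gcongr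
    _ = K * G * Real.exp (-β * t) + (16 * K ^ 2 / c ^ 2) * G * (V * Real.exp (-(c' * t * V))) +
        (K ^ 2 / c) * G * (t * V ^ 2 * Real.exp (-(c' * t * V))) := by ring
    _ ≤ _ := by
        have u1 : 0 ≤ (16 * K ^ 2 / c ^ 2) * G * (t * V ^ 2 * Real.exp (-(c' * t * V))) := by
          positivity
        have u2 : 0 ≤ (K ^ 2 / c) * G * (V * Real.exp (-(c' * t * V))) := by positivity
        nlinarith

end

/-- Bounds on all Fourier modes of the renewal equation on the lattice of size `L`. -/
structure ModeBounds (Φ : ℤ → ℝ) (γ c C d : ℝ) (L : ℕ) [NeZero L] (a : ZMod L → ℝ) : Prop where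
  decay : ∀ n : ZMod L, n ≠ 0 → ∀ G Y f, RenewalMode c G (modeKernel γ (freqSq Φ L) n) Y f →
    ∀ t, 0 ≤ t → ‖Y t‖ ≤ C * G * Real.exp (-(d * t * dualPt L n ^ 2))
  equilibrium : ∀ G Y f, RenewalMode c G (modeKernel γ (freqSq Φ L) 0) Y f →
    ∀ t, 0 ≤ t → ‖Y t - γ • ∫ s in Ioi (0 : ℝ), f s‖ ≤ C * G * Real.exp (-d * t)
  diffusive : ∀ n G Y f, RenewalMode c G (modeKernel γ (freqSq Φ L) n) Y f → ∀ t, 0 < t →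
    ‖Y t - (a n * Real.exp (-t * diffRate γ (freqSq Φ L) n)) • ∫ s in Ioi (0 : ℝ), f s‖ ≤
      C * G * (Real.exp (-d * t) +
        if n = 0 then 0 else 1 / t * Real.exp (-(d * t * dualPt L n ^ 2)))

lemma modeVar_zero {L : ℕ} [NeZero L] (v : ZMod L → ℝ) : modeVar v 0 = 0 := by
  simp [modeVar, cavg]

set_option maxHeartbeats 1000000 in
-- Dual points with $|k|\le\varepsilon_0$ are slow modes, the others fast modes; the two-sided
-- comparison of `modeVar` with $k^2$ expresses all decay through $k$.
theorem GammaAssumption.exists_modeBounds {Φ : ℤ → ℝ} {γ : ℝ} (h : GammaAssumption Φ γ)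
    {v₀ v₁ : ℝ} (ho : Overdamped γ v₀ v₁) (hv01 : v₀ ≤ v₁) (hv : ∀ k, hatPhi Φ k ∈ Icc v₀ v₁) :
    ∃ (L₀ : ℕ) (C d ε₀ β : ℝ), 0 < C ∧ 0 < d ∧ 0 < ε₀ ∧ 0 < β ∧
      ∀ (L : ℕ) [NeZero L], L₀ ≤ L → ∃ R a : ZMod L → ℝ, IsRateAmplitude L Φ γ ε₀ β R a ∧
        ModeBounds Φ γ (respRate γ v₀) C d L a := by
  obtain ⟨C₁, hC₁, κ, hκ, θ, hθ, ρ, hρ, hpair⟩ := ho.exists_kernelPair hv01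
  have hc := ho.rate_pos
  set c := respRate γ v₀
  have hγ := h.gamma_pos
  obtain ⟨β, hβ, ε, hε, K, hK, hslow⟩ := exists_slowMode hγ hC₁ hc hκ hθ hρ
  obtain ⟨Λ, hΛ, hvar⟩ := h.exists_modeVar_le
  -- The bounds allow the integer multiples in `exists_modeVar_ge`, make $V$ small enough for the
  -- slow-mode analysis, and keep $R\le c/2$.
  set ε₀ := min (1 / 4) (min (ε / Λ) (c / (2 * K * Λ))) with hε₀d
  have hε₀ : 0 < ε₀ := lt_min (by norm_num) (lt_min (by positivity) (by positivity))
  have hε₀4 : ε₀ ≤ 1 / 4 := min_le_left _ _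
  have hε₀1 : Λ * ε₀ ≤ ε := by
    have : ε₀ ≤ ε / Λ := (min_le_right _ _).trans (min_le_left _ _)
    rwa [le_div_iff₀ hΛ, mul_comm] at this
  have hε₀2 : K * (Λ * ε₀) ≤ c / 2 := by
    have : ε₀ ≤ c / (2 * K * Λ) := (min_le_right _ _).trans (min_le_right _ _)
    rw [le_div_iff₀ (by positivity)] at this
    linarith
  obtain ⟨L₀, c₀, hc₀, hge⟩ := h.exists_modeVar_ge hε₀ hε₀4
  obtain ⟨β', hβ', K', hK', hfast⟩ := exists_fastMode (γ := γ) (θ := θ) (ρ := ρ) hC₁ hc hκ hc₀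
  set c₂ := min (1 / K) (γ * κ) with hc₂d
  have hc₂ : 0 < c₂ := lt_min (by positivity) (by positivity)
  set M := 16 * K ^ 2 / c ^ 2 + K ^ 2 / c with hM
  have hM0 : 0 < M := by positivity
  -- The factor $\frac12$ is the half of the exponent spent on absorbing powers of $V$ into $1/t$.
  set d := min (min β β') (c₂ / 2 * c₀) with hd
  have hd0 : 0 < d := lt_min (lt_min hβ hβ') (by positivity)
  have hdβ : d ≤ β := (min_le_left _ _).trans (min_le_left _ _)
  have hdβ' : d ≤ β' := (min_le_left _ _).trans (min_le_right _ _)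
  have hdc : d ≤ c₂ / 2 * c₀ := min_le_right _ _
  set C := 2 * K + 1 + K' + M * (2 / c₂ + 8 / c₂ ^ 2) with hCd
  have hN : 0 < M * (2 / c₂ + 8 / c₂ ^ 2) := by positivity
  have hC : 0 < C := by positivity
  refine ⟨L₀, C, d, ε₀, β, hC, hd0, hε₀, hβ, fun L _ hL => ?_⟩
  have hvL : ∀ n : ZMod L, freqSq Φ L n ∈ Icc v₀ v₁ := fun n => hv _
  have hk : ∀ n : ZMod L, KernelPair γ C₁ c κ θ ρ (modeKernel γ (freqSq Φ L) 0)
    (modeKernel γ (freqSq Φ L) n) (modeVar (freqSq Φ L) n) := hpair L (freqSq Φ L) hvL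
  have hV0 : ∀ n : ZMod L, 0 ≤ modeVar (freqSq Φ L) n := modeVar_nonneg _
  have hΛε : ∀ n : ZMod L, |dualPt L n| ≤ ε₀ → modeVar (freqSq Φ L) n ≤ Λ * ε₀ := fun n hn => by
    refine (hvar L n).trans (mul_le_mul_of_nonneg_left ?_ hΛ.le)
    rw [← sq_abs]
    nlinarith [abs_nonneg (dualPt L n)]
  have hex : ∀ n : ZMod L, ∃ R a, (|dualPt L n| ≤ ε₀ →
      SlowMode γ c β K (modeKernel γ (freqSq Φ L) n) (modeVar (freqSq Φ L) n) R a) ∧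
      (ε₀ < |dualPt L n| → R = β ∧ a = 0) := fun n => by
    by_cases hn : |dualPt L n| ≤ ε₀
    · obtain ⟨R, a, hs⟩ := hslow _ _ _ (hV0 n) ((hΛε n hn).trans hε₀1) (hk n)
      exact ⟨R, a, fun _ => hs, fun h => absurd hn (not_le.mpr h)⟩
    · exact ⟨β, 0, fun h => absurd h hn, fun _ => ⟨rfl, rfl⟩⟩
  choose R a hsm hlarge using hex
  have hz : |dualPt L 0| ≤ ε₀ := by simpa [dualPt] using hε₀.le
  have fast : ∀ n : ZMod L, ε₀ < |dualPt L n| → ∀ G Y f,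
      RenewalMode c G (modeKernel γ (freqSq Φ L) n) Y f →
      ∀ t, 0 ≤ t → ‖Y t‖ ≤ C * G * Real.exp (-d * t) := by
    intro n hn G Y f m t ht
    have hG := m.nonneg
    refine (hfast _ _ _ (((hge L hL n).1 hn.le)) (hk n) Y f G m.cont m.bound m.eq t ht).trans ?_
    have h1 : K' ≤ C := by linarith
    gcongr
  refine ⟨R, a, ⟨fun n hn => (hlarge n hn).1, fun n hn => (hlarge n hn).2,
    fun n hn => (hsm n hn).rate_mem, fun n hn => ?_, fun n hn r hr h1 => ?_,
    fun n hn => (hsm n hn).amp_pos, fun n hn => ?_⟩, ?_, ?_, ?_⟩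
  · simp only [h.cosKernel_eq]; exact (hsm n hn).rate_eq
  · simp only [h.cosKernel_eq] at h1; exact (hsm n hn).rate_unique r hr h1
  · simp only [h.cosKernel_eq]; exact (hsm n hn).amp_eq
  · intro n _ G Y f m t ht
    have hG := m.nonneg
    by_cases hn : |dualPt L n| ≤ ε₀
    · refine ((hsm n hn).norm_le m hK.le ht).trans ?_
      have h1 : 2 * K + 1 ≤ C := by linarith
      have h2 : d * dualPt L n ^ 2 ≤ R n := by
        have h3 := (hge L hL n).2 hn
        have h4 := (hsm n hn).le_rate
        have h5 : c₂ ≤ 1 / K := min_le_left _ _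
        calc d * dualPt L n ^ 2 ≤ c₂ / 2 * c₀ * dualPt L n ^ 2 := by gcongr
          _ = c₂ / 2 * (c₀ * dualPt L n ^ 2) := by ring
          _ ≤ c₂ / 2 * (K * R n) := mul_le_mul_of_nonneg_left (h3.trans h4) (by positivity)
          _ ≤ 1 / K / 2 * (K * R n) := by
              have := mul_nonneg hK.le (hsm n hn).rate_mem.1
              gcongr
          _ = R n / 2 := by field_simp
          _ ≤ R n := by linarith [(hsm n hn).rate_mem.1]
      have h3 := mul_le_mul_of_nonneg_right h2 ht
      gcongr
      linarith
    · refine (fast n (not_le.mp hn) G Y f m t ht).trans ?_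
      gcongr
      have h1 : dualPt L n ^ 2 ≤ 1 := by
        have := abs_dualPt_le n
        rw [← sq_abs]
        nlinarith [abs_nonneg (dualPt L n)]
      have := mul_le_mul_of_nonneg_left h1 (mul_nonneg hd0.le ht)
      linarith
  · intro G Y f m t ht
    have hG := m.nonneg
    have s := hsm 0 hz
    have k0 := hk 0
    -- The zero mode already has mass one, so no tilt is needed; its amplitude is the inverse mean
    -- $\gamma$.
    have hR0 : R 0 = 0 := by
      symm
      refine s.rate_unique 0 ⟨le_rfl, hβ.le⟩ ?_
      simp only [mul_zero, Real.exp_zero, one_mul]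
      exact k0.mass₀.symm
    have ha0 : a 0 = γ := by
      have h1 := s.amp_eq
      simp only [hR0, mul_zero, Real.exp_zero, mul_one] at h1
      rw [k0.mean₀] at h1
      have := s.amp_pos
      field_simp at h1
      exact h1.symm
    have h1 := s.asymptotics Y f G m.cont m.cont_source m.bound m.eq t ht
    simp only [hR0, ha0, neg_zero, zero_mul, mul_zero, Real.exp_zero, mul_one, one_smul] at h1
    refine h1.trans ?_
    have h2 : K ≤ C := by linarith
    gcongr
  · intro n G Y f m t ht
    have hG := m.nonneg
    by_cases hn : |dualPt L n| ≤ ε₀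
    · have s := hsm n hn
      have hV := hV0 n
      set V := modeVar (freqSq Φ L) n with hVd
      have hRc : R n ≤ c / 2 := by
        refine s.rate_le.trans (le_trans ?_ hε₀2)
        have := hΛε n hn
        gcongr
      have hDV : c₂ * V ≤ γ * (1 - ∫ s in Ioi (0 : ℝ), modeKernel γ (freqSq Φ L) n s) := by
        have h1 := (hk n).le_one_sub_mass hc
        calc c₂ * V ≤ γ * κ * V := by gcongr; exact min_le_right _ _
          _ = γ * (κ * V) := by ring
          _ ≤ _ := by gcongr
      refine (s.diffusive m hc hK hV hRc (min_le_left _ _) hDV ht.le).trans ?_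
      have hKC : K * G * Real.exp (-β * t) ≤ C * G * Real.exp (-d * t) := by
        have h2 : K ≤ C := by linarith
        gcongr
      rw [mul_add (C * G)]
      refine add_le_add hKC ?_
      split_ifs with h0
      · have : V = 0 := by rw [hVd, h0, modeVar_zero]
        simp [this]
      · have hVk := (hge L hL n).2 hn
        have h1 := sq_mul_exp_neg_le (x := V) hc₂ ht
        have h2 := mul_sq_mul_exp_neg_le hc₂ ht hV
        have h3 : Real.exp (-(c₂ / 2 * t * V)) ≤ Real.exp (-(d * t * dualPt L n ^ 2)) := by
          rw [Real.exp_le_exp, neg_le_neg_iff]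
          calc d * t * dualPt L n ^ 2 ≤ c₂ / 2 * c₀ * t * dualPt L n ^ 2 := by gcongr
            _ = c₂ / 2 * t * (c₀ * dualPt L n ^ 2) := by ring
            _ ≤ _ := by gcongr
        have hNC : M * (2 / c₂ + 8 / c₂ ^ 2) ≤ C := by linarith
        calc M * G * (V * Real.exp (-(c₂ * t * V)) + t * V ^ 2 * Real.exp (-(c₂ * t * V)))
            ≤ M * G * (2 / (c₂ * t) * Real.exp (-(c₂ / 2 * t * V)) +
                8 / (c₂ ^ 2 * t) * Real.exp (-(c₂ / 2 * t * V))) := by gcongr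
          _ = M * (2 / c₂ + 8 / c₂ ^ 2) * G * (1 / t * Real.exp (-(c₂ / 2 * t * V))) := by
              field_simp
          _ ≤ _ := by gcongr
    · have hn' := not_le.mp hn
      rw [(hlarge n hn').2, zero_mul, zero_smul, sub_zero]
      refine (fast n hn' G Y f m t ht.le).trans ?_
      rw [mul_add]
      refine le_add_of_nonneg_right ?_
      split_ifs
      · simp
      · positivity

/-! ### The kinetic temperature profile -/

section
variable {Φ : ℤ → ℝ} {γ : ℝ} {L : ℕ} [NeZero L] {μ₀ : Measure (Phase L)}

lemma continuous_dFT {T : ℝ → ZMod L → ℝ} (hT : ∀ x, Continuous fun t => T t x) (n : ZMod L) :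
    Continuous fun t => dFT (T t) n :=
  continuous_finsetSum _ fun x _ => continuous_const.mul (Complex.continuous_ofReal.comp (hT x))

lemma dFT_add (T S : ZMod L → ℝ) (n : ZMod L) : dFT (fun x => T x + S x) n = dFT T n + dFT S n := by
  simp only [dFT, ← Finset.sum_add_distrib]
  exact Finset.sum_congr rfl fun x _ => by push_cast; ring

/-- The discrete Fourier transform diagonalizes lattice renewal equations. -/
lemma dFT_renewal {p T g : ℝ → ZMod L → ℝ} (hp : ∀ x, Continuous fun t => p t x)
    (hT : ∀ x, Continuous fun t => T t x) {t : ℝ}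
    (heq : ∀ x, T t x = g t x + ∫ s in (0 : ℝ)..t, ∑ y, p s y * T (t - s) (x - y)) (n : ZMod L) :
    dFT (T t) n = dFT (g t) n + ∫ s in (0 : ℝ)..t, dFT (p s) n * dFT (T (t - s)) n := by
  have hc : ∀ x, Continuous fun s => ∑ y, p s y * T (t - s) (x - y) := fun x =>
    continuous_finsetSum _ fun y _ =>
      (hp y).mul ((hT (x - y)).comp (continuous_const.sub continuous_id))
  have e : T t = fun x => g t x + ∫ s in (0 : ℝ)..t, ∑ y, p s y * T (t - s) (x - y) := funext heq
  rw [e, dFT_add]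
  congr 1
  simp only [← dFT_convolution]
  rw [dFT]
  simp only [dFT]
  have hi : ∀ x ∈ Finset.univ, IntervalIntegrable (fun s => wave L n (-x) *
      ((∑ y, p s y * T (t - s) (x - y) : ℝ) : ℂ)) volume 0 t := fun x _ =>
    (continuous_const.mul (Complex.continuous_ofReal.comp (hc x))).intervalIntegrable 0 t
  rw [intervalIntegral.integral_finsetSum hi]
  refine Finset.sum_congr rfl fun x _ => ?_
  rw [intervalIntegral.integral_const_mul, ← intervalIntegral.integral_ofReal]

/-- A profile is prescribed and continuous only for $t\ge0$; freezing it at negative times gives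
continuity on the line, as the scalar theory requires. -/
lemma IsTempProfile.extend {T : ℝ → ZMod L → ℝ} (hT : IsTempProfile L Φ γ μ₀ T) :
    IsTempProfile L Φ γ μ₀ (fun t => T (max t 0)) ∧ ∀ x, Continuous fun t => T (max t 0) x := by
  have hc : ∀ x, Continuous fun t => T (max t 0) x := fun x =>
    (hT.1 x).comp_continuous (by fun_prop) fun t => le_max_right t 0
  refine ⟨⟨fun x => (hc x).continuousOn, fun t ht x => ?_⟩, hc⟩
  simp only [max_eq_left ht]
  rw [hT.2 t ht x]
  congr 1
  refine intervalIntegral.integral_congr fun s hs => ?_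
  rw [uIcc_of_le ht] at hs
  simp only [max_eq_left (sub_nonneg.mpr hs.2)]

lemma GammaAssumption.renewalMode (h : GammaAssumption Φ γ) {T : ℝ → ZMod L → ℝ}
    (hT : IsTempProfile L Φ γ μ₀ T) (hTc : ∀ x, Continuous fun t => T t x) {c G : ℝ}
    (hG : ∀ t, 0 ≤ t → ∑ x, |source L Φ γ μ₀ t x| ≤ G * Real.exp (-c * t)) (n : ZMod L) :
    RenewalMode c G (modeKernel γ (freqSq Φ L) n) (fun t => dFT (T t) n)
      (fun t => dFT (source L Φ γ μ₀ t) n) where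
  cont := continuous_dFT hTc n
  cont_source := continuous_dFT h.continuous_source n
  bound t ht := (norm_dFT_le _ _).trans (hG t ht)
  eq t ht := by
    rw [dFT_renewal h.continuous_memKernel hTc (hT.2 t ht)]
    simp only [h.dFT_memKernel, Complex.real_smul]

lemma GammaAssumption.exists_isTempProfile (h : GammaAssumption Φ γ) {G : ℝ}
    (hG : ∀ t, 0 ≤ t → ∀ x, |source L Φ γ μ₀ t x| ≤ G) :
    ∃ T : ℝ → ZMod L → ℝ, IsTempProfile L Φ γ μ₀ T ∧ ∀ x, Continuous fun t => T t x := by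
  obtain ⟨v₀, v₁, ho, _, hv⟩ := h.exists_overdamped
  have hG0 : 0 ≤ G := (abs_nonneg _).trans (hG 0 le_rfl 0)
  let shift : ZMod L → (ZMod L → ℝ) →L[ℝ] (ZMod L → ℝ) := fun y =>
    ContinuousLinearMap.pi fun x => ContinuousLinearMap.proj (x - y)
  let k : ℝ → (ZMod L → ℝ) →L[ℝ] (ZMod L → ℝ) := fun s => ∑ y, memKernel L Φ γ s y • shift y
  have hk : Continuous k :=
    continuous_finsetSum _ fun y _ => (h.continuous_memKernel y).smul continuous_const
  have hshift : ∀ y, ‖shift y‖ ≤ 1 := fun y =>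
    ContinuousLinearMap.opNorm_le_bound _ zero_le_one fun φ => by
      rw [one_mul]
      exact (pi_norm_le_iff_of_nonneg (norm_nonneg _)).mpr fun x => norm_le_pi_norm φ (x - y)
  have hCk : ∀ s, 0 ≤ s → ‖k s‖ ≤ 2 * γ * respBound γ v₁ ^ 2 := fun s hs => by
    have h1 := ho.modeKernel_zero_le (v := freqSq Φ L) (fun n => hv _) hs
    have hγ := h.gamma_pos
    calc ‖k s‖ ≤ ∑ y, ‖memKernel L Φ γ s y • shift y‖ := norm_sum_le _ _
      _ ≤ ∑ y, memKernel L Φ γ s y := Finset.sum_le_sum fun y _ => by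
          rw [norm_smul, Real.norm_eq_abs, abs_of_nonneg (h.memKernel_nonneg s y)]
          exact mul_le_of_le_one_right (h.memKernel_nonneg s y) (hshift y)
      _ = modeKernel γ (freqSq Φ L) 0 s := h.sum_memKernel s
      _ ≤ _ := h1
      _ ≤ 2 * γ * respBound γ v₁ ^ 2 * 1 := by
          gcongr
          rw [Real.exp_le_one_iff]
          nlinarith [ho.rate_pos]
      _ = _ := mul_one _
  have hg : Continuous fun t => source L Φ γ μ₀ t := continuous_pi h.continuous_source
  obtain ⟨T, hTc, hT⟩ := exists_volterra_solution hk hg hCk fun s hs =>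
    (pi_norm_le_iff_of_nonneg hG0).mpr (hG s hs)
  have hTx : ∀ x, Continuous fun t => T t x := fun x => (continuous_apply x).comp hTc
  refine ⟨T, ⟨fun x => (hTx x).continuousOn, fun t ht x => ?_⟩, hTx⟩
  have hi : IntervalIntegrable (fun s => k s (T (t - s))) volume 0 t :=
    (hk.clm_apply (hTc.comp (continuous_const.sub continuous_id))).intervalIntegrable 0 t
  have h1 := congrFun (hT t ht) x
  have h2 := (ContinuousLinearMap.proj (R := ℝ) (φ := fun _ : ZMod L => ℝ)
    x).intervalIntegral_comp_comm hi
  rw [Pi.add_apply] at h1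
  rw [h1]
  congr 1
  refine h2.symm.trans (intervalIntegral.integral_congr fun s _ => ?_)
  simp [k, shift]

/-- Two profiles with the same Fourier transform up to small errors are close. -/
lemma abs_sub_le_sum_dFT (T S : ZMod L → ℝ) (x : ZMod L) :
    |T x - S x| ≤ 1 / L * ∑ n, ‖dFT T n - dFT S n‖ := by
  have e : ((T x - S x : ℝ) : ℂ) = (1 / (L : ℂ)) * ∑ n, wave L n x * (dFT T n - dFT S n) := by
    rw [Complex.ofReal_sub, inversion T, inversion S, ← mul_sub, ← Finset.sum_sub_distrib]
    simp only [mul_sub]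
  rw [← Real.norm_eq_abs, ← Complex.norm_real, e, norm_mul]
  have hn : ‖(1 / (L : ℂ))‖ = 1 / L := by simp
  rw [hn]
  gcongr
  refine (norm_sum_le _ _).trans (Finset.sum_le_sum fun n _ => ?_)
  rw [norm_mul, norm_wave, one_mul]

lemma dFT_const (E : ℝ) (n : ZMod L) :
    dFT (fun _ : ZMod L => E) n = if n = 0 then ((L * E : ℝ) : ℂ) else 0 := by
  have e : ∑ x, wave L n (-x) = ∑ x, wave L n x :=
    Fintype.sum_equiv (Equiv.neg _) _ _ fun x => rfl
  rw [dFT, ← Finset.sum_mul, e, sum_wave]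
  split_ifs <;> simp

/-! ### Uniqueness and the two estimates for the profile -/

section
variable {c C d M : ℝ} {a : ZMod L → ℝ} {T : ℝ → ZMod L → ℝ}

lemma ModeBounds.unique (hb : ModeBounds Φ γ c C d L a) (h : GammaAssumption Φ γ)
    {T' : ℝ → ZMod L → ℝ} (hT : IsTempProfile L Φ γ μ₀ T) (hT' : IsTempProfile L Φ γ μ₀ T')
    {t : ℝ} (ht : 0 ≤ t) (x : ZMod L) : T' t x = T t x := by
  obtain ⟨hU, hUc⟩ := hT.extend
  obtain ⟨hU', hUc'⟩ := hT'.extend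
  -- The difference of two solutions has zero source, so the mode bounds with $G=0$ force it to
  -- vanish.
  have hmode : ∀ n, RenewalMode c 0 (modeKernel γ (freqSq Φ L) n)
      (fun t => dFT (T' (max t 0)) n - dFT (T (max t 0)) n) (fun _ => 0) := fun n =>
    { cont := (continuous_dFT hUc' n).sub (continuous_dFT hUc n)
      cont_source := continuous_const
      bound := fun t _ => by simp
      eq := fun t ht => by
        have hi : ∀ {S : ℝ → ZMod L → ℝ}, (∀ x, Continuous fun t => S (max t 0) x) →
            IntervalIntegrable (fun s => dFT (memKernel L Φ γ s) n * dFT (S (max (t - s) 0)) n)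
              volume 0 t := fun hS =>
          ((continuous_dFT h.continuous_memKernel n).mul
            ((continuous_dFT hS n).comp (continuous_const.sub continuous_id))).intervalIntegrable 0 t
        rw [dFT_renewal h.continuous_memKernel hUc' (hU'.2 t ht),
          dFT_renewal h.continuous_memKernel hUc (hU.2 t ht), add_sub_add_left_eq_sub, zero_add,
          ← intervalIntegral.integral_sub (hi hUc') (hi hUc)]
        simp only [h.dFT_memKernel, Complex.real_smul, mul_sub] }
  have hzero : ∀ n, dFT (T' (max t 0)) n = dFT (T (max t 0)) n := fun n => by
    rw [← sub_eq_zero, ← norm_le_zero_iff]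
    by_cases hn : n = 0
    · subst hn
      simpa using hb.equilibrium 0 _ _ (hmode 0) t ht
    · simpa using hb.decay n hn 0 _ _ (hmode n) t ht
  have := eq_of_dFT_eq hzero
  rw [max_eq_left ht] at this
  rw [this]

/-- The constant profile has only the zero mode, which is the limit of the zero mode of $T$. The
source size $G$ is proportional to $L\mathcal E$, and its factor $L$ cancels the $1/L$ of Fourier
inversion. -/
lemma ModeBounds.abs_sub_energyDensity_le (hb : ModeBounds Φ γ c C d L a) (hC : 0 ≤ C)
    (hd : 0 < d) (hM : 0 ≤ M) (h : GammaAssumption Φ γ) (hμ : HasSecondMoments L μ₀)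
    (hT : IsTempProfile L Φ γ μ₀ T) (hTc : ∀ x, Continuous fun t => T t x)
    (hG : ∀ t, 0 ≤ t → ∑ x, |source L Φ γ μ₀ t x| ≤
      M * (L * energyDensity L Φ μ₀) * Real.exp (-c * t)) {t : ℝ} (ht : 0 < t) (x : ZMod L) :
    |T t x - energyDensity L Φ μ₀| ≤ 3 * C * M * energyDensity L Φ μ₀ *
      (Real.exp (-d * t / (L : ℝ) ^ 2) / (1 - Real.exp (-2 * d * t / (L : ℝ) ^ 2))) := by
  have hL := natCast_pos_of_neZero (L := L)
  have hL1 : (1 : ℝ) ≤ L := by exact_mod_cast Nat.pos_of_ne_zero (NeZero.ne L)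
  have hE := h.energyDensity_nonneg (L := L) (μ₀ := μ₀)
  set E := energyDensity L Φ μ₀
  set G := M * (L * E) with hGd
  have hm := fun n => h.renewalMode hT hTc hG n
  have hlim : γ • ∫ s in Ioi (0 : ℝ), dFT (source L Φ γ μ₀ s) 0 = ((L * E : ℝ) : ℂ) := by
    rw [← h.integral_sum_source hμ]
    simp only [dFT_zero]
    rw [integral_complex_ofReal, Complex.real_smul, Complex.ofReal_mul]
  set q := Real.exp (-(d * t / (L : ℝ) ^ 2)) / (1 - Real.exp (-(2 * (d * t / (L : ℝ) ^ 2))))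
    with hq
  have hden : 0 < 1 - Real.exp (-(2 * (d * t / (L : ℝ) ^ 2))) := by
    rw [sub_pos, Real.exp_lt_one_iff]
    have : 0 < d * t / (L : ℝ) ^ 2 := by positivity
    linarith
  have hexp : Real.exp (-d * t) ≤ q := by
    have h1 : Real.exp (-d * t) ≤ Real.exp (-(d * t / (L : ℝ) ^ 2)) := by
      rw [Real.exp_le_exp, neg_mul, neg_le_neg_iff]
      exact div_le_self (by positivity) (one_le_pow₀ hL1)
    refine h1.trans (le_div_self (Real.exp_pos _).le hden ?_)
    linarith [Real.exp_pos (-(2 * (d * t / (L : ℝ) ^ 2)))]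
  -- One $q$ comes from the zero mode and two from the pairs $\pm n$.
  have hsum : ∑ n, ‖dFT (T t) n - dFT (fun _ : ZMod L => E) n‖ ≤ C * G * (3 * q) := by
    have hG0 : 0 ≤ G := by positivity
    rw [← Finset.add_sum_erase _ _ (Finset.mem_univ (0 : ZMod L))]
    have h0 : ‖dFT (T t) 0 - dFT (fun _ : ZMod L => E) 0‖ ≤ C * G * q := by
      rw [dFT_const, if_pos rfl, ← hlim]
      refine (hb.equilibrium G _ _ (hm 0) t ht.le).trans ?_
      gcongr
    have h1 : ∑ n ∈ Finset.univ.erase (0 : ZMod L),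
        ‖dFT (T t) n - dFT (fun _ : ZMod L => E) n‖ ≤ C * G * (2 * q) := by
      calc _ ≤ ∑ n ∈ Finset.univ.erase (0 : ZMod L),
            C * G * Real.exp (-(d * t * dualPt L n ^ 2)) :=
            Finset.sum_le_sum fun n hn => by
              have hn0 := (Finset.mem_erase.mp hn).1
              rw [dFT_const, if_neg hn0, sub_zero]
              exact hb.decay n hn0 G _ _ (hm n) t ht.le
        _ = C * G * ∑ n ∈ Finset.univ.erase (0 : ZMod L),
            Real.exp (-(d * t * dualPt L n ^ 2)) := by rw [Finset.mul_sum]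
        _ ≤ _ := mul_le_mul_of_nonneg_left
            (sum_exp_neg_dualPt_sq_le (mul_pos hd ht)) (by positivity)
    linarith
  have e1 : Real.exp (-d * t / (L : ℝ) ^ 2) / (1 - Real.exp (-2 * d * t / (L : ℝ) ^ 2)) = q := by
    rw [hq]; congr 2
    · ring
    · congr 1; ring
  rw [e1]
  calc |T t x - E| ≤ 1 / L * (C * G * (3 * q)) :=
        (abs_sub_le_sum_dFT (T t) (fun _ => E) x).trans (by gcongr)
    _ = _ := by rw [hGd]; field_simp

/-- The modes of $e^{-tD}\tau$ are the leading terms in `ModeBounds.diffusive`. Fast modes and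
remainders contribute $L\,e^{-dt}$ in total, slow ones $t^{-1}$ times a Gaussian sum; both are at
most a multiple of $L\,t^{-3/2}$. -/
lemma ModeBounds.abs_sub_diffFlow_le (hb : ModeBounds Φ γ c C d L a) (hC : 0 ≤ C)
    (hd : 0 < d) (hM : 0 ≤ M) (h : GammaAssumption Φ γ) (ha : IsEvenFn a)
    (hsrc : ∀ x, IntegrableOn (fun s => source L Φ γ μ₀ s x) (Ioi 0))
    (hT : IsTempProfile L Φ γ μ₀ T) (hTc : ∀ x, Continuous fun t => T t x)
    (hG : ∀ t, 0 ≤ t → ∑ x, |source L Φ γ μ₀ t x| ≤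
      M * (L * energyDensity L Φ μ₀) * Real.exp (-c * t)) {t : ℝ} (ht : 0 < t) (x : ZMod L) :
    |T t x - diffFlow L Φ γ t
      (circ a *ᵥ fun y => ∫ s in Ioi (0 : ℝ), source L Φ γ μ₀ s y) x| ≤
      C * M * (1 / d + 2 / d ^ 2 + Real.sqrt (Real.pi / d)) * energyDensity L Φ μ₀ * L *
        t ^ (-(3 / 2) : ℝ) := by
  have hL := natCast_pos_of_neZero (L := L)
  have hE := h.energyDensity_nonneg (L := L) (μ₀ := μ₀)
  set E := energyDensity L Φ μ₀
  set G := M * (L * E) with hGd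
  have hG0 : 0 ≤ G := by positivity
  have hm := fun n => h.renewalMode hT hTc hG n
  set τ := circ a *ᵥ fun y => ∫ s in Ioi (0 : ℝ), source L Φ γ μ₀ s y with hτ
  have hmode : ∀ n, ‖dFT (T t) n - dFT (diffFlow L Φ γ t τ) n‖ ≤
      C * G * (Real.exp (-d * t) +
        if n = 0 then 0 else 1 / t * Real.exp (-(d * t * dualPt L n ^ 2))) := fun n => by
    have e : dFT (diffFlow L Φ γ t τ) n =
        (a n * Real.exp (-t * diffRate γ (freqSq Φ L) n)) •
          ∫ s in Ioi (0 : ℝ), dFT (source L Φ γ μ₀ s) n := by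
      rw [h.dFT_diffFlow, hτ, dFT_circ_mulVec ha, dFT_integral hsrc, Complex.real_smul]
      push_cast; ring
    rw [e]
    exact hb.diffusive n G _ _ (hm n) t ht
  have hsum : ∑ n, ‖dFT (T t) n - dFT (diffFlow L Φ γ t τ) n‖ ≤
      C * G * (L * Real.exp (-d * t) + 1 / t * (L * Real.sqrt (Real.pi / (d * t)))) := by
    refine (Finset.sum_le_sum fun n _ => hmode n).trans ?_
    rw [← Finset.mul_sum, Finset.sum_add_distrib, Finset.sum_const, Finset.card_univ, ZMod.card,
      nsmul_eq_mul, ← Finset.add_sum_erase _ _ (Finset.mem_univ (0 : ZMod L)), if_pos rfl, zero_add,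
      Finset.sum_congr rfl fun n hn => if_neg (Finset.mem_erase.mp hn).1, ← Finset.mul_sum]
    have := sum_exp_neg_dualPt_sq_le_sqrt (L := L) (mul_pos hd ht)
    gcongr
  have h1 := exp_neg_mul_le_rpow hd ht
  have h2 := sqrt_pi_div_div (A := 1) ht hd
  calc _ ≤ 1 / L * (C * G * (L * Real.exp (-d * t) +
        1 / t * (L * Real.sqrt (Real.pi / (d * t))))) :=
        (abs_sub_le_sum_dFT (T t) _ x).trans (by gcongr)
    _ = C * M * E * L * (Real.exp (-d * t) + 1 / t * Real.sqrt (Real.pi / (d * t))) := by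
        rw [hGd]; field_simp
    _ ≤ C * M * E * L * ((1 / d + 2 / d ^ 2) * t ^ (-(3 / 2) : ℝ) +
        1 * Real.sqrt (Real.pi / d) * t ^ (-(3 / 2) : ℝ)) := by rw [h2]; gcongr
    _ = _ := by ring

end

end

end VelocityFlip

end

/-! ### Assembly of the theorem -/

open VelocityFlip

theorem theorem4p3 (Φ : ℤ → ℝ) (γ : ℝ) (hΦγ : GammaAssumption Φ γ) :
    ∃ (L₀ : ℕ) (C d ε₀ β : ℝ), 0 < C ∧ 0 < d ∧ 0 < ε₀ ∧ 0 < β ∧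
      ∀ (L : ℕ) [NeZero L], L₀ ≤ L →
        (∀ x : ZMod L, IntegrableOn (fun s => memKernel L Φ γ s x) (Ioi 0) ∧
          0 ≤ pTilde L Φ γ x) ∧
        ∃ R a : ZMod L → ℝ, IsRateAmplitude L Φ γ ε₀ β R a ∧
          ∀ (μ₀ : Measure (Phase L)) [IsProbabilityMeasure μ₀], HasSecondMoments L μ₀ →
            Integrable (hamiltonian L Φ) μ₀ ∧
            (∀ x : ZMod L, IntegrableOn (fun s => source L Φ γ μ₀ s x) (Ioi 0)) ∧
            ∃ T : ℝ → ZMod L → ℝ,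
              IsTempProfile L Φ γ μ₀ T ∧
              (∀ T' : ℝ → ZMod L → ℝ, IsTempProfile L Φ γ μ₀ T' →
                ∀ t : ℝ, 0 ≤ t → ∀ x : ZMod L, T' t x = T t x) ∧
              (∀ t : ℝ, 0 < t → ∀ x : ZMod L,
                |T t x - energyDensity L Φ μ₀| ≤
                  C * energyDensity L Φ μ₀ *
                    (Real.exp (-d * t / (L : ℝ) ^ 2) /
                      (1 - Real.exp (-2 * d * t / (L : ℝ) ^ 2)))) ∧
              ∃ τ : ZMod L → ℝ, (∀ x : ZMod L, (τ x : ℂ) = initProfile L Φ γ μ₀ a x) ∧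
                ∀ t : ℝ, 0 < t → ∀ x : ZMod L,
                  |T t x - diffFlow L Φ γ t τ x| ≤
                    C * energyDensity L Φ μ₀ * L * t ^ (-(3 / 2) : ℝ) := by
  obtain ⟨v₀, v₁, ho, hv01, hv⟩ := hΦγ.exists_overdamped
  obtain ⟨L₀, C, d, ε₀, β, hC, hd, hε₀, hβ, hmodes⟩ := hΦγ.exists_modeBounds ho hv01 hv
  have hc := ho.rate_pos
  have hv1 : 0 < v₁ := ho.pos.trans_le hv01
  obtain ⟨M, hM⟩ : ∃ M, M = 4 * respBound γ v₁ ^ 2 * (1 + v₁) := ⟨_, rfl⟩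
  have hM0 : 0 ≤ M := by rw [hM]; positivity
  obtain ⟨N, hN⟩ : ∃ N, N = 1 / d + 2 / d ^ 2 + Real.sqrt (Real.pi / d) := ⟨_, rfl⟩
  have hN0 : 0 ≤ N := by rw [hN]; positivity
  have hCM : 0 ≤ C * M := by positivity
  have hCMN : 0 ≤ C * M * N := by positivity
  -- One constant covers both estimates; the summand $1$ makes it strictly positive when $M$ and $N$
  -- are only known to be nonnegative.
  refine ⟨L₀, 3 * C * M + C * M * N + 1, d, ε₀, β, by linarith, hd, hε₀, hβ,
    fun L _ hL => ⟨fun x => ⟨hΦγ.integrableOn_memKernel x, hΦγ.pTilde_nonneg x⟩, ?_⟩⟩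
  obtain ⟨R, a, hRa, hb⟩ := hmodes L hL
  refine ⟨R, a, hRa, fun μ₀ _ hμ => ?_⟩
  have hE := hΦγ.energyDensity_nonneg (L := L) (μ₀ := μ₀)
  have hLpos := natCast_pos_of_neZero (L := L)
  set E := energyDensity L Φ μ₀
  have hG0 : 0 ≤ M * (L * E) := by positivity
  have hG : ∀ t, 0 ≤ t → ∑ x, |source L Φ γ μ₀ t x| ≤
      M * (L * E) * Real.exp (-respRate γ v₀ * t) := fun t ht => by
    rw [Finset.sum_congr rfl fun x _ => abs_of_nonneg (hΦγ.source_nonneg hμ t x)]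
    refine (hΦγ.sum_source_le ho hv hμ ht).trans ?_
    rw [← hM]
    gcongr
    linarith
  have hGx : ∀ t, 0 ≤ t → ∀ x, |source L Φ γ μ₀ t x| ≤
      M * (L * E) * Real.exp (-respRate γ v₀ * t) := fun t ht x =>
    (Finset.single_le_sum (f := fun x => |source L Φ γ μ₀ t x|) (fun y _ => abs_nonneg _)
      (Finset.mem_univ x)).trans (hG t ht)
  have hsrc : ∀ x, IntegrableOn (fun s => source L Φ γ μ₀ s x) (Ioi 0) := fun x =>
    integrableOn_Ioi_of_exp_bound hc (hΦγ.continuous_source x) fun s hs => hGx s hs x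
  obtain ⟨T, hT, hTc⟩ := hΦγ.exists_isTempProfile (μ₀ := μ₀) (G := M * (L * E)) fun t ht x =>
    (hGx t ht x).trans (mul_le_of_le_one_right hG0 (Real.exp_le_one_iff.mpr (by nlinarith)))
  have ha := hRa.isEvenFn hΦγ
  refine ⟨hΦγ.integrable_hamiltonian hμ, hsrc, T, hT, fun T' hT' t ht x =>
    hb.unique hΦγ hT hT' ht x, fun t ht x => ?_, _, fun x => initProfile_eq ha x,
    fun t ht x => ?_⟩
  · refine (hb.abs_sub_energyDensity_le hC.le hd hM0 hΦγ hμ hT hTc hG ht x).trans ?_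
    have hq : 0 ≤ Real.exp (-d * t / (L : ℝ) ^ 2) / (1 - Real.exp (-2 * d * t / (L : ℝ) ^ 2)) := by
      refine div_nonneg (Real.exp_pos _).le (sub_nonneg.mpr (Real.exp_le_one_iff.mpr ?_))
      exact div_nonpos_of_nonpos_of_nonneg (by nlinarith) (by positivity)
    gcongr
    linarith
  · refine (hb.abs_sub_diffFlow_le hC.le hd hM0 hΦγ ha hsrc hT hTc hG ht x).trans ?_
    rw [← hN]
    have : C * M * N ≤ 3 * C * M + C * M * N + 1 := by linarith
    gcongr
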